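/- Let $d\ge 2$ be an integer and let $(\Omega,\mathcal F,\mu)$ be a measure space with a $d$-adic system $\mathcal D=\{I_{n,k}\}_{n,k\in\mathbb Z}$: for each $n$ the sets $I_{n,k}$ ($k\in\mathbb Z$) partition $\Omega$, $I_{n,k}=\bigcup_{j=0}^{d-1}I_{n+1,kd+j}$, $\mu(I_{n,k})=d^{-n}$, and $\mathcal F$ is generated by all the $I_{n,k}$ (for example $\Omega=\mathbb R$ with Lebesgue measure and $I_{n,k}=[kd^{-n},(k+1)d^{-n})$). Write $|I|=\mu(I)$; call $g:\Omega\to\mathbb C$ locally integrable if it is integrable on every $I\in\mathcal D$; let $\mathbb E_n g=g_n=\sum_k \mathbb 1_{I_{n,k}}\frac1{|I_{n,k}|}\int_{I_{n,k}}g\,d\mu$ and $d_ng=g_n-g_{n-1}$. Let $\langle f,g\rangle=\int\overline f g\,d\mu$ and, for $I=I_{n,k}$ and $1\le i\le d-1$, $$h_I^i=d^{n/2}\sum_{j=0}^{d-1}e^{2\pi \mathrm i\, i(j+1)/d}\,\mathbb 1_{I_{n+1,kd+j}} .$$ Let $BMO^d$ be the space of locally integrable $a$ with $\|a\|_{BMO^d}=\sup_{n\in\mathbb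 Z}\big\|\mathbb E_n\big(\sum_{k\ge n+1}|d_ka|^2\big)\big\|_\infty^{1/2}<\infty$, and let $\boldsymbol B_p^d$ be the space of locally integrable $b$ with $\|b\|_{\boldsymbol B^d_p}=\big(\sum_{I\in\mathcal D}\sum_{i=1}^{d-1}|I|^{-p/2}|\langle h_I^i,b\rangle|^p\big)^{1/p}<\infty$. For a family $c$ with decreasing rearrangement $c^*(1)\ge c^*(2)\ge\dots$ let $\|c\|_{\ell_{p,q}}=\big(\sum_{m\ge1}m^{q/p-1}c^*(m)^q\big)^{1/q}$ for $q<\infty$ and $\|c\|_{\ell_{p,\infty}}=\sup_m m^{1/p}c^*(m)$. Let $S_{p,q}(L_2)$ be the class of compact operators $A$ on $L_2=L_2(\Omega,\mathbb C)$ with $\|A\|_{S_{p,q}}=\|(\lambda_n)_n\|_{\ell_{p,q}}<\infty$, where $A=\sum_n\lambda_n\langle e_n,\cdot\rangle f_n$ is a singular value decomposition, and let $S_p=S_{p,p}$. Let $0<p<\infty$, and let $a\in BMO^d$. Then $\pi_a f=\sum_{k\in\mathbb Z}d_ka\cdot f_{k-1}$ (unconditional convergence in $L_2$) defines a bounded operator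 $\pi_a$ on $L_2$. For $P\in\{\pi_a,\pi_a^*\}$ and $b$ locally integrable, the commutator $[P,M_b]f=P(bf)-bP(f)$ has the natural domain of all $f\in L_2$ with $bf\in L_2$ and $bP(f)\in L_2$. 1. Let $0<q\le\infty$. There is a constant $C$ depending only on $d,p,q$ such that if $b$ is locally integrable and $\{|I|^{-1/2}|\langle h_I^i,b\rangle|\}_{I\in\mathcal D,\,1\le i\le d-1}\in\ell_{p,q}$, then $[\pi_a,M_b]$ and $[\pi_a^*,M_b]$ are densely defined, extend to bounded operators on $L_2$, and these both belong to $S_{p,q}(L_2)$ with $$\|[\pi_a,M_b]\|_{S_{p,q}},\ \|[\pi_a^*,M_b]\|_{S_{p,q}}\le C\,\|a\|_{BMO^d}\,\Big\|\big\{|I|^{-1/2}|\langle h_I^i,b\rangle|\big\}_{I\in\mathcal D,\,1\le i\le d-1}\Big\|_{\ell_{p,q}} .$$ 2. In particular, there is a constant $C$ depending only on $d,p$ such that if $b\in\boldsymbol B_p^d$, then $[\pi_a,M_b]$ and $[\pi_a^*,M_b]$ (densely defined and extended in the same sense) both belong to $S_p(L_2)$ with $$\|[\pi_a,M_b]\|_{S_p},\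 \|[\pi_a^*,M_b]\|_{S_p}\le C\,\|a\|_{BMO^d}\,\|b\|_{\boldsymbol B_p^d} .$$ -/

import Mathlib

open MeasureTheory Filter Topology
open scoped ENNReal NNReal

noncomputable section

/-! ### Lorentz sequence spaces -/

/-- The decreasing rearrangement of a family of non-negative numbers (indexed from `m = 0`):
`c*(m)` is the least `s` such that at most `m` members of the family exceed `s`. -/
def decreasingRearrangement {ι : Type*} (c : ι → ℝ≥0∞) (m : ℕ) : ℝ≥0∞ :=
  sInf {s : ℝ≥0∞ | {i | s < c i}.encard ≤ m}

/-- The quasi-norm of the Lorentz space `ℓ_{p,q}`, with value `∞` off the space: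
`(∑_{m ≥ 1} m^{q/p-1} c*(m)^q)^{1/q}` for `q < ∞`, and `sup_{m ≥ 1} m^{1/p} c*(m)` for `q = ∞`
(here written with `m + 1` in place of `m`). -/
def lorentzNorm {ι : Type*} (p : ℝ) (q : ℝ≥0∞) (c : ι → ℝ≥0∞) : ℝ≥0∞ :=
  if q = ⊤ then
    ⨆ m : ℕ, ((m : ℝ≥0∞) + 1) ^ (1 / p) * decreasingRearrangement c m
  else
    (∑' m : ℕ, ((m : ℝ≥0∞) + 1) ^ (q.toReal / p - 1) *
      decreasingRearrangement c m ^ q.toReal) ^ (1 / q.toReal)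

/-! ### Schatten-Lorentz classes -/

section Schatten

variable {H : Type*} [NormedAddCommGroup H] [InnerProductSpace ℂ H]

/-- A singular value decomposition `A ξ = ∑ₙ λₙ ⟨eₙ, ξ⟩ fₙ`. The vectors with a non-zero
coefficient form orthonormal systems; those with `λₙ = 0` play no role, so that operators of
finite rank are covered as well. -/
structure IsSingularValueDecomposition (A : H →L[ℂ] H) (lam : ℕ → ℂ) (e f : ℕ → H) : Prop where
  orthonormal_left : Orthonormal ℂ (fun n : {n : ℕ // lam n ≠ 0} => e n)
  orthonormal_right : Orthonormal ℂ (fun n : {n : ℕ // lam n ≠ 0} => f n)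
  hasSum : ∀ ξ : H, HasSum (fun n => (lam n * inner ℂ (e n) ξ) • f n) (A ξ)

/-- The quasi-norm of `S_{p,q}(H)`: the `ℓ_{p,q}` quasi-norm of the coefficients of a singular
value decomposition. (It is the same for all decompositions of a compact operator, so the infimum
only serves to pick the common value; it is `∞` when there is no decomposition.) -/
def schattenLorentzNorm (p : ℝ) (q : ℝ≥0∞) (A : H →L[ℂ] H) : ℝ≥0∞ :=
  ⨅ (lam : ℕ → ℂ) (e : ℕ → H) (f : ℕ → H) (_ : IsSingularValueDecomposition A lam e f),
    lorentzNorm p q (fun n => ‖lam n‖ₑ)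

/-- Membership in the Schatten-Lorentz class `S_{p,q}(H)`. -/
def MemSchattenLorentz (p : ℝ) (q : ℝ≥0∞) (A : H →L[ℂ] H) : Prop :=
  IsCompactOperator A ∧ schattenLorentzNorm p q A < ⊤

end Schatten

/-! ### `d`-adic systems and martingales -/

/-- A `d`-adic system `(I_{n,k})` on the measure space `(Ω, 𝓕, μ)`, where `𝓕` is the `σ`-algebra
generated by all the `d`-adic intervals. -/
structure DAdicSystem (d : ℕ) {Ω : Type*} [mΩ : MeasurableSpace Ω] (μ : Measure Ω) where
  /-- the `d`-adic interval `I_{n,k}` -/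
  I : ℤ → ℤ → Set Ω
  disjoint : ∀ n : ℤ, Pairwise fun k l => Disjoint (I n k) (I n l)
  cover : ∀ n : ℤ, ⋃ k, I n k = Set.univ
  children : ∀ n k : ℤ, I n k = ⋃ j : Fin d, I (n + 1) (k * d + (j : ℕ))
  measure_eq : ∀ n k : ℤ, μ (I n k) = (d : ℝ≥0∞) ^ (-n)
  generate : mΩ = MeasurableSpace.generateFrom {s | ∃ n k : ℤ, s = I n k}

namespace DAdicSystem

variable {d : ℕ} {Ω : Type*} [MeasurableSpace Ω] {μ : Measure Ω} (D : DAdicSystem d μ)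

/-- Locally integrable functions: integrable on each `d`-adic interval. -/
def LocallyIntegrable (g : Ω → ℂ) : Prop :=
  ∀ n k : ℤ, IntegrableOn g (D.I n k) μ

/-- The conditional expectation `𝔼ₙ g = ∑ₖ 1_{I_{n,k}} μ(I_{n,k})⁻¹ ∫_{I_{n,k}} g dμ`. -/
def condExpect (n : ℤ) (g : Ω → ℂ) (x : Ω) : ℂ :=
  ∑' k : ℤ, (D.I n k).indicator (fun _ => ⨍ y in D.I n k, g y ∂μ) x

/-- The conditional expectation `𝔼ₙ g` of a function with values in `[0, ∞]`. -/
def lcondExpect (n : ℤ) (g : Ω → ℝ≥0∞) (x : Ω) : ℝ≥0∞ :=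
  ∑' k : ℤ, (D.I n k).indicator (fun _ => ⨍⁻ y in D.I n k, g y ∂μ) x

/-- The martingale difference `dₙ g = 𝔼ₙ g - 𝔼ₙ₋₁ g`. -/
def martDiff (n : ℤ) (g : Ω → ℂ) (x : Ω) : ℂ :=
  D.condExpect n g x - D.condExpect (n - 1) g x

/-- The Haar wavelet `h_I^i = d^{n/2} ∑_{j=0}^{d-1} ω^{i(j+1)} 1_{I_{n+1,kd+j}}`, `I = I_{n,k}`,
`ω = e^{2πi/d}`. -/
def haar (n k : ℤ) (i : ℕ) (x : Ω) : ℂ :=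
  (((d : ℝ) ^ ((n : ℝ) / 2) : ℝ) : ℂ) *
    ∑ j : Fin d, (D.I (n + 1) (k * d + (j : ℕ))).indicator
      (fun _ => Complex.exp (2 * Real.pi * Complex.I / d) ^ (i * ((j : ℕ) + 1))) x

/-- The Haar coefficient `⟨h_I^i, b⟩`, `I = I_{n,k}` (conjugate-linear in the first variable). -/
def haarCoeff (b : Ω → ℂ) (n k : ℤ) (i : ℕ) : ℂ :=
  ∫ x, (starRingEnd ℂ) (D.haar n k i x) * b x ∂μ

/-- The family `|I|^{-1/2} |⟨h_I^i, b⟩|`, indexed by `I = I_{n,k}` and `1 ≤ i ≤ d - 1`. -/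
def haarSeq (b : Ω → ℂ) (t : ℤ × ℤ × Finset.Icc 1 (d - 1)) : ℝ≥0∞ :=
  μ (D.I t.1 t.2.1) ^ (-(1 / 2) : ℝ) * ‖D.haarCoeff b t.1 t.2.1 t.2.2‖ₑ

/-- The norm of the martingale Besov space `B_p^d`, with value `∞` off the space. -/
def besovNorm (p : ℝ) (b : Ω → ℂ) : ℝ≥0∞ :=
  (∑' t : ℤ × ℤ × Finset.Icc 1 (d - 1),
    ‖D.haarCoeff b t.1 t.2.1 t.2.2‖ₑ ^ p / μ (D.I t.1 t.2.1) ^ (p / 2)) ^ (1 / p)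

/-- Membership in the martingale Besov space `B_p^d`. -/
def MemBesov (p : ℝ) (b : Ω → ℂ) : Prop :=
  D.LocallyIntegrable b ∧ D.besovNorm p b < ⊤

/-- The norm `supₙ ‖𝔼ₙ(∑_{k ≥ n+1} |d_k a|²)‖_∞^{1/2}` of the martingale space `BMO^d`. -/
def bmoNorm (a : Ω → ℂ) : ℝ≥0∞ :=
  ⨆ n : ℤ, essSup
    (D.lcondExpect n fun x => ∑' k : ℕ, ‖D.martDiff (n + 1 + k) a x‖ₑ ^ 2) μ ^ (1 / 2 : ℝ)

/-- Membership in the martingale space `BMO^d`. -/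
def MemBMO (a : Ω → ℂ) : Prop :=
  D.LocallyIntegrable a ∧ D.bmoNorm a < ⊤

/-- The bounded operator `P` on `L₂` is the martingale paraproduct `π_a`:
`P f = ∑_{k ∈ ℤ} d_k a · f_{k-1}`, with (unconditional) convergence in `L₂`, for all `f ∈ L₂`. -/
def IsParaproduct (a : Ω → ℂ) (P : Lp ℂ 2 μ →L[ℂ] Lp ℂ 2 μ) : Prop :=
  ∀ f : Lp ℂ 2 μ, Tendsto
    (fun s : Finset ℤ => eLpNorm
      (fun x => P f x - ∑ k ∈ s, D.martDiff k a x * D.condExpect (k - 1) f x) 2 μ)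
    atTop (𝓝 0)

end DAdicSystem

/-! ### Commutators with multiplication operators -/

/-- The bounded operator `T` on `L₂` is the commutator `[P, M_b] = P M_b - M_b P` of a bounded
operator with the (possibly unbounded) operator `M_b` of multiplication by `b`: the natural domain
of `P M_b - M_b P`, namely all `f ∈ L₂` with `b f ∈ L₂` and `b (P f) ∈ L₂`, is dense in `L₂`, and
`T` is the bounded extension of `P M_b - M_b P` from it. -/
structure IsCommutator {Ω : Type*} [MeasurableSpace Ω] {μ : Measure Ω}
    (P : Lp ℂ 2 μ →L[ℂ] Lp ℂ 2 μ) (b : Ω → ℂ) (T : Lp ℂ 2 μ →L[ℂ] Lp ℂ 2 μ) : Prop where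
  dense : Dense {f : Lp ℂ 2 μ | MemLp (fun x => b x * f x) 2 μ ∧ MemLp (fun x => b x * P f x) 2 μ}
  eq : ∀ (f : Lp ℂ 2 μ) (h₁ : MemLp (fun x => b x * f x) 2 μ)
    (h₂ : MemLp (fun x => b x * P f x) 2 μ),
    T f = P (h₁.toLp (fun x => b x * f x)) - h₂.toLp (fun x => b x * P f x)

end

noncomputable section

/-! ### Decreasing rearrangements -/

section Rearrangement

variable {ι : Type*} (c : ι → ℝ≥0∞)

/-! The commutator is estimated through its matrix in the Haar basis. Since `π_a h_K = ∑ₗ h_K|_{K_l}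
1_{K_l} (a - a_{K_l})`, where `a_{K_l}` is the mean over the child `K_l`, the entry between `h_J`
and `h_K` vanishes for disjoint `J`, `K`. For nested nodes `N` generations apart, cancellation
leaves only the deviation of `b` from its mean on the smaller node, say `J`, and the entry is at
most a constant times `‖a‖_BMO (N + 1) d^{-N/2} s_J`, where `s_J²` is `|J|⁻¹` times the sum of the
squared Haar coefficients of `b` at all nodes below `J` (`norm_commMatrix_up_sq_le`,
`norm_commMatrix_down_sq_le`). The factor `N + 1` is the growth of the means of `a` along a branch.

Such almost diagonal matrices obey weak type estimates for every exponent `r > 0`. The entries at a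
fixed distance `N` form finitely many sums of orthogonal rank-one blocks; discarding the `m` largest
blocks bounds the `m`-th approximation number by `(m + 1)^{-1/r}` times the `ℓ_r` norm of the block
sizes. These sizes are quadratic means over `d^N` descendants, which yields a factor geometric in
`N` and makes the sum over `N` converge even though the weak ideal is only quasi-normed
(`HilbertBasis.exists_almostDiagonal`). Moreover `s_J²` is a sum over generations of means of the
squared normalized coefficients, so `‖s‖_r` is controlled by their `ℓ_r` norm
(`tsum_treeEnergy_rpow_le`).

Real interpolation between the exponents `p/2` and `2p` gives `ℓ_{p,q}`: at each dyadic height the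
coefficients are cut into large and small ones, the matrix entries are distributed according to
which part dominates the energy at the lower node, and dyadic Hardy inequalities combine the two
bounds (`lorentzSeqNorm_le_of_dyadic`, `HilbertBasis.exists_almostDiagonal_lorentz`). Approximation
numbers dominate the coefficients of a singular value decomposition, whence the Schatten-Lorentz
norm.

It remains to connect matrices with operators. The paraproduct is bounded by the Carleson embedding
theorem, proved with a Bellman function. The Haar wavelets lie in the natural domain of the
commutator because products of deviations of `a` and `b` are square integrable
(`memLp_dev_mul_dev`), and duality extends the matrix identity to the whole natural domain. Finally
`[π_a^*, M_b]` is minus the adjoint of the commutator of `π_a` with the conjugate of `b`, which has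
the same energies as `b`. -/

theorem encard_decreasingRearrangement_lt_le (m : ℕ) :
    {i | decreasingRearrangement c m < c i}.encard ≤ m := by
  by_contra h
  push Not at h
  obtain ⟨t, hts, htc⟩ := Set.exists_subset_encard_eq (Order.add_one_le_of_lt h)
  have htf : t.Finite := Set.finite_of_encard_eq_coe (k := m + 1) (by simpa using htc)
  have hne : t.Nonempty := by
    rw [← Set.encard_ne_zero, htc]; simp
  -- The infimum is attained: the least of `m + 1` members exceeding it would exceed an admissible
  -- level `s`, which then all `m + 1` members exceed.
  obtain ⟨i₀, hi₀, hmin⟩ := htf.exists_minimalFor c t hne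
  have hlt : sInf {s : ℝ≥0∞ | {i | s < c i}.encard ≤ m} < c i₀ := hts hi₀
  obtain ⟨s, hs, hsl⟩ := sInf_lt_iff.1 hlt
  have hsub : t ⊆ {i | s < c i} := by
    intro i hi
    rcases le_total (c i₀) (c i) with h1 | h1
    · exact hsl.trans_le h1
    · exact hsl.trans_le (hmin hi h1)
  have := (Set.encard_le_encard hsub).trans hs
  rw [htc] at this
  exact absurd this (not_le.2 (by exact_mod_cast Nat.lt_succ_self m))

theorem decreasingRearrangement_le_iff {m : ℕ} {s : ℝ≥0∞} :
    decreasingRearrangement c m ≤ s ↔ {i | s < c i}.encard ≤ m := by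
  constructor
  · intro h
    refine (Set.encard_le_encard ?_).trans (encard_decreasingRearrangement_lt_le c m)
    intro i hi
    exact lt_of_le_of_lt h hi
  · intro h
    exact sInf_le h

theorem decreasingRearrangement_antitone : Antitone (decreasingRearrangement c) := by
  intro m n hmn
  rw [decreasingRearrangement_le_iff]
  exact (encard_decreasingRearrangement_lt_le c m).trans (by exact_mod_cast hmn)

theorem le_decreasingRearrangement_zero (i : ι) : c i ≤ decreasingRearrangement c 0 := by
  have h := encard_decreasingRearrangement_lt_le c 0
  simp only [Nat.cast_zero, nonpos_iff_eq_zero, Set.encard_eq_zero] at h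
  by_contra hi
  push Not at hi
  exact (Set.mem_empty_iff_false i).1 (h ▸ hi)

theorem decreasingRearrangement_comp_equiv {κ : Type*} (e : κ ≃ ι) (m : ℕ) :
    decreasingRearrangement (fun k => c (e k)) m = decreasingRearrangement c m := by
  unfold decreasingRearrangement
  congr 1
  ext s
  have : {i | s < c (e i)} = e ⁻¹' {i | s < c i} := rfl
  rw [Set.mem_ofPred_eq, Set.mem_ofPred_eq, this, Set.encard_preimage_of_bijective e.bijective]

/-- By the Galois property of the rearrangement, the set on the left is an initial segment of `ℕ` of
the right length. This is equimeasurability. -/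
theorem encard_lt_decreasingRearrangement (s : ℝ≥0∞) :
    {m : ℕ | s < decreasingRearrangement c m}.encard = {i | s < c i}.encard := by
  have h : {m : ℕ | s < decreasingRearrangement c m} = {m : ℕ | (m : ℕ∞) < {i | s < c i}.encard} := by
    ext m
    rw [Set.mem_ofPred_eq, Set.mem_ofPred_eq, ← not_le, decreasingRearrangement_le_iff, not_le]
  rw [h]
  generalize {i | s < c i}.encard = N
  induction N using ENat.recTopCoe with
  | top => simp
  | coe n =>
    have : {m : ℕ | (m : ℕ∞) < (n : ℕ∞)} = ↑(Finset.range n) := by ext; simp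
    rw [this, Set.encard_coe_eq_coe_finsetCard, Finset.card_range]

end Rearrangement

theorem ENNReal.tsum_indicator_one {ι : Type*} (s : Set ι) :
    ∑' i, s.indicator (fun _ => (1 : ℝ≥0∞)) i = (s.encard : ℝ≥0∞) := by
  rw [← tsum_subtype s (fun _ => (1 : ℝ≥0∞)), ENNReal.tsum_set_one]

/-- The layer-cake formula for counting measure. The right side sees only the distribution function,
so equimeasurable families have equal sums. -/
theorem ENNReal.tsum_rpow_eq_lintegral_encard {ι : Type*} (f : ι → ℝ≥0∞) (hf : ∀ i, f i ≠ ⊤)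
    {p : ℝ} (hp : 0 < p) :
    ∑' i, f i ^ p = ENNReal.ofReal p *
      ∫⁻ t in Set.Ioi (0 : ℝ), ({i | ENNReal.ofReal t < f i}.encard : ℝ≥0∞) *
        ENNReal.ofReal (t ^ (p - 1)) := by
  let _ : MeasurableSpace ι := ⊤
  have h := lintegral_rpow_eq_lintegral_meas_lt_mul (μ := Measure.count)
    (f := fun k : ι => (f k).toReal) (Filter.Eventually.of_forall fun k => ENNReal.toReal_nonneg)
    (measurable_from_top.aemeasurable) hp
  rw [lintegral_count' measurable_from_top] at h
  have h1 : ∀ i, ENNReal.ofReal ((f i).toReal ^ p) = f i ^ p := fun i => by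
    rw [← ENNReal.ofReal_rpow_of_nonneg ENNReal.toReal_nonneg hp.le, ENNReal.ofReal_toReal (hf i)]
  simp_rw [h1] at h
  rw [h]
  congr 1
  refine setLIntegral_congr_fun measurableSet_Ioi fun t ht => ?_
  rw [Measure.count_apply (MeasurableSpace.measurableSet_top)]
  simp_rw [← ENNReal.ofReal_lt_iff_lt_toReal (le_of_lt ht) (hf _)]

/-- Part of the equimeasurability of a family and its decreasing rearrangement. -/
theorem tsum_decreasingRearrangement_rpow_le {ι : Type*} (c : ι → ℝ≥0∞) {p : ℝ} (hp : 0 < p)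
    (hc : ∑' i, c i ^ p < ⊤) :
    ∑' m, decreasingRearrangement c m ^ p ≤ ∑' i, c i ^ p := by
  have hci : ∀ i, c i ≠ ⊤ := by
    intro i hi
    have := (ENNReal.le_tsum i).trans_lt hc
    rw [hi, ENNReal.top_rpow_of_pos hp] at this
    exact lt_irrefl _ this
  have hsup : decreasingRearrangement c 0 ≠ ⊤ := by
    intro h
    have h1 : decreasingRearrangement c 0 ≤ (∑' i, c i ^ p) ^ p⁻¹ := by
      rw [decreasingRearrangement_le_iff]
      simp only [Nat.cast_zero, nonpos_iff_eq_zero, Set.encard_eq_zero]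
      ext i
      simp only [Set.mem_ofPred_eq, Set.mem_empty_iff_false, iff_false, not_lt]
      rw [ENNReal.le_rpow_inv_iff hp]
      exact ENNReal.le_tsum i
    rw [h, top_le_iff, ENNReal.rpow_eq_top_iff_of_pos (by positivity)] at h1
    exact hc.ne h1
  have hd : ∀ m, decreasingRearrangement c m ≠ ⊤ := fun m =>
    ne_top_of_le_ne_top hsup (decreasingRearrangement_antitone c (Nat.zero_le m))
  rw [ENNReal.tsum_rpow_eq_lintegral_encard _ hd hp, ENNReal.tsum_rpow_eq_lintegral_encard _ hci hp]
  simp_rw [encard_lt_decreasingRearrangement]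
  exact le_rfl

theorem lorentzNorm_self_le {ι : Type*} (c : ι → ℝ≥0∞) {p : ℝ} (hp : 0 < p)
    (hc : ∑' i, c i ^ p < ⊤) :
    lorentzNorm p (ENNReal.ofReal p) c ≤ (∑' i, c i ^ p) ^ (1 / p) := by
  rw [lorentzNorm, if_neg ENNReal.ofReal_ne_top, ENNReal.toReal_ofReal hp.le]
  refine ENNReal.rpow_le_rpow ?_ (by positivity)
  simp only [div_self hp.ne', sub_self, ENNReal.rpow_zero, one_mul]
  exact tsum_decreasingRearrangement_rpow_le c hp hc

/-! ### Dyadic discretization -/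

theorem ENNReal.two_rpow_add (x y : ℝ) : (2 : ℝ≥0∞) ^ (x + y) = 2 ^ x * 2 ^ y :=
  ENNReal.rpow_add _ _ two_ne_zero ENNReal.ofNat_ne_top

/-- With indices starting at `0`, the `k`-th block consists of the `m` with `2 ^ k ≤ m + 1 < 2 ^ (k
+ 1)`. -/
theorem ENNReal.tsum_eq_tsum_dyadic (f : ℕ → ℝ≥0∞) :
    ∑' m, f m = ∑' k : ℕ, ∑ j ∈ Finset.range (2 ^ k), f (2 ^ k - 1 + j) := by
  have h : ∀ n, ∑ m ∈ Finset.range (2 ^ n - 1), f m =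
      ∑ k ∈ Finset.range n, ∑ j ∈ Finset.range (2 ^ k), f (2 ^ k - 1 + j) := by
    intro n
    induction n with
    | zero => simp
    | succ n ih =>
      rw [Finset.sum_range_succ, ← ih, ← Finset.sum_range_add]
      congr 2
      have := Nat.one_le_two_pow (n := n)
      rw [pow_succ]; omega
  have h1 := ENNReal.tendsto_nat_tsum f
  have h2 := ENNReal.tendsto_nat_tsum fun k => ∑ j ∈ Finset.range (2 ^ k), f (2 ^ k - 1 + j)
  have h3 : Tendsto (fun n : ℕ => 2 ^ n - 1) atTop atTop :=
    (tendsto_sub_atTop_nat 1).comp (tendsto_pow_atTop_atTop_of_one_lt (by norm_num))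
  have h4 := h1.comp h3
  simp only [Function.comp_def, h] at h4
  exact tendsto_nhds_unique h4 h2

/-- The tail form of the geometric series used in the estimates below. -/
theorem ENNReal.tsum_two_rpow_neg_mul {a : ℝ} (ha : 0 < a) :
    ∑' l : ℕ, (2 : ℝ≥0∞) ^ (-(a * l)) < ⊤ := by
  have h : ∀ l : ℕ, (2 : ℝ≥0∞) ^ (-(a * l)) = ((2 : ℝ≥0∞) ^ (-a)) ^ l := by
    intro l
    rw [← ENNReal.rpow_natCast, ← ENNReal.rpow_mul]; ring_nf
  simp_rw [h]
  rw [ENNReal.tsum_geometric]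
  refine ENNReal.inv_lt_top.2 (tsub_pos_of_lt ?_)
  exact ENNReal.rpow_lt_one_of_one_lt_of_neg (by norm_num) (by linarith)

theorem ENNReal.tsum_int_two_rpow_neg_abs_mul {a : ℝ} (ha : 0 < a) :
    ∑' n : ℤ, (2 : ℝ≥0∞) ^ (-(a * |(n : ℝ)|)) < ⊤ := by
  have h0 : ∑' l : ℕ, (2 : ℝ≥0∞) ^ (-(a * |(((l : ℕ) : ℤ) : ℝ)|)) < ⊤ := by
    simpa using ENNReal.tsum_two_rpow_neg_mul ha
  have h1 : ∑' l : ℕ, (2 : ℝ≥0∞) ^ (-(a * |((-((l : ℤ) + 1) : ℤ) : ℝ)|)) < ⊤ := by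
    refine lt_of_le_of_lt (ENNReal.tsum_le_tsum fun l => ?_) (ENNReal.tsum_two_rpow_neg_mul ha)
    refine ENNReal.rpow_le_rpow_of_exponent_le (by norm_num) ?_
    push_cast
    rw [abs_neg, abs_of_nonneg (by positivity)]
    nlinarith
  have h := HasSum.of_nat_of_neg_add_one
    (f := fun n : ℤ => (2 : ℝ≥0∞) ^ (-(a * |(n : ℝ)|)))
    ENNReal.summable.hasSum ENNReal.summable.hasSum
  rw [h.tsum_eq]
  exact ENNReal.add_lt_top.2 ⟨h0, h1⟩

/-- The `ℓ_{p,q}` functional applied to a sequence that is already decreasing. -/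
def lorentzSeqNorm (p : ℝ) (q : ℝ≥0∞) (x : ℕ → ℝ≥0∞) : ℝ≥0∞ :=
  if q = ⊤ then
    ⨆ m : ℕ, ((m : ℝ≥0∞) + 1) ^ (1 / p) * x m
  else
    (∑' m : ℕ, ((m : ℝ≥0∞) + 1) ^ (q.toReal / p - 1) * x m ^ q.toReal) ^ (1 / q.toReal)

theorem lorentzNorm_eq {ι : Type*} (p : ℝ) (q : ℝ≥0∞) (c : ι → ℝ≥0∞) :
    lorentzNorm p q c = lorentzSeqNorm p q (decreasingRearrangement c) := rfl

theorem ENNReal.rpow_le_rpow_of_exponent_nonpos {x y : ℝ≥0∞} {z : ℝ} (hz : z ≤ 0) (h : x ≤ y) :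
    y ^ z ≤ x ^ z := by
  rw [← neg_neg z, ENNReal.rpow_neg y, ENNReal.rpow_neg x, ENNReal.inv_le_inv]
  exact ENNReal.rpow_le_rpow h (by linarith)

/-- On a dyadic block the weight is constant up to the factor `2 ^ |β|`, whatever the sign of the
exponent. -/
theorem ENNReal.cast_add_one_rpow_le {m k : ℕ} (h1 : 2 ^ k ≤ m + 1) (h2 : m + 1 ≤ 2 ^ (k + 1))
    (β : ℝ) : ((m : ℝ≥0∞) + 1) ^ β ≤ 2 ^ |β| * 2 ^ (k * β) := by
  have e1 : (2 : ℝ≥0∞) ^ (k : ℝ) ≤ (m : ℝ≥0∞) + 1 := by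
    rw [ENNReal.rpow_natCast]; exact_mod_cast h1
  have e2 : (m : ℝ≥0∞) + 1 ≤ (2 : ℝ≥0∞) ^ ((k : ℝ) + 1) := by
    have : (k : ℝ) + 1 = ((k + 1 : ℕ) : ℝ) := by push_cast; ring
    rw [this, ENNReal.rpow_natCast]; exact_mod_cast h2
  rw [← ENNReal.two_rpow_add]
  rcases le_total 0 β with hβ | hβ
  · refine (ENNReal.rpow_le_rpow e2 hβ).trans ?_
    rw [← ENNReal.rpow_mul, abs_of_nonneg hβ]
    exact ENNReal.rpow_le_rpow_of_exponent_le (by norm_num) (by linarith)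
  · refine (ENNReal.rpow_le_rpow_of_exponent_nonpos hβ e1).trans ?_
    rw [← ENNReal.rpow_mul]
    exact ENNReal.rpow_le_rpow_of_exponent_le (by norm_num) (by linarith [abs_nonneg β])

theorem ENNReal.le_cast_add_one_rpow {m k : ℕ} (h1 : 2 ^ k ≤ m + 1) (h2 : m + 1 ≤ 2 ^ (k + 1))
    (β : ℝ) : (2 : ℝ≥0∞) ^ ((k + 1) * β) ≤ 2 ^ |β| * ((m : ℝ≥0∞) + 1) ^ β := by
  have h := ENNReal.cast_add_one_rpow_le h1 h2 (-β)
  have e1 : (2 : ℝ≥0∞) ^ (k : ℝ) ≤ (m : ℝ≥0∞) + 1 := by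
    rw [ENNReal.rpow_natCast]; exact_mod_cast h1
  have e2 : (m : ℝ≥0∞) + 1 ≤ (2 : ℝ≥0∞) ^ ((k : ℝ) + 1) := by
    have : (k : ℝ) + 1 = ((k + 1 : ℕ) : ℝ) := by push_cast; ring
    rw [this, ENNReal.rpow_natCast]; exact_mod_cast h2
  rcases le_total 0 β with hβ | hβ
  · have := ENNReal.rpow_le_rpow e1 hβ
    rw [← ENNReal.rpow_mul] at this
    refine le_trans (le_of_eq ?_) (mul_le_mul_right this (2 ^ |β|))
    rw [abs_of_nonneg hβ, ← ENNReal.two_rpow_add]; ring_nf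
  · have := ENNReal.rpow_le_rpow_of_exponent_nonpos hβ e2
    rw [← ENNReal.rpow_mul] at this
    refine this.trans (le_mul_of_one_le_left' ?_)
    have := ENNReal.rpow_le_rpow_of_exponent_le (x := 2) (by norm_num) (abs_nonneg β)
    rwa [ENNReal.rpow_zero] at this

/-- The maximal function controlling dyadic sums in the Hardy inequality. -/
def dyadicMax (p : ℝ) (X : ℕ → ℝ≥0∞) (k : ℕ) : ℝ≥0∞ :=
  ⨆ i : ℕ, 2 ^ ((i : ℝ) / p - |(k : ℝ) - i| / (4 * p)) * X i

theorem le_dyadicMax (p : ℝ) (X : ℕ → ℝ≥0∞) (k i : ℕ) :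
    X i ≤ 2 ^ (-((i : ℝ) / p) + |(k : ℝ) - i| / (4 * p)) * dyadicMax p X k := by
  have h : (2 : ℝ≥0∞) ^ ((i : ℝ) / p - |(k : ℝ) - i| / (4 * p)) * X i ≤ dyadicMax p X k :=
    le_iSup (fun i : ℕ => (2 : ℝ≥0∞) ^ ((i : ℝ) / p - |(k : ℝ) - i| / (4 * p)) * X i) i
  calc X i = 2 ^ (-((i : ℝ) / p) + |(k : ℝ) - i| / (4 * p)) *
        (2 ^ ((i : ℝ) / p - |(k : ℝ) - i| / (4 * p)) * X i) := by
        rw [← mul_assoc, ← ENNReal.two_rpow_add]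
        ring_nf
        simp
    _ ≤ _ := by gcongr

/-- By `le_dyadicMax`, the `i`-th term is at most `2^{k/2 - 3(k-i)/8} M^{p/2}`: the slack `1/(4p)`
in the maximal function uses up `1/8` of the decay `1/2`, and a geometric series remains. -/
theorem dyadic_head_le {p : ℝ} (hp : 0 < p) (X : ℕ → ℝ≥0∞) (k : ℕ) :
    (2 ^ (-(k : ℝ)) * ∑ i ∈ Finset.range k, 2 ^ (i : ℝ) * X i ^ (p / 2)) ^ (2 / p) ≤
      (∑' l : ℕ, (2 : ℝ≥0∞) ^ (-(3 / 8 * l : ℝ))) ^ (2 / p) *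
        (2 ^ (-((k : ℝ) / p)) * dyadicMax p X k) := by
  set M := dyadicMax p X k
  set G := ∑' l : ℕ, (2 : ℝ≥0∞) ^ (-(3 / 8 * l : ℝ))
  have h1 : ∑ i ∈ Finset.range k, (2 : ℝ≥0∞) ^ (i : ℝ) * X i ^ (p / 2) ≤
      2 ^ ((k : ℝ) / 2) * M ^ (p / 2) * G := by
    have h2 : ∀ i ∈ Finset.range k, (2 : ℝ≥0∞) ^ (i : ℝ) * X i ^ (p / 2) ≤
        2 ^ ((k : ℝ) / 2) * M ^ (p / 2) * 2 ^ (-(3 / 8 * ((k - 1 - i : ℕ) : ℝ))) := by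
      intro i hi
      have hik : i < k := Finset.mem_range.1 hi
      have := ENNReal.rpow_le_rpow (le_dyadicMax p X k i) (show 0 ≤ p / 2 by positivity)
      rw [ENNReal.mul_rpow_of_nonneg _ _ (by positivity), ← ENNReal.rpow_mul] at this
      calc (2 : ℝ≥0∞) ^ (i : ℝ) * X i ^ (p / 2) ≤ 2 ^ (i : ℝ) * _ := mul_le_mul_right this _
        _ = 2 ^ ((i : ℝ) + (-((i : ℝ) / p) + |(k : ℝ) - i| / (4 * p)) * (p / 2)) * M ^ (p / 2) := by
          rw [← mul_assoc, ← ENNReal.two_rpow_add]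
        _ ≤ 2 ^ ((k : ℝ) / 2 + -(3 / 8 * ((k - 1 - i : ℕ) : ℝ))) * M ^ (p / 2) := by
          refine mul_le_mul_left (ENNReal.rpow_le_rpow_of_exponent_le (by norm_num) ?_) _
          · have hk : ((k - 1 - i : ℕ) : ℝ) = (k : ℝ) - 1 - i := by
              rw [Nat.cast_sub (by omega), Nat.cast_sub (by omega)]; simp
            have hik' : (i : ℝ) + 1 ≤ k := by exact_mod_cast hik
            rw [hk, abs_of_nonneg (by linarith)]
            field_simp
            ring_nf
            nlinarith
        _ = _ := by rw [ENNReal.two_rpow_add]; ring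
    refine (Finset.sum_le_sum h2).trans ?_
    rw [← Finset.mul_sum]
    refine mul_le_mul_right ?_ _
    rw [Finset.sum_range_reflect (fun l : ℕ => (2 : ℝ≥0∞) ^ (-(3 / 8 * (l : ℝ))))]
    exact ENNReal.sum_le_tsum _
  calc (2 ^ (-(k : ℝ)) * ∑ i ∈ Finset.range k, (2 : ℝ≥0∞) ^ (i : ℝ) * X i ^ (p / 2)) ^ (2 / p)
      ≤ (2 ^ (-(k : ℝ)) * (2 ^ ((k : ℝ) / 2) * M ^ (p / 2) * G)) ^ (2 / p) := by
        gcongr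
    _ = (2 ^ (-((k : ℝ) / 2)) * M ^ (p / 2) * G) ^ (2 / p) := by
        rw [← mul_assoc, ← mul_assoc, ← ENNReal.two_rpow_add]; ring_nf
    _ = _ := by
        rw [ENNReal.mul_rpow_of_nonneg _ _ (by positivity),
          ENNReal.mul_rpow_of_nonneg _ _ (by positivity), ← ENNReal.rpow_mul, ← ENNReal.rpow_mul,
          show p / 2 * (2 / p) = 1 by field_simp, ENNReal.rpow_one,
          show -((k : ℝ) / 2) * (2 / p) = -((k : ℝ) / p) by field_simp]
        ring

/-- The counterpart for the exponent `2p`: the `l`-th term is at most `2^{-k - l/2} M^{2p}`, where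
the slack has used up half of the decay. -/
theorem dyadic_tail_le {p : ℝ} (hp : 0 < p) (X : ℕ → ℝ≥0∞) (k : ℕ) :
    (2 ^ (-(k : ℝ)) * ∑' l : ℕ, 2 ^ ((k + l : ℕ) : ℝ) * X (k + l) ^ (2 * p)) ^ (1 / (2 * p)) ≤
      (∑' l : ℕ, (2 : ℝ≥0∞) ^ (-(1 / 2 * l : ℝ))) ^ (1 / (2 * p)) *
        (2 ^ (-((k : ℝ) / p)) * dyadicMax p X k) := by
  set M := dyadicMax p X k
  set G := ∑' l : ℕ, (2 : ℝ≥0∞) ^ (-(1 / 2 * l : ℝ))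
  have h1 : ∑' l : ℕ, (2 : ℝ≥0∞) ^ ((k + l : ℕ) : ℝ) * X (k + l) ^ (2 * p) ≤
      2 ^ (-(k : ℝ)) * M ^ (2 * p) * G := by
    rw [← ENNReal.tsum_mul_left]
    refine ENNReal.tsum_le_tsum fun l => ?_
    have := ENNReal.rpow_le_rpow (le_dyadicMax p X k (k + l)) (show 0 ≤ 2 * p by positivity)
    rw [ENNReal.mul_rpow_of_nonneg _ _ (by positivity), ← ENNReal.rpow_mul] at this
    calc _ ≤ 2 ^ ((k + l : ℕ) : ℝ) * _ := mul_le_mul_right this _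
      _ = 2 ^ (((k + l : ℕ) : ℝ) + (-(((k + l : ℕ) : ℝ) / p) + |(k : ℝ) - ((k + l : ℕ) : ℝ)| / (4 * p)) * (2 * p))
          * M ^ (2 * p) := by
        rw [← mul_assoc, ← ENNReal.two_rpow_add]
      _ = 2 ^ (-(k : ℝ) + -(1 / 2 * l : ℝ)) * M ^ (2 * p) := by
        congr 2
        push_cast
        rw [show (k : ℝ) - (k + l) = -l by ring, abs_neg, Nat.abs_cast]
        field_simp
        ring
      _ = _ := by rw [ENNReal.two_rpow_add]; ring
  calc _ ≤ (2 ^ (-(k : ℝ)) * (2 ^ (-(k : ℝ)) * M ^ (2 * p) * G)) ^ (1 / (2 * p)) := by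
        gcongr
    _ = (2 ^ (-(2 * k : ℝ)) * M ^ (2 * p) * G) ^ (1 / (2 * p)) := by
        rw [← mul_assoc, ← mul_assoc, ← ENNReal.two_rpow_add]; ring_nf
    _ = _ := by
        rw [ENNReal.mul_rpow_of_nonneg _ _ (by positivity),
          ENNReal.mul_rpow_of_nonneg _ _ (by positivity), ← ENNReal.rpow_mul, ← ENNReal.rpow_mul,
          show 2 * p * (1 / (2 * p)) = 1 by field_simp, ENNReal.rpow_one,
          show -(2 * k : ℝ) * (1 / (2 * p)) = -((k : ℝ) / p) by field_simp]
        ring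

theorem dyadicMax_le_iSup {p : ℝ} (hp : 0 < p) (X : ℕ → ℝ≥0∞) (k : ℕ) :
    dyadicMax p X k ≤ ⨆ i : ℕ, 2 ^ ((i : ℝ) / p) * X i := by
  refine iSup_mono fun i => ?_
  gcongr
  · norm_num
  · have : 0 ≤ |(k : ℝ) - i| / (4 * p) := by positivity
    linarith

/-- The `r`-th power of a supremum is at most the sum of the `r`-th powers, which here is a
convolution with a summable kernel on `ℤ`. This needs no Minkowski inequality and so covers `r < 1`.
-/
theorem tsum_dyadicMax_rpow_le {p r : ℝ} (hr : 0 < r) (X : ℕ → ℝ≥0∞) :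
    ∑' k, dyadicMax p X k ^ r ≤ (∑' n : ℤ, (2 : ℝ≥0∞) ^ (-(r / (4 * p) * |(n : ℝ)|))) *
      ∑' i : ℕ, (2 ^ ((i : ℝ) / p) * X i) ^ r := by
  have h1 : ∀ k, dyadicMax p X k ^ r ≤
      ∑' i : ℕ, 2 ^ (-(r / (4 * p) * |(k : ℝ) - i|)) * (2 ^ ((i : ℝ) / p) * X i) ^ r := by
    intro k
    rw [← ENNReal.le_rpow_inv_iff hr]
    refine iSup_le fun i => ?_
    rw [ENNReal.le_rpow_inv_iff hr]
    refine le_trans (le_of_eq ?_) (ENNReal.le_tsum i)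
    rw [sub_eq_add_neg, ENNReal.two_rpow_add, ENNReal.mul_rpow_of_nonneg _ _ hr.le,
      ENNReal.mul_rpow_of_nonneg _ _ hr.le, ENNReal.mul_rpow_of_nonneg _ _ hr.le,
      ← ENNReal.rpow_mul (2 : ℝ≥0∞) (-_)]
    rw [show -(|(k : ℝ) - i| / (4 * p)) * r = -(r / (4 * p) * |(k : ℝ) - i|) by ring]
    ring
  refine (ENNReal.tsum_le_tsum h1).trans ?_
  rw [ENNReal.tsum_comm, ← ENNReal.tsum_mul_left]
  refine ENNReal.tsum_le_tsum fun i => ?_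
  rw [ENNReal.tsum_mul_right]
  gcongr
  have := ENNReal.tsum_comp_le_tsum_of_injective (f := fun k : ℕ => (k : ℤ) - i)
    (fun a b h => by simpa using h) (fun n : ℤ => (2 : ℝ≥0∞) ^ (-(r / (4 * p) * |(n : ℝ)|)))
  simpa using this

/-- By monotonicity the value at the start of block `k + 1` is below all values on block `k`. The
first value has no preceding block; it is bounded by the term `m = 0`, hence the summand `1` in the
constant. -/
theorem tsum_dyadic_le_tsum {p r : ℝ} (hr : 0 < r) {x : ℕ → ℝ≥0∞}
    (hx : Antitone x) :
    ∑' k : ℕ, ((2 : ℝ≥0∞) ^ ((k : ℝ) / p) * x (2 ^ k - 1)) ^ r ≤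
      (1 + 2 * 2 ^ |r / p - 1|) * ∑' m : ℕ, ((m : ℝ≥0∞) + 1) ^ (r / p - 1) * x m ^ r := by
  set f : ℕ → ℝ≥0∞ := fun m => ((m : ℝ≥0∞) + 1) ^ (r / p - 1) * x m ^ r with hf
  rw [tsum_eq_zero_add' ENNReal.summable, add_mul, one_mul]
  refine add_le_add ?_ ?_
  · refine le_trans (le_of_eq ?_) (ENNReal.le_tsum (f := f) 0)
    simp [hf]
  · rw [ENNReal.tsum_eq_tsum_dyadic f, ← ENNReal.tsum_mul_left]
    refine ENNReal.tsum_le_tsum fun k => ?_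
    have hk : ∀ j ∈ Finset.range (2 ^ k),
        (2 : ℝ≥0∞) ^ ((k + 1) * (r / p - 1)) * x (2 ^ (k + 1) - 1) ^ r ≤
          2 ^ |r / p - 1| * f (2 ^ k - 1 + j) := by
      intro j hj
      have hj' := Finset.mem_range.1 hj
      have h1k := Nat.one_le_two_pow (n := k)
      have h2k : 2 ^ (k + 1) = 2 * 2 ^ k := by ring
      have h1 := ENNReal.le_cast_add_one_rpow (m := 2 ^ k - 1 + j) (k := k) (by omega) (by omega)
        (r / p - 1)
      have h2 : x (2 ^ (k + 1) - 1) ≤ x (2 ^ k - 1 + j) := hx (by omega)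
      rw [hf]
      beta_reduce
      rw [← mul_assoc]
      gcongr
    have h := Finset.sum_le_sum hk
    rw [Finset.sum_const, Finset.card_range, ← Finset.mul_sum, nsmul_eq_mul] at h
    rw [mul_assoc]
    refine le_trans (le_of_eq ?_) (mul_le_mul_right h 2)
    rw [ENNReal.mul_rpow_of_nonneg _ _ hr.le, ← ENNReal.rpow_mul, ← mul_assoc, ← mul_assoc]
    congr 1
    have : (2 : ℝ≥0∞) * ((2 ^ k : ℕ) : ℝ≥0∞) = 2 ^ ((k : ℝ) + 1) := by
      rw [ENNReal.two_rpow_add, ENNReal.rpow_natCast, ENNReal.rpow_one]; push_cast; ring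
    rw [this, ← ENNReal.two_rpow_add]
    push_cast
    ring_nf

theorem tsum_le_tsum_dyadic {p r : ℝ} (hr : 0 < r) {y : ℕ → ℝ≥0∞}
    (hy : Antitone y) :
    ∑' m : ℕ, ((m : ℝ≥0∞) + 1) ^ (r / p - 1) * y m ^ r ≤
      2 ^ |r / p - 1| * ∑' k : ℕ, ((2 : ℝ≥0∞) ^ ((k : ℝ) / p) * y (2 ^ k - 1)) ^ r := by
  rw [ENNReal.tsum_eq_tsum_dyadic, ← ENNReal.tsum_mul_left]
  refine ENNReal.tsum_le_tsum fun k => ?_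
  have hk : ∀ j ∈ Finset.range (2 ^ k),
      (((2 ^ k - 1 + j : ℕ) : ℝ≥0∞) + 1) ^ (r / p - 1) * y (2 ^ k - 1 + j) ^ r ≤
        2 ^ |r / p - 1| * 2 ^ (k * (r / p - 1)) * y (2 ^ k - 1) ^ r := by
    intro j hj
    have hj' := Finset.mem_range.1 hj
    have h1k := Nat.one_le_two_pow (n := k)
    have h2k : 2 ^ (k + 1) = 2 * 2 ^ k := by ring
    have h1 := ENNReal.cast_add_one_rpow_le (m := 2 ^ k - 1 + j) (k := k) (by omega) (by omega)
      (r / p - 1)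
    have h2 : y (2 ^ k - 1 + j) ≤ y (2 ^ k - 1) := hy (by omega)
    gcongr
  refine (Finset.sum_le_sum hk).trans (le_of_eq ?_)
  rw [Finset.sum_const, Finset.card_range, nsmul_eq_mul,
    ENNReal.mul_rpow_of_nonneg _ _ hr.le, ← ENNReal.rpow_mul, ← mul_assoc, ← mul_assoc, ← mul_assoc]
  congr 1
  have : ((2 ^ k : ℕ) : ℝ≥0∞) = 2 ^ (k : ℝ) := by
    rw [ENNReal.rpow_natCast]; push_cast; ring
  rw [this, mul_comm (2 ^ (k : ℝ)), mul_assoc, ← ENNReal.two_rpow_add]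
  ring_nf

theorem two_rpow_mul_le_iSup {p : ℝ} (x : ℕ → ℝ≥0∞) (k : ℕ) :
    (2 : ℝ≥0∞) ^ ((k : ℝ) / p) * x (2 ^ k - 1) ≤ ⨆ m : ℕ, ((m : ℝ≥0∞) + 1) ^ (1 / p) * x m := by
  refine le_trans (le_of_eq ?_) (le_iSup _ (2 ^ k - 1))
  congr 1
  have h : (((2 ^ k - 1 : ℕ) : ℝ≥0∞) + 1) = 2 ^ (k : ℝ) := by
    rw [ENNReal.rpow_natCast]
    have := Nat.sub_add_cancel (Nat.one_le_two_pow (n := k))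
    exact_mod_cast congrArg (Nat.cast : ℕ → ℝ≥0∞) this
  rw [h, ← ENNReal.rpow_mul]
  ring_nf

/-- Dyadic form of the Hardy inequalities behind real interpolation between `ℓ_{p/2}` and
`ℓ_{2p}`. -/
theorem lorentzSeqNorm_le_of_dyadic {p : ℝ} (hp : 0 < p) {q : ℝ≥0∞} (hq : 0 < q) :
    ∃ C : ℝ≥0, ∀ (x y : ℕ → ℝ≥0∞) (A : ℝ≥0∞), Antitone x → Antitone y →
      (∀ k : ℕ, y (2 ^ (k + 1) - 2) ≤ A *
        ((2 ^ (-(k : ℝ)) * ∑ i ∈ Finset.range k, 2 ^ (i : ℝ) * x (2 ^ i - 1) ^ (p / 2)) ^ (2 / p) +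
        (2 ^ (-(k : ℝ)) * ∑' l : ℕ, 2 ^ ((k + l : ℕ) : ℝ) * x (2 ^ (k + l) - 1) ^ (2 * p)) ^
          (1 / (2 * p)))) →
      lorentzSeqNorm p q y ≤ C * A * lorentzSeqNorm p q x := by
  set G : ℝ≥0∞ := (∑' l : ℕ, (2 : ℝ≥0∞) ^ (-(3 / 8 * l : ℝ))) ^ (2 / p) +
    (∑' l : ℕ, (2 : ℝ≥0∞) ^ (-(1 / 2 * l : ℝ))) ^ (1 / (2 * p)) with hG
  have hGtop : G ≠ ⊤ := ENNReal.add_ne_top.2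
    ⟨ENNReal.rpow_ne_top_of_nonneg (by positivity)
      (ENNReal.tsum_two_rpow_neg_mul (a := 3 / 8) (by norm_num)).ne,
    ENNReal.rpow_ne_top_of_nonneg (by positivity)
      (ENNReal.tsum_two_rpow_neg_mul (a := 1 / 2) (by norm_num)).ne⟩
  -- The hypothesis controls `y` at `2 ^ (k + 1) - 2`, just before the next dyadic point. Shifting
  -- down one level costs `2 ^ (1 / p)` and replaces `k` by `k - 1`, which stays `0` for `k = 0`.
  have hbase : ∀ (x y : ℕ → ℝ≥0∞) (A : ℝ≥0∞), Antitone y →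
      (∀ k : ℕ, y (2 ^ (k + 1) - 2) ≤ A *
        ((2 ^ (-(k : ℝ)) * ∑ i ∈ Finset.range k, 2 ^ (i : ℝ) * x (2 ^ i - 1) ^ (p / 2)) ^ (2 / p) +
        (2 ^ (-(k : ℝ)) * ∑' l : ℕ, 2 ^ ((k + l : ℕ) : ℝ) * x (2 ^ (k + l) - 1) ^ (2 * p)) ^
          (1 / (2 * p)))) →
      ∀ k : ℕ, 2 ^ ((k : ℝ) / p) * y (2 ^ k - 1) ≤
        2 ^ (1 / p) * G * A * dyadicMax p (fun i => x (2 ^ i - 1)) (k - 1) := by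
    intro x y A hy h
    have h1 : ∀ k : ℕ, y (2 ^ (k + 1) - 2) ≤
        G * A * (2 ^ (-((k : ℝ) / p)) * dyadicMax p (fun i => x (2 ^ i - 1)) k) := by
      intro k
      refine (h k).trans ?_
      have h2 := dyadic_head_le hp (fun i => x (2 ^ i - 1)) k
      have h3 := dyadic_tail_le hp (fun i => x (2 ^ i - 1)) k
      refine (mul_le_mul_right (add_le_add h2 h3) A).trans (le_of_eq ?_)
      rw [hG]; ring
    intro k
    cases k with
    | zero =>
      have := h1 0
      simp only [Nat.cast_zero, zero_div, ENNReal.rpow_zero, one_mul, pow_zero, zero_add, pow_one,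
        neg_zero, Nat.sub_self, Nat.zero_sub] at this ⊢
      refine this.trans ?_
      rw [mul_assoc (2 ^ (1 / p)), mul_assoc (2 ^ (1 / p))]
      refine le_mul_of_one_le_left' ?_
      have := ENNReal.rpow_le_rpow_of_exponent_le (x := 2) (by norm_num)
        (show (0 : ℝ) ≤ 1 / p by positivity)
      rwa [ENNReal.rpow_zero] at this
    | succ k =>
      have h2 : y (2 ^ (k + 1) - 1) ≤ y (2 ^ (k + 1) - 2) := hy (by omega)
      refine (mul_le_mul_right (h2.trans (h1 k)) _).trans (le_of_eq ?_)
      simp only [Nat.add_sub_cancel]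
      have : (2 : ℝ≥0∞) ^ (((k + 1 : ℕ) : ℝ) / p) * 2 ^ (-((k : ℝ) / p)) = 2 ^ (1 / p) := by
        rw [← ENNReal.two_rpow_add]; congr 1; push_cast; ring
      rw [← this]; ring
  have h2top : ∀ z : ℝ, (2 : ℝ≥0∞) ^ z ≠ ⊤ := fun z =>
    ENNReal.rpow_ne_top_of_ne_zero two_ne_zero ENNReal.ofNat_ne_top
  by_cases hqt : q = ⊤
  · refine ⟨(2 ^ (1 / p) * (2 ^ (1 / p) * G)).toNNReal, fun x y A hx hy h => ?_⟩
    rw [ENNReal.coe_toNNReal (ENNReal.mul_ne_top (h2top _) (ENNReal.mul_ne_top (h2top _) hGtop))]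
    rw [lorentzSeqNorm, lorentzSeqNorm, if_pos hqt, if_pos hqt]
    refine iSup_le fun m => ?_
    obtain ⟨k, hk1, hk2⟩ : ∃ k : ℕ, 2 ^ k ≤ m + 1 ∧ m + 1 < 2 ^ (k + 1) :=
      ⟨Nat.log 2 (m + 1), Nat.pow_log_le_self 2 (by omega), Nat.lt_pow_succ_log_self (by norm_num) _⟩
    have h1 := ENNReal.cast_add_one_rpow_le hk1 hk2.le (1 / p)
    have h2 : y m ≤ y (2 ^ k - 1) := hy (by omega)
    rw [abs_of_nonneg (show (0 : ℝ) ≤ 1 / p by positivity)] at h1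
    calc ((m : ℝ≥0∞) + 1) ^ (1 / p) * y m ≤ 2 ^ (1 / p) * 2 ^ (k * (1 / p)) * y (2 ^ k - 1) := by
          gcongr
      _ = 2 ^ (1 / p) * (2 ^ ((k : ℝ) / p) * y (2 ^ k - 1)) := by rw [mul_assoc, mul_one_div]
      _ ≤ 2 ^ (1 / p) * (2 ^ (1 / p) * G * A * dyadicMax p (fun i => x (2 ^ i - 1)) (k - 1)) :=
          mul_le_mul_right (hbase x y A hy h k) _
      _ ≤ 2 ^ (1 / p) * (2 ^ (1 / p) * G * A * ⨆ m : ℕ, ((m : ℝ≥0∞) + 1) ^ (1 / p) * x m) := by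
          gcongr
          exact (dyadicMax_le_iSup hp _ _).trans (iSup_le fun i => two_rpow_mul_le_iSup x i)
      _ = _ := by ring
  · set r := q.toReal with hr
    have hr0 : 0 < r := ENNReal.toReal_pos hq.ne' hqt
    set Z : ℝ≥0∞ := ∑' n : ℤ, (2 : ℝ≥0∞) ^ (-(r / (4 * p) * |(n : ℝ)|)) with hZ
    have hZtop : Z ≠ ⊤ := (ENNReal.tsum_int_two_rpow_neg_abs_mul (by positivity)).ne
    set K : ℝ≥0∞ := 2 ^ |r / p - 1| * ((2 ^ (1 / p) * G) ^ r * (2 * (Z * (1 + 2 * 2 ^ |r / p - 1|))))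
      with hK
    have hKtop : K ≠ ⊤ := by
      have h1 := ENNReal.rpow_ne_top_of_nonneg hr0.le (ENNReal.mul_ne_top (h2top (1 / p)) hGtop)
      have h2 : (1 : ℝ≥0∞) + 2 * 2 ^ |r / p - 1| ≠ ⊤ :=
        ENNReal.add_ne_top.2 ⟨ENNReal.one_ne_top, ENNReal.mul_ne_top ENNReal.ofNat_ne_top (h2top _)⟩
      exact ENNReal.mul_ne_top (h2top _) (ENNReal.mul_ne_top h1
        (ENNReal.mul_ne_top ENNReal.ofNat_ne_top (ENNReal.mul_ne_top hZtop h2)))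
    refine ⟨(K ^ (1 / r)).toNNReal, fun x y A hx hy h => ?_⟩
    rw [ENNReal.coe_toNNReal (ENNReal.rpow_ne_top_of_nonneg (by positivity) hKtop)]
    rw [lorentzSeqNorm, lorentzSeqNorm, if_neg hqt, if_neg hqt]
    set S := ∑' m : ℕ, ((m : ℝ≥0∞) + 1) ^ (r / p - 1) * x m ^ r
    have hsum : ∑' m : ℕ, ((m : ℝ≥0∞) + 1) ^ (r / p - 1) * y m ^ r ≤ K * A ^ r * S := by
      refine (tsum_le_tsum_dyadic hr0 hy).trans ?_
      have h1 : ∀ k : ℕ, (2 ^ ((k : ℝ) / p) * y (2 ^ k - 1)) ^ r ≤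
          (2 ^ (1 / p) * G * A) ^ r * dyadicMax p (fun i => x (2 ^ i - 1)) (k - 1) ^ r := by
        intro k
        rw [← ENNReal.mul_rpow_of_nonneg _ _ hr0.le]
        exact ENNReal.rpow_le_rpow (hbase x y A hy h k) hr0.le
      -- The truncated subtraction counts the value at `0` twice, for `k = 0` and `k = 1`; hence the
      -- factor `2`.
      have h2 : ∑' k : ℕ, dyadicMax p (fun i => x (2 ^ i - 1)) (k - 1) ^ r ≤
          2 * ∑' k : ℕ, dyadicMax p (fun i => x (2 ^ i - 1)) k ^ r := by
        rw [tsum_eq_zero_add' ENNReal.summable, two_mul]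
        refine add_le_add ?_ ?_
        · exact ENNReal.le_tsum (f := fun k => dyadicMax p (fun i => x (2 ^ i - 1)) k ^ r) 0
        · simp
      have h3 := tsum_dyadicMax_rpow_le (p := p) hr0 (fun i => x (2 ^ i - 1))
      have h4 := tsum_dyadic_le_tsum (p := p) hr0 hx
      calc _ ≤ 2 ^ |r / p - 1| * ∑' k : ℕ,
            (2 ^ (1 / p) * G * A) ^ r * dyadicMax p (fun i => x (2 ^ i - 1)) (k - 1) ^ r := by
            gcongr with k
            exact h1 k
        _ ≤ 2 ^ |r / p - 1| * ((2 ^ (1 / p) * G * A) ^ r *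
              (2 * (Z * ((1 + 2 * 2 ^ |r / p - 1|) * S)))) := by
            rw [ENNReal.tsum_mul_left]
            gcongr
            exact h2.trans (mul_le_mul_right (h3.trans (mul_le_mul_right h4 _)) _)
        _ = K * A ^ r * S := by
            rw [ENNReal.mul_rpow_of_nonneg _ A hr0.le, hK]; ring
    refine (ENNReal.rpow_le_rpow hsum (show 0 ≤ 1 / r by positivity)).trans (le_of_eq ?_)
    rw [ENNReal.mul_rpow_of_nonneg _ _ (by positivity),
      ENNReal.mul_rpow_of_nonneg _ _ (by positivity), ← ENNReal.rpow_mul,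
      mul_one_div_cancel hr0.ne', ENNReal.rpow_one]

/-- The embedding of `ℓ_{p,q}` into weak `ℓ_p`, along dyadic indices. It serves only to secure
finiteness, so the bound is left implicit. -/
theorem two_rpow_mul_lt_top_of_lorentzSeqNorm_lt_top {p : ℝ} {q : ℝ≥0∞} (hq : 0 < q)
    {x : ℕ → ℝ≥0∞} (hx : Antitone x) (h : lorentzSeqNorm p q x < ⊤) :
    ∃ K : ℝ≥0∞, K < ⊤ ∧ ∀ k : ℕ, (2 : ℝ≥0∞) ^ ((k : ℝ) / p) * x (2 ^ k - 1) ≤ K := by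
  rw [lorentzSeqNorm] at h
  split_ifs at h with hqt
  · exact ⟨_, h, two_rpow_mul_le_iSup x⟩
  · have hr0 : 0 < q.toReal := ENNReal.toReal_pos hq.ne' hqt
    have h1 := tsum_dyadic_le_tsum (p := p) hr0 hx
    rw [ENNReal.rpow_lt_top_iff_of_pos (by positivity)] at h
    set S := ∑' m : ℕ, ((m : ℝ≥0∞) + 1) ^ (q.toReal / p - 1) * x m ^ q.toReal
    have h2 : (1 + 2 * 2 ^ |q.toReal / p - 1|) * S < ⊤ := by
      refine ENNReal.mul_lt_top (ENNReal.add_lt_top.2 ⟨ENNReal.one_lt_top, ?_⟩) h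
      exact ENNReal.mul_lt_top ENNReal.ofNat_lt_top
        (ENNReal.rpow_ne_top_of_ne_zero two_ne_zero ENNReal.ofNat_ne_top).lt_top
    refine ⟨_, ENNReal.rpow_lt_top_of_nonneg (inv_nonneg.2 hr0.le) h2.ne, fun k => ?_⟩
    rw [ENNReal.le_rpow_inv_iff hr0]
    exact (ENNReal.le_tsum k).trans h1

theorem exists_lt_of_lorentzSeqNorm_lt_top {p : ℝ} (hp : 0 < p) {q : ℝ≥0∞} (hq : 0 < q)
    {x : ℕ → ℝ≥0∞} (hx : Antitone x) (h : lorentzSeqNorm p q x < ⊤) :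
    ∀ ε > 0, ∃ i : ℕ, x (2 ^ i - 1) < ε := by
  intro ε hε
  obtain ⟨K, hK, hle⟩ := two_rpow_mul_lt_top_of_lorentzSeqNorm_lt_top hq
    hx h
  by_contra hcon
  push Not at hcon
  have h2 : Tendsto (fun k : ℕ => (2 : ℝ≥0∞) ^ ((k : ℝ) / p) * ε) atTop (𝓝 ⊤) := by
    have h3 : Tendsto (fun k : ℕ => ((2 : ℝ≥0∞) ^ (1 / p)) ^ k) atTop (𝓝 ⊤) := by
      refine ENNReal.tendsto_pow_atTop_nhds_top_iff.2 ?_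
      exact ENNReal.one_lt_rpow (by norm_num) (by positivity)
    have h4 := ENNReal.Tendsto.mul_const (b := ε) h3 (Or.inl ENNReal.top_ne_zero)
    rw [ENNReal.top_mul hε.ne'] at h4
    refine h4.congr fun k => ?_
    rw [← ENNReal.rpow_natCast, ← ENNReal.rpow_mul]
    ring_nf
  have h6 : ∀ k : ℕ, (2 : ℝ≥0∞) ^ ((k : ℝ) / p) * ε ≤ K := fun k =>
    (mul_le_mul_right (hcon k) _).trans (hle k)
  exact absurd hK (not_lt.2 (le_of_tendsto' h2 h6))

section Split

variable {ι : Type*} (c : ι → ℝ≥0∞)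

theorem tsum_indicator_rearrangement_lt (i : ℕ) :
    ∑' t, {t | decreasingRearrangement c (2 ^ (i + 1) - 1) < c t}.indicator
      (fun _ => (1 : ℝ≥0∞)) t ≤ 2 * 2 ^ (i : ℝ) := by
  rw [ENNReal.tsum_indicator_one]
  have h := encard_decreasingRearrangement_lt_le c (2 ^ (i + 1) - 1)
  have h2 : ((2 ^ (i + 1) - 1 : ℕ) : ℕ∞) ≤ ((2 ^ (i + 1) : ℕ) : ℕ∞) := by
    exact_mod_cast Nat.sub_le _ _
  have h3 := ENat.toENNReal_le.2 (h.trans h2)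
  refine h3.trans (le_of_eq ?_)
  rw [ENNReal.rpow_natCast]
  push_cast
  ring

/-- Each large member lies in a layer `X (i + 1) < c t ≤ X i` with `i < k`, and such a layer has
fewer than `2 ^ (i + 1)` members. -/
theorem tsum_split_head_le {r : ℝ} (hr : 0 < r) (k : ℕ) :
    ∑' t, (if decreasingRearrangement c (2 ^ k - 1) < c t then c t else 0) ^ r ≤
      2 * ∑ i ∈ Finset.range k, 2 ^ (i : ℝ) * decreasingRearrangement c (2 ^ i - 1) ^ r := by
  set X : ℕ → ℝ≥0∞ := fun i => decreasingRearrangement c (2 ^ i - 1) with hX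
  have h1 : ∀ t, (if X k < c t then c t else 0) ^ r ≤
      ∑ i ∈ Finset.range k, {t | X (i + 1) < c t}.indicator (fun _ => (1 : ℝ≥0∞)) t * X i ^ r := by
    intro t
    split_ifs with h
    · have hex : ∃ i, X i < c t := ⟨k, h⟩
      have hne : Nat.find hex ≠ 0 := by
        intro h0
        have := Nat.find_spec hex
        rw [h0] at this
        exact absurd (le_decreasingRearrangement_zero c t) (not_le.2 (by simpa [hX] using this))
      obtain ⟨i, hi⟩ := Nat.exists_eq_succ_of_ne_zero hne
      have h2 : X (i + 1) < c t := by
        have := Nat.find_spec hex; rwa [hi] at this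
      have h3 : c t ≤ X i := not_lt.1 (Nat.find_min hex (by omega))
      have h4 : i < k := by
        have := Nat.find_min' hex h; omega
      refine le_trans ?_ (Finset.single_le_sum (f := fun i => {t | X (i + 1) < c t}.indicator
        (fun _ => (1 : ℝ≥0∞)) t * X i ^ r) (fun _ _ => zero_le) (Finset.mem_range.2 h4))
      rw [Set.indicator_of_mem (by exact h2), one_mul]
      exact ENNReal.rpow_le_rpow h3 hr.le
    · rw [ENNReal.zero_rpow_of_pos hr]; exact zero_le
  refine (ENNReal.tsum_le_tsum h1).trans ?_
  rw [Summable.tsum_finsetSum (fun _ _ => ENNReal.summable), Finset.mul_sum]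
  refine Finset.sum_le_sum fun i _ => ?_
  rw [ENNReal.tsum_mul_right, ← mul_assoc]
  gcongr
  exact tsum_indicator_rearrangement_lt c i

/-- The same layers, now with `i ≥ k`. The hypothesis `h0` guarantees that every non-zero member
falls into some layer. -/
theorem tsum_split_tail_le {r : ℝ} (hr : 0 < r)
    (h0 : ∀ ε > 0, ∃ i : ℕ, decreasingRearrangement c (2 ^ i - 1) < ε) (k : ℕ) :
    ∑' t, (if decreasingRearrangement c (2 ^ k - 1) < c t then 0 else c t) ^ r ≤
      2 * ∑' l : ℕ, 2 ^ ((k + l : ℕ) : ℝ) * decreasingRearrangement c (2 ^ (k + l) - 1) ^ r := by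
  set X : ℕ → ℝ≥0∞ := fun i => decreasingRearrangement c (2 ^ i - 1) with hX
  have hXa : Antitone X := fun i j hij => decreasingRearrangement_antitone c
    (Nat.sub_le_sub_right (Nat.pow_le_pow_right (by norm_num) hij) 1)
  have h1 : ∀ t, (if X k < c t then 0 else c t) ^ r ≤
      ∑' l : ℕ, {t | X (k + l + 1) < c t}.indicator (fun _ => (1 : ℝ≥0∞)) t * X (k + l) ^ r := by
    intro t
    split_ifs with h
    · rw [ENNReal.zero_rpow_of_pos hr]; exact zero_le
    · rcases eq_or_ne (c t) 0 with hc | hc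
      · rw [hc, ENNReal.zero_rpow_of_pos hr]; exact zero_le
      have hex : ∃ i, X i < c t := h0 _ (pos_iff_ne_zero.2 hc)
      have hlt : k < Nat.find hex := by
        by_contra hle
        exact h (lt_of_le_of_lt (hXa (not_lt.1 hle)) (Nat.find_spec hex))
      obtain ⟨l, hl⟩ := Nat.exists_eq_add_of_lt hlt
      have h2 : X (k + l + 1) < c t := by
        have := Nat.find_spec hex; rwa [hl] at this
      have h3 : c t ≤ X (k + l) := not_lt.1 (Nat.find_min hex (by omega))
      refine le_trans ?_ (ENNReal.le_tsum l)
      rw [Set.indicator_of_mem (by exact h2), one_mul]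
      exact ENNReal.rpow_le_rpow h3 hr.le
  refine (ENNReal.tsum_le_tsum h1).trans ?_
  rw [ENNReal.tsum_comm, ← ENNReal.tsum_mul_left]
  refine ENNReal.tsum_le_tsum fun l => ?_
  rw [ENNReal.tsum_mul_right, ← mul_assoc]
  gcongr
  exact tsum_indicator_rearrangement_lt c (k + l)

theorem exists_decreasingRearrangement_lt {p : ℝ} (hp : 0 < p) {q : ℝ≥0∞} (hq : 0 < q)
    (h : lorentzNorm p q c < ⊤) :
    ∀ ε > 0, ∃ i : ℕ, decreasingRearrangement c (2 ^ i - 1) < ε :=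
  exists_lt_of_lorentzSeqNorm_lt_top hp hq (decreasingRearrangement_antitone c) h

end Split

/-! ### Approximation numbers -/

section Approx

variable {H : Type*} [NormedAddCommGroup H] [InnerProductSpace ℂ H]

/-- The operators that are sums of `m` operators of rank at most one. -/
def rankLE (H : Type*) [NormedAddCommGroup H] [InnerProductSpace ℂ H] (m : ℕ) : Set (H →L[ℂ] H) :=
  {R | ∃ u v : Fin m → H, R = ∑ i, InnerProductSpace.rankOne ℂ (u i) (v i)}

theorem zero_mem_rankLE (m : ℕ) : (0 : H →L[ℂ] H) ∈ rankLE H m :=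
  ⟨0, 0, by simp⟩

theorem rankLE_zero : rankLE H 0 = {0} := by
  ext R
  simp [rankLE]

theorem add_mem_rankLE {m n : ℕ} {R S : H →L[ℂ] H} (hR : R ∈ rankLE H m) (hS : S ∈ rankLE H n) :
    R + S ∈ rankLE H (m + n) := by
  obtain ⟨u, v, rfl⟩ := hR
  obtain ⟨u', v', rfl⟩ := hS
  refine ⟨Fin.append u u', Fin.append v v', ?_⟩
  simp [Fin.sum_univ_add]

theorem rankLE_mono {m n : ℕ} (h : m ≤ n) : rankLE H m ⊆ rankLE H n := by
  intro R hR
  obtain ⟨k, rfl⟩ := Nat.exists_eq_add_of_le h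
  simpa using add_mem_rankLE hR (zero_mem_rankLE k)

theorem sum_rankOne_mem_rankLE {α : Type*} (E : Finset α) {m : ℕ} (hE : E.card ≤ m) (u v : α → H) :
    ∑ a ∈ E, InnerProductSpace.rankOne ℂ (u a) (v a) ∈ rankLE H m := by
  refine rankLE_mono hE ⟨fun i => u (E.equivFin.symm i), fun i => v (E.equivFin.symm i), ?_⟩
  rw [← Finset.sum_coe_sort E]
  exact (Equiv.sum_comp E.equivFin.symm
    (fun a : E => InnerProductSpace.rankOne ℂ (u a) (v a))).symm

theorem neg_mem_rankLE {m : ℕ} {R : H →L[ℂ] H} (hR : R ∈ rankLE H m) : -R ∈ rankLE H m := by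
  obtain ⟨u, v, rfl⟩ := hR
  exact ⟨fun i => -u i, v, by simp⟩

theorem adjoint_mem_rankLE [CompleteSpace H] {m : ℕ} {R : H →L[ℂ] H} (hR : R ∈ rankLE H m) :
    ContinuousLinearMap.adjoint R ∈ rankLE H m := by
  obtain ⟨u, v, rfl⟩ := hR
  exact ⟨v, u, by simp⟩

/-- The approximation numbers of an operator: the distance to the operators of rank `≤ m`. -/
def approxNumber (T : H →L[ℂ] H) (m : ℕ) : ℝ≥0∞ :=
  ⨅ R ∈ rankLE H m, ‖T - R‖ₑ

theorem approxNumber_le {T R : H →L[ℂ] H} {m : ℕ} (hR : R ∈ rankLE H m) :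
    approxNumber T m ≤ ‖T - R‖ₑ := iInf₂_le R hR

theorem approxNumber_zero_right (T : H →L[ℂ] H) : approxNumber T 0 = ‖T‖ₑ := by
  simp [approxNumber, rankLE_zero]

theorem approxNumber_antitone (T : H →L[ℂ] H) : Antitone (approxNumber T) := by
  intro m n hmn
  exact le_iInf₂ fun R hR => approxNumber_le (rankLE_mono hmn hR)

theorem approxNumber_add_le (T S : H →L[ℂ] H) (m n : ℕ) :
    approxNumber (T + S) (m + n) ≤ approxNumber T m + approxNumber S n := by
  simp only [approxNumber, ENNReal.iInf_add, ENNReal.add_iInf]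
  refine le_iInf₂ fun R' hR' => le_iInf₂ fun R hR => ?_
  refine (approxNumber_le (add_mem_rankLE hR hR')).trans ?_
  rw [show T + S - (R + R') = (T - R) + (S - R') by abel]
  simp only [← ofReal_norm]
  rw [← ENNReal.ofReal_add (norm_nonneg _) (norm_nonneg _)]
  exact ENNReal.ofReal_le_ofReal (norm_add_le _ _)

theorem approxNumber_sum_le {κ : Type*} (s : Finset κ) (T : κ → H →L[ℂ] H) (m : κ → ℕ) :
    approxNumber (∑ k ∈ s, T k) (∑ k ∈ s, m k) ≤ ∑ k ∈ s, approxNumber (T k) (m k) := by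
  classical
  induction s using Finset.induction_on with
  | empty =>
    rw [Finset.sum_empty, Finset.sum_empty, Finset.sum_empty, approxNumber_zero_right,
      ← ofReal_norm, norm_zero, ENNReal.ofReal_zero]
  | insert a s ha ih =>
    rw [Finset.sum_insert ha, Finset.sum_insert ha, Finset.sum_insert ha]
    exact (approxNumber_add_le _ _ _ _).trans (add_le_add_right ih _)

theorem approxNumber_neg (T : H →L[ℂ] H) (m : ℕ) : approxNumber (-T) m = approxNumber T m := by
  have h : ∀ T : H →L[ℂ] H, approxNumber (-T) m ≤ approxNumber T m := fun T =>
    le_iInf₂ fun R hR => (approxNumber_le (neg_mem_rankLE hR)).trans (by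
      rw [show -T - -R = -(T - R) by abel, enorm_neg])
  refine le_antisymm (h T) ?_
  simpa using h (-T)

theorem approxNumber_adjoint [CompleteSpace H] (T : H →L[ℂ] H) (m : ℕ) :
    approxNumber (ContinuousLinearMap.adjoint T) m = approxNumber T m := by
  have h : ∀ T : H →L[ℂ] H, approxNumber (ContinuousLinearMap.adjoint T) m ≤ approxNumber T m :=
    fun T => le_iInf₂ fun R hR => (approxNumber_le (adjoint_mem_rankLE hR)).trans (by
      rw [← map_sub, ← ofReal_norm, ← ofReal_norm, LinearIsometryEquiv.norm_map])
  refine le_antisymm (h T) ?_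
  simpa using h (ContinuousLinearMap.adjoint T)

theorem isCompactOperator_of_mem_rankLE {m : ℕ} {R : H →L[ℂ] H} (hR : R ∈ rankLE H m) :
    IsCompactOperator R := by
  obtain ⟨u, v, rfl⟩ := hR
  suffices ∀ s : Finset (Fin m), IsCompactOperator
      (∑ i ∈ s, InnerProductSpace.rankOne ℂ (u i) (v i) : H →L[ℂ] H) from this _
  intro s
  classical
  induction s using Finset.induction_on with
  | empty => simpa using isCompactOperator_zero
  | insert a s ha ih =>
    rw [Finset.sum_insert ha]
    refine IsCompactOperator.add ?_ ih
    rw [InnerProductSpace.rankOne_def']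
    have h : IsCompactOperator (ContinuousLinearMap.toSpanSingleton ℂ (u a)) :=
      isCompactOperator_of_locallyCompactSpace_rng _
    change IsCompactOperator (⇑(ContinuousLinearMap.toSpanSingleton ℂ (u a)) ∘ ⇑(innerSL ℂ (v a)))
    exact h.comp_clm _

theorem isCompactOperator_of_approxNumber [CompleteSpace H] {T : H →L[ℂ] H}
    (h : ∀ ε > 0, ∃ m, approxNumber T m < ε) : IsCompactOperator T := by
  have h1 : ∀ n : ℕ, ∃ R : H →L[ℂ] H, IsCompactOperator R ∧ ‖T - R‖ₑ < (n : ℝ≥0∞)⁻¹ := by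
    intro n
    obtain ⟨m, hm⟩ := h (n : ℝ≥0∞)⁻¹ (by simp)
    obtain ⟨R, hR⟩ := iInf_lt_iff.1 hm
    obtain ⟨hR1, hR2⟩ := iInf_lt_iff.1 hR
    exact ⟨R, isCompactOperator_of_mem_rankLE hR1, hR2⟩
  choose R hR1 hR2 using h1
  refine isCompactOperator_of_tendsto (l := atTop) (F := R) ?_ (Eventually.of_forall hR1)
  rw [tendsto_iff_edist_tendsto_0]
  refine tendsto_of_tendsto_of_tendsto_of_le_of_le tendsto_const_nhds
    ENNReal.tendsto_inv_nat_nhds_zero (fun _ => zero_le) fun n => ?_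
  rw [edist_comm, edist_eq_enorm_sub]
  exact (hR2 n).le

/-- Only `m` of the orthogonal vectors `T eₐ` are longer than the distance to an operator of rank
`m`. -/
theorem encard_lt_enorm_apply_le {A : Type*} {T : H →L[ℂ] H} {e : A → H} (he : Orthonormal ℂ e)
    (hT : ∀ a b, a ≠ b → inner ℂ (T (e a)) (T (e b)) = 0) (m : ℕ) :
    {a | approxNumber T m < ‖T (e a)‖ₑ}.encard ≤ m := by
  by_contra hcon
  push Not at hcon
  obtain ⟨t, hts, htc⟩ := Set.exists_subset_encard_eq (Order.add_one_le_of_lt hcon)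
  have htf : t.Finite := Set.finite_of_encard_eq_coe (k := m + 1) (by simpa using htc)
  obtain ⟨t, rfl⟩ := htf.exists_finset_coe
  have hcard : t.card = m + 1 := by
    rw [Set.encard_coe_eq_coe_finsetCard] at htc
    exact_mod_cast htc
  have hmin : approxNumber T m < t.inf' (Finset.card_pos.1 (by omega)) fun a => ‖T (e a)‖ₑ := by
    rw [Finset.lt_inf'_iff]
    exact fun a ha => hts ha
  obtain ⟨R, hR⟩ := iInf_lt_iff.1 hmin
  obtain ⟨⟨u, v, rfl⟩, hR2⟩ := iInf_lt_iff.1 hR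
  rw [Finset.lt_inf'_iff] at hR2
  set R : H →L[ℂ] H := ∑ i, InnerProductSpace.rankOne ℂ (u i) (v i) with hRdef
  -- The `m` functionals defining `R` have a common zero `x ≠ 0` in the span of `m + 1` of the
  -- vectors `e a`. There `T x = (T - R) x`, whereas orthogonality of the images makes `‖T x‖`
  -- larger than `‖T - R‖ ‖x‖`.
  let L : (t → ℂ) →ₗ[ℂ] (Fin m → ℂ) :=
    { toFun := fun c i => inner ℂ (v i) (∑ a, c a • e a)
      map_add' := fun c c' => by
        ext i; simp [add_smul, Finset.sum_add_distrib]
      map_smul' := fun z c => by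
        ext i; simp [mul_smul, ← Finset.smul_sum] }
  have hker : LinearMap.ker L ≠ ⊥ := by
    apply LinearMap.ker_ne_bot_of_finrank_lt
    simp [hcard]
  obtain ⟨c, hc, hc0⟩ := (Submodule.ne_bot_iff _).1 hker
  set x : H := ∑ a : t, c a • e a with hx
  have hRx : R x = 0 := by
    rw [hRdef, sum_apply]
    refine Finset.sum_eq_zero fun i _ => ?_
    have : inner ℂ (v i) x = 0 := congrFun (LinearMap.mem_ker.1 hc) i
    simp [this]
  have hTx : ‖T x‖ ^ 2 = ∑ a : t, ‖c a‖ ^ 2 * ‖T (e a)‖ ^ 2 := by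
    have h1 : (inner ℂ (T x) (T x) : ℂ) = ∑ a : t, ((‖c a‖ ^ 2 * ‖T (e a)‖ ^ 2 : ℝ) : ℂ) := by
      rw [hx, map_sum, sum_inner]
      refine Finset.sum_congr rfl fun a _ => ?_
      rw [inner_sum, Finset.sum_eq_single a]
      · rw [map_smul, inner_smul_left, inner_smul_right, inner_self_eq_norm_sq_to_K, ← mul_assoc,
          RCLike.conj_mul]
        push_cast; rfl
      · intro b _ hb
        rw [map_smul, map_smul, inner_smul_left, inner_smul_right,
          hT a b (fun h => hb (Subtype.ext h).symm)]
        simp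
      · simp
    rw [inner_self_eq_norm_sq_to_K] at h1
    exact Complex.ofReal_injective (by simpa using h1)
  have hxx : ‖x‖ ^ 2 = ∑ a : t, ‖c a‖ ^ 2 := by
    have het : Orthonormal ℂ fun a : t => e a := he.comp _ Subtype.val_injective
    have h1 := het.inner_sum c c Finset.univ
    rw [← hx, inner_self_eq_norm_sq_to_K] at h1
    simp only [RCLike.conj_mul] at h1
    exact Complex.ofReal_injective (by simpa using h1)
  have hle : ‖T x‖ ≤ ‖T - R‖ * ‖x‖ := by
    have := (T - R).le_opNorm x
    rwa [sub_apply, hRx, sub_zero] at this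
  have hlt : ∀ a : t, ‖T - R‖ < ‖T (e a)‖ := by
    intro a
    have := hR2 a a.2
    rwa [← ofReal_norm, ← ofReal_norm, ENNReal.ofReal_lt_ofReal_iff_of_nonneg (norm_nonneg _)]
      at this
  have h2 : ‖T - R‖ ^ 2 * ‖x‖ ^ 2 < ‖T x‖ ^ 2 := by
    rw [hTx, hxx, Finset.mul_sum]
    obtain ⟨a, ha⟩ := Function.ne_iff.1 hc0
    refine Finset.sum_lt_sum (fun b _ => ?_) ⟨a, Finset.mem_univ _, ?_⟩
    · rw [mul_comm]
      have := (hlt b).le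
      gcongr
    · rw [mul_comm]
      have h3 := hlt a
      have h4 : 0 < ‖c a‖ := norm_pos_iff.2 ha
      gcongr
  have h3 := pow_le_pow_left₀ (norm_nonneg _) hle 2
  rw [mul_pow] at h3
  linarith

end Approx

/-! ### Singular value decompositions -/

section SVD

variable {H : Type*} [NormedAddCommGroup H] [InnerProductSpace ℂ H]

theorem IsSingularValueDecomposition.apply {T : H →L[ℂ] H} {lam : ℕ → ℂ} {e f : ℕ → H}
    (h : IsSingularValueDecomposition T lam e f) {n : ℕ} (hn : lam n ≠ 0) :
    T (e n) = lam n • f n := by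
  have h1 := h.hasSum (e n)
  have h2 : ∀ k, k ≠ n → (lam k * inner ℂ (e k) (e n)) • f k = 0 := by
    intro k hk
    by_cases hk0 : lam k = 0
    · simp [hk0]
    · have := h.orthonormal_left.2 (i := ⟨k, hk0⟩) (j := ⟨n, hn⟩) (by simpa using hk)
      simp [this]
  have h3 := hasSum_single n h2
  rw [h1.unique h3]
  have := h.orthonormal_left.1 ⟨n, hn⟩
  rw [inner_self_eq_norm_sq_to_K, this]
  simp

/-- The images `T (e n) = lam n • f n` are orthogonal with lengths `‖lam n‖`, so the counting bound
`encard_lt_enorm_apply_le` applies. -/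
theorem IsSingularValueDecomposition.decreasingRearrangement_le {T : H →L[ℂ] H} {lam : ℕ → ℂ}
    {e f : ℕ → H} (h : IsSingularValueDecomposition T lam e f) (m : ℕ) :
    decreasingRearrangement (fun n => ‖lam n‖ₑ) m ≤ approxNumber T m := by
  rw [decreasingRearrangement_le_iff]
  have h1 := encard_lt_enorm_apply_le (T := T) h.orthonormal_left (fun a b hab => by
    rw [h.apply a.2, h.apply b.2, inner_smul_left, inner_smul_right, h.orthonormal_right.2 hab]
    simp) m
  refine le_trans ?_ h1
  rw [← (Subtype.val_injective (p := fun n => lam n ≠ 0)).encard_image]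
  refine Set.encard_le_encard fun n hn => ?_
  have hn0 : lam n ≠ 0 := by
    intro h0
    simp [h0] at hn
  refine ⟨⟨n, hn0⟩, ?_, rfl⟩
  have := h.orthonormal_right.1 ⟨n, hn0⟩
  change approxNumber T m < ‖T (e n)‖ₑ
  rw [h.apply hn0, enorm_smul, ← ofReal_norm (f n), this]
  simpa using hn

/-- An orthonormal system of eigenvectors of `T* T` for its non-zero eigenvalues has orthogonal
images under `T`, and `T` kills its orthogonal complement. Normalizing the images gives the second
system. -/
theorem exists_isSingularValueDecomposition [CompleteSpace H] {T : H →L[ℂ] H}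
    (hT : ∀ ε > 0, ∃ m, approxNumber T m < ε) :
    ∃ (lam : ℕ → ℂ) (e f : ℕ → H), IsSingularValueDecomposition T lam e f := by
  have hc := isCompactOperator_of_approxNumber hT
  set S : H →L[ℂ] H := ContinuousLinearMap.adjoint T * T with hSdef
  have hSc : IsCompactOperator S := by
    change IsCompactOperator (⇑(ContinuousLinearMap.adjoint T) ∘ ⇑T)
    exact hc.clm_comp _
  have hSs : (S : H →ₗ[ℂ] H).IsSymmetric := by
    intro x y
    change inner ℂ (ContinuousLinearMap.adjoint T (T x)) y = inner ℂ x (ContinuousLinearMap.adjoint T (T y))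
    rw [ContinuousLinearMap.adjoint_inner_left, ContinuousLinearMap.adjoint_inner_right]
  have hS : ∀ x y, inner ℂ (T x) (T y) = inner ℂ x (S y) := by
    intro x y
    change _ = inner ℂ x (ContinuousLinearMap.adjoint T (T y))
    rw [ContinuousLinearMap.adjoint_inner_right]
  let V : {μ : ℂ // μ ≠ 0} → Submodule ℂ H := fun μ => Module.End.eigenspace (S : H →ₗ[ℂ] H) μ
  have hfd : ∀ μ, FiniteDimensional ℂ (V μ) := fun μ =>
    ContinuousLinearMap.finite_dimensional_eigenspace hSc μ.1 μ.2
  let A := Σ μ : {μ : ℂ // μ ≠ 0}, Fin (Module.finrank ℂ (V μ))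
  let e : A → H := fun a => (stdOrthonormalBasis ℂ (V a.1) a.2 : H)
  have hVo : OrthogonalFamily ℂ (fun μ => V μ) fun μ => (V μ).subtypeₗᵢ :=
    hSs.orthogonalFamily_eigenspaces.comp Subtype.val_injective
  have he : Orthonormal ℂ e :=
    hVo.orthonormal_sigma_orthonormal (v_family := fun μ => stdOrthonormalBasis ℂ (V μ))
      (fun μ => (stdOrthonormalBasis ℂ (V μ)).orthonormal)
  have hSe : ∀ a, S (e a) = (a.1 : ℂ) • e a := fun a =>
    Module.End.mem_eigenspace_iff.1 (stdOrthonormalBasis ℂ (V a.1) a.2).2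
  have hTe : ∀ a b, a ≠ b → inner ℂ (T (e a)) (T (e b)) = 0 := by
    intro a b hab
    rw [hS, hSe, inner_smul_right, he.2 hab, mul_zero]
  have hTe0 : ∀ a, T (e a) ≠ 0 := by
    intro a ha
    have h1 := hSe a
    have h2 : S (e a) = ContinuousLinearMap.adjoint T (T (e a)) := rfl
    rw [h2, ha, map_zero] at h1
    rcases smul_eq_zero.1 h1.symm with h3 | h3
    · exact a.1.2 h3
    · exact he.ne_zero a h3
  -- `H` need not be separable. Countability holds because only finitely many of the orthogonal
  -- vectors `T (e a)` are longer than `1 / n`.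
  have hcount : Countable A := by
    rw [← Set.countable_univ_iff]
    have : (Set.univ : Set A) = ⋃ n : ℕ, {a | (n : ℝ≥0∞)⁻¹ < ‖T (e a)‖ₑ} := by
      symm
      rw [Set.eq_univ_iff_forall]
      intro a
      rw [Set.mem_iUnion]
      exact ENNReal.exists_inv_nat_lt (by simpa using hTe0 a)
    rw [this]
    refine Set.countable_iUnion fun n => Set.Finite.countable ?_
    obtain ⟨m, hm⟩ := hT (n : ℝ≥0∞)⁻¹ (by simp)
    have h1 := encard_lt_enorm_apply_le he hTe m
    have h2 : {a | approxNumber T m < ‖T (e a)‖ₑ}.Finite :=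
      Set.finite_of_encard_le_coe h1
    exact h2.subset fun a ha => hm.trans ha
  have hker : ∀ η : H, (∀ a, inner ℂ (e a) η = 0) → T η = 0 := by
    intro η hη
    have hS0 : S η = 0 := by
      have hbot := ContinuousLinearMap.orthogonalComplement_iSup_eigenspaces_eq_bot hSc hSs
      -- The vector `S η` is tested rather than `η`, since `η` may have a component in the kernel of
      -- `S`; on that eigenspace symmetry gives `⟨u, S η⟩ = ⟨S u, η⟩ = 0`.
      have hmem : S η ∈ (⨆ μ, Module.End.eigenspace (S : H →ₗ[ℂ] H) μ)ᗮ := by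
        rw [← Submodule.iInf_orthogonal, Submodule.mem_iInf]
        intro μ
        rw [Submodule.mem_orthogonal]
        intro u hu
        have hu' : S u = μ • u := Module.End.mem_eigenspace_iff.1 hu
        have h1 : inner ℂ u (S η) = inner ℂ (S u) η := (hSs u η).symm
        rw [h1, hu', inner_smul_left]
        by_cases hμ : μ = 0
        · simp [hμ]
        · have hsum := (stdOrthonormalBasis ℂ (V ⟨μ, hμ⟩)).sum_repr ⟨u, hu⟩
          have hsum' := congrArg (Subtype.val) hsum
          rw [Submodule.coe_sum] at hsum'
          change _ = u at hsum'
          rw [← hsum', sum_inner]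
          rw [Finset.sum_eq_zero, mul_zero]
          intro i _
          rw [Submodule.coe_smul, inner_smul_left]
          have := hη ⟨⟨μ, hμ⟩, i⟩
          change inner ℂ ((stdOrthonormalBasis ℂ (V ⟨μ, hμ⟩) i : V ⟨μ, hμ⟩) : H) η = 0 at this
          rw [this, mul_zero]
      rw [hbot] at hmem
      exact (Submodule.mem_bot ℂ).1 hmem
    have := hS η η
    rw [hS0, inner_zero_right, inner_self_eq_zero] at this
    exact this
  have hHS : ∀ ξ, HasSum (fun a => inner ℂ (e a) ξ • T (e a)) (T ξ) := by
    intro ξ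
    have hsm : Summable fun a => inner ℂ (e a) ξ • e a := by
      have h1 := he.orthogonalFamily.summable_iff_norm_sq_summable (fun a => inner ℂ (e a) ξ)
      simp only [LinearIsometry.toSpanSingleton_apply] at h1
      exact h1.2 (he.inner_products_summable ξ)
    obtain ⟨x, hx⟩ := hsm
    have hperp : ∀ b, inner ℂ (e b) (ξ - x) = 0 := by
      intro b
      have h1 := (innerSL ℂ (e b)).hasSum hx
      simp only [innerSL_apply_apply, inner_smul_right] at h1
      have h2 := hasSum_single (f := fun a => inner ℂ (e a) ξ * inner ℂ (e b) (e a)) b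
        (fun a ha => by rw [he.2 ha.symm, mul_zero])
      rw [inner_sub_right, h1.unique h2, inner_self_eq_norm_sq_to_K, he.1]
      simp
    have h3 := hker _ hperp
    rw [map_sub, sub_eq_zero] at h3
    rw [h3]
    simpa using T.hasSum hx
  obtain ⟨g, hg⟩ := hcount.exists_injective_nat
  -- The system is transported to `ℕ` along an injection. Outside its range the coefficients are
  -- `0`, and the orthonormality conditions ignore those indices.
  let lam : ℕ → ℂ := Function.extend g (fun a => ((‖T (e a)‖ : ℝ) : ℂ)) 0
  let e' : ℕ → H := Function.extend g e 0
  let f' : ℕ → H := Function.extend g (fun a => (((‖T (e a)‖ : ℝ) : ℂ)⁻¹) • T (e a)) 0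
  have hlam : ∀ a, lam (g a) = ((‖T (e a)‖ : ℝ) : ℂ) := fun a => hg.extend_apply _ _ a
  have he' : ∀ a, e' (g a) = e a := fun a => hg.extend_apply _ _ a
  have hf' : ∀ a, f' (g a) = (((‖T (e a)‖ : ℝ) : ℂ)⁻¹) • T (e a) := fun a => hg.extend_apply _ _ a
  have hne : ∀ a, ((‖T (e a)‖ : ℝ) : ℂ) ≠ 0 := fun a => by
    exact_mod_cast norm_ne_zero_iff.2 (hTe0 a)
  have hrange : ∀ n : {n // lam n ≠ 0}, ∃ a, g a = n := by
    rintro ⟨n, hn⟩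
    by_contra hcon
    exact hn (Function.extend_apply' _ _ _ hcon)
  choose r hr using hrange
  have hrinj : Function.Injective r := fun n n' h => Subtype.ext (by rw [← hr n, ← hr n', h])
  have hfo : Orthonormal ℂ fun a => (((‖T (e a)‖ : ℝ) : ℂ)⁻¹) • T (e a) := by
    refine ⟨fun a => ?_, fun a b hab => ?_⟩
    · rw [norm_smul, norm_inv, Complex.norm_real, norm_norm]
      exact inv_mul_cancel₀ (norm_ne_zero_iff.2 (hTe0 a))
    · beta_reduce
      rw [inner_smul_left, inner_smul_right, hTe a b hab]; simp
  refine ⟨lam, e', f', ?_, ?_, fun ξ => ?_⟩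
  · have : (fun n : {n // lam n ≠ 0} => e' n) = e ∘ r := by
      ext n; rw [Function.comp_apply, ← he', hr]
    rw [this]
    exact he.comp r hrinj
  · have : (fun n : {n // lam n ≠ 0} => f' n) =
        (fun a => (((‖T (e a)‖ : ℝ) : ℂ)⁻¹) • T (e a)) ∘ r := by
      ext n; rw [Function.comp_apply, ← hf', hr]
    rw [this]
    exact hfo.comp r hrinj
  · rw [← hg.hasSum_iff]
    · have hfun : (fun n => (lam n * inner ℂ (e' n) ξ) • f' n) ∘ g =
          fun a => inner ℂ (e a) ξ • T (e a) := by
        ext a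
        rw [Function.comp_apply, hlam, he', hf', smul_smul, mul_comm _ (inner ℂ (e a) ξ), mul_assoc,
          mul_inv_cancel₀ (hne a), mul_one]
      rw [hfun]
      exact hHS ξ
    · intro n hn
      have : lam n = 0 := Function.extend_apply' _ _ _ hn
      simp [this]

theorem schattenLorentzNorm_le [CompleteSpace H] {p : ℝ} {q : ℝ≥0∞} {T : H →L[ℂ] H}
    (hT : ∀ ε > 0, ∃ m, approxNumber T m < ε) :
    schattenLorentzNorm p q T ≤ lorentzSeqNorm p q (approxNumber T) := by
  obtain ⟨lam, e, f, h⟩ := exists_isSingularValueDecomposition hT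
  refine (iInf₂_le_of_le lam e (iInf₂_le f h)).trans ?_
  rw [lorentzNorm_eq, lorentzSeqNorm, lorentzSeqNorm]
  have h1 := h.decreasingRearrangement_le
  split_ifs with hq
  · exact iSup_mono fun m => mul_le_mul_right (h1 m) _
  · refine ENNReal.rpow_le_rpow (ENNReal.tsum_le_tsum fun m => mul_le_mul_right ?_ _) (by positivity)
    exact ENNReal.rpow_le_rpow (h1 m) ENNReal.toReal_nonneg

end SVD

/-! ### Operators given by their coordinates in a Hilbert basis -/

section Coordinates

variable {H : Type*} [NormedAddCommGroup H] [InnerProductSpace ℂ H] {ι : Type*}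

theorem HilbertBasis.ext_inner (h : HilbertBasis ι ℂ H) {x y : H}
    (hxy : ∀ i, inner ℂ (h i) x = inner ℂ (h i) y) : x = y := by
  apply h.repr.injective
  ext i
  rw [h.repr_apply_apply, h.repr_apply_apply, hxy]

theorem HilbertBasis.tsum_enorm_sq (h : HilbertBasis ι ℂ H) (x : H) :
    ∑' i, ‖inner ℂ (h i) x‖ₑ ^ 2 = ‖x‖ₑ ^ 2 := by
  have h1 := h.hasSum_inner_mul_inner x x
  have h2 : ∀ i, inner ℂ x (h i) * inner ℂ (h i) x = ((‖inner ℂ (h i) x‖ ^ 2 : ℝ) : ℂ) := by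
    intro i
    rw [← inner_conj_symm x (h i), RCLike.conj_mul]
    simp
  simp_rw [h2] at h1
  rw [inner_self_eq_norm_sq_to_K] at h1
  have h3 : HasSum (fun i => ‖inner ℂ (h i) x‖ ^ 2) (‖x‖ ^ 2) := by
    apply Complex.hasSum_ofReal.1
    simpa using h1
  have h4 := ENNReal.ofReal_tsum_of_nonneg (fun i => by positivity) h3.summable
  rw [h3.tsum_eq] at h4
  rw [← ofReal_norm, ← ENNReal.ofReal_pow (norm_nonneg _), h4]
  congr 1
  ext i
  rw [← ofReal_norm, ← ENNReal.ofReal_pow (norm_nonneg _)]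

theorem HilbertBasis.exists_coord (h : HilbertBasis ι ℂ H) {g : ι → ℂ}
    (hg : ∑' i, ‖g i‖ₑ ^ 2 < ⊤) : ∃ x : H, ∀ i, inner ℂ (h i) x = g i := by
  have hs : Summable fun i => ‖g i‖ ^ 2 := by
    have h1 := ENNReal.summable_toReal hg.ne
    simpa using h1
  have hm : Memℓp g 2 := memℓp_gen (by simpa using hs)
  refine ⟨h.repr.symm ⟨g, hm⟩, fun i => ?_⟩
  rw [← h.repr_apply_apply, LinearIsometryEquiv.apply_symm_apply]

/-- The operator with prescribed coordinates. -/
theorem HilbertBasis.exists_operator (h : HilbertBasis ι ℂ H) (g : ι → H →ₗ[ℂ] ℂ) (C : ℝ≥0)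
    (hg : ∀ ξ, ∑' i, ‖g i ξ‖ₑ ^ 2 ≤ (C * ‖ξ‖ₑ) ^ 2) :
    ∃ P : H →L[ℂ] H, (∀ ξ i, inner ℂ (h i) (P ξ) = g i ξ) ∧ ‖P‖ ≤ C := by
  have hex : ∀ ξ, ∃ x : H, ∀ i, inner ℂ (h i) x = g i ξ := fun ξ =>
    h.exists_coord ((hg ξ).trans_lt (ENNReal.pow_lt_top
      (ENNReal.mul_lt_top ENNReal.coe_lt_top enorm_lt_top)))
  choose P hP using hex
  let L : H →ₗ[ℂ] H :=
    { toFun := P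
      map_add' := fun x y => h.ext_inner fun i => by simp [hP]
      map_smul' := fun z x => h.ext_inner fun i => by simp [hP] }
  have hb : ∀ ξ, ‖L ξ‖ ≤ C * ‖ξ‖ := by
    intro ξ
    have h1 := hg ξ
    simp_rw [← hP ξ] at h1
    rw [h.tsum_enorm_sq, ENNReal.pow_le_pow_left_iff two_ne_zero] at h1
    have h2 := ENNReal.toReal_mono (ENNReal.mul_ne_top ENNReal.coe_ne_top enorm_ne_top) h1
    have h3 : ‖P ξ‖ ≤ C * ‖ξ‖ := by simpa using h2
    exact h3
  exact ⟨L.mkContinuous C hb, fun ξ i => hP ξ i, L.mkContinuous_norm_le C.2 hb⟩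

theorem HilbertBasis.operator_ext (h : HilbertBasis ι ℂ H) {S T : H →L[ℂ] H}
    (hST : ∀ i j, inner ℂ (h i) (S (h j)) = inner ℂ (h i) (T (h j))) : S = T := by
  have h1 : ∀ j, S (h j) = T (h j) := fun j => h.ext_inner fun i => hST i j
  refine ContinuousLinearMap.ext_on (s := Set.range h) ?_ ?_
  · rw [dense_iff_closure_eq, ← Submodule.topologicalClosure_coe, h.dense_span]; rfl
  · rintro _ ⟨j, rfl⟩
    exact h1 j

end Coordinates

/-! ### Block operators -/

section Block

variable {H : Type*} [NormedAddCommGroup H] [InnerProductSpace ℂ H] {ι α : Type*}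

theorem ENNReal.tsum_mul_comp_le {w : ι → ℝ≥0∞} {π : ι → α} {t F : α → ℝ≥0∞}
    (hw : ∀ K, ∑' x, (π ⁻¹' {K}).indicator w x ≤ t K) :
    ∑' x, w x * F (π x) ≤ ∑' K, t K * F K := by
  have h1 : ∀ x, w x * F (π x) = ∑' K, (π ⁻¹' {K}).indicator w x * F K := by
    intro x
    rw [tsum_eq_single (π x)]
    · rw [Set.indicator_of_mem (by simp)]
    · intro K hK
      rw [Set.indicator_of_notMem (by simpa using hK.symm), zero_mul]
  simp_rw [h1]
  rw [ENNReal.tsum_comm]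
  refine ENNReal.tsum_le_tsum fun K => ?_
  rw [ENNReal.tsum_mul_right]
  gcongr
  exact hw K

/-- The operator `ξ ↦ ∑ₓ wₓ ⟨h_{e(π x)}, ξ⟩ hₓ`: its blocks map the orthogonal vectors `h_{e K}`
to vectors of length at most `t K` that are orthogonal to each other. -/
theorem HilbertBasis.exists_blockOperator (h : HilbertBasis ι ℂ H) (π : ι → α) {e : α → ι}
    (he : Function.Injective e) {w : ι → ℂ} {t : α → ℝ≥0∞}
    (hw : ∀ K, ∑' x, (π ⁻¹' {K}).indicator (fun x => ‖w x‖ₑ ^ 2) x ≤ t K ^ 2)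
    {σ : ℝ≥0} (hσ : ∀ K, t K ≤ σ) :
    ∃ T : H →L[ℂ] H, (∀ ξ x, inner ℂ (h x) (T ξ) = w x * inner ℂ (h (e (π x))) ξ) ∧ ‖T‖ ≤ σ := by
  refine h.exists_operator
    (fun x => (w x) • (innerSL ℂ (h (e (π x)))).toLinearMap) σ fun ξ => ?_
  have h1 : ∀ x, ‖((w x) • (innerSL ℂ (h (e (π x)))).toLinearMap) ξ‖ₑ ^ 2 =
      ‖w x‖ₑ ^ 2 * (fun K => ‖inner ℂ (h (e K)) ξ‖ₑ ^ 2) (π x) := by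
    intro x
    simp [enorm_mul, mul_pow]
  simp_rw [h1]
  refine (ENNReal.tsum_mul_comp_le (F := fun K => ‖inner ℂ (h (e K)) ξ‖ₑ ^ 2) hw).trans ?_
  calc ∑' K, t K ^ 2 * ‖inner ℂ (h (e K)) ξ‖ₑ ^ 2
      ≤ ∑' K, (σ : ℝ≥0∞) ^ 2 * ‖inner ℂ (h (e K)) ξ‖ₑ ^ 2 := by
        gcongr with K
        exact hσ K
    _ ≤ (σ : ℝ≥0∞) ^ 2 * ‖ξ‖ₑ ^ 2 := by
        rw [ENNReal.tsum_mul_left, ← h.tsum_enorm_sq ξ]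
        gcongr
        exact ENNReal.tsum_comp_le_tsum_of_injective he (fun x => ‖inner ℂ (h x) ξ‖ₑ ^ 2)
    _ = _ := by rw [mul_pow]

/-- Chebyshev's inequality for counting measure: at this level `σ` one has `(m + 1) σ ^ p = ∑ t ^
p`, so `m + 1` members above it would exceed the total. -/
theorem ENNReal.encard_lt_le_of_tsum_rpow {t : α → ℝ≥0∞} {p : ℝ} (hp : 0 < p)
    (m : ℕ) :
    {K | ((m : ℝ≥0∞) + 1) ^ (-(1 / p)) * (∑' K, t K ^ p) ^ (1 / p) < t K}.encard ≤ m := by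
  set V := ∑' K, t K ^ p with hV
  set σ := ((m : ℝ≥0∞) + 1) ^ (-(1 / p)) * V ^ (1 / p) with hσdef
  have hm0 : (m : ℝ≥0∞) + 1 ≠ 0 := by simp
  have hmt : (m : ℝ≥0∞) + 1 ≠ ⊤ := by simp
  by_contra hcon
  push Not at hcon
  have hσ : ((m : ℝ≥0∞) + 1) * σ ^ p = V := by
    rw [hσdef, ENNReal.mul_rpow_of_nonneg _ _ hp.le, ← ENNReal.rpow_mul, ← ENNReal.rpow_mul,
      show -(1 / p) * p = -1 by field_simp, show 1 / p * p = 1 by field_simp, ENNReal.rpow_one,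
      ENNReal.rpow_neg_one, ← mul_assoc, ENNReal.mul_inv_cancel hm0 hmt, one_mul]
  obtain ⟨s, hs, hsc⟩ := Set.exists_subset_encard_eq (Order.add_one_le_of_lt hcon)
  have hsf : s.Finite := Set.finite_of_encard_eq_coe (k := m + 1) (by simpa using hsc)
  obtain ⟨s, rfl⟩ := hsf.exists_finset_coe
  have hcard : s.card = m + 1 := by
    rw [Set.encard_coe_eq_coe_finsetCard] at hsc
    exact_mod_cast hsc
  have h1 : ((m : ℝ≥0∞) + 1) * σ ^ p = ∑ K ∈ s, σ ^ p := by
    rw [Finset.sum_const, hcard]; simp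
  have h2 : ∑ K ∈ s, σ ^ p < ∑ K ∈ s, t K ^ p := by
    refine ENNReal.sum_lt_sum_of_nonempty (Finset.card_pos.1 (by omega)) fun K hK => ?_
    exact ENNReal.rpow_lt_rpow (hs hK) hp
  have h3 : ∑ K ∈ s, t K ^ p ≤ V := ENNReal.sum_le_tsum s
  rw [← h1, hσ] at h2
  exact absurd h3 (not_le.2 h2)

/-- Each block has rank at most one. Removing the at most `m` blocks with `t K > σ` is a
perturbation of rank at most `m`, and the remaining operator has norm at most `σ`. -/
theorem HilbertBasis.approxNumber_blockOperator_le (h : HilbertBasis ι ℂ H) (π : ι → α) {e : α → ι}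
    (he : Function.Injective e) {w : ι → ℂ} {t : α → ℝ≥0∞}
    (hw : ∀ K, ∑' x, (π ⁻¹' {K}).indicator (fun x => ‖w x‖ₑ ^ 2) x ≤ t K ^ 2)
    {p : ℝ} (hp : 0 < p) (ht : ∑' K, t K ^ p < ⊤) :
    ∃ T : H →L[ℂ] H, (∀ ξ x, inner ℂ (h x) (T ξ) = w x * inner ℂ (h (e (π x))) ξ) ∧
      ∀ m, approxNumber T m ≤ ((m : ℝ≥0∞) + 1) ^ (-(1 / p)) * (∑' K, t K ^ p) ^ (1 / p) := by
  classical
  set V := ∑' K, t K ^ p with hV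
  have hVt : V ^ (1 / p) ≠ ⊤ := ENNReal.rpow_ne_top_of_nonneg (by positivity) ht.ne
  have hbd : ∀ K, t K ≤ (V ^ (1 / p)).toNNReal := by
    intro K
    rw [ENNReal.coe_toNNReal hVt, one_div, ENNReal.le_rpow_inv_iff hp]
    exact ENNReal.le_tsum K
  obtain ⟨T, hT, -⟩ := h.exists_blockOperator π he hw hbd
  refine ⟨T, hT, fun m => ?_⟩
  set σ := ((m : ℝ≥0∞) + 1) ^ (-(1 / p)) * V ^ (1 / p) with hσdef
  have hσt : σ ≠ ⊤ := ENNReal.mul_ne_top (ENNReal.rpow_ne_top_of_ne_zero (by simp) (by simp)) hVt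
  have hcard := ENNReal.encard_lt_le_of_tsum_rpow (t := t) hp m
  rw [← hV, ← hσdef] at hcard
  have hfin : {K | σ < t K}.Finite := Set.finite_of_encard_le_coe hcard
  set E : Finset α := hfin.toFinset with hE
  have hEcard : E.card ≤ m := by
    have : ((E.card : ℕ) : ℕ∞) = {K | σ < t K}.encard := by
      rw [← Set.encard_coe_eq_coe_finsetCard, hE, Set.Finite.coe_toFinset]
    rw [← this] at hcard
    exact_mod_cast hcard
  have hR := sum_rankOne_mem_rankLE E hEcard (fun K => T (h (e K))) (fun K => h (e K))
  refine (approxNumber_le hR).trans ?_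
  -- The weights and block sizes of the operator left after the blocks in `E` are removed.
  set w' : ι → ℂ := fun x => if π x ∈ E then 0 else w x with hw'
  set t' : α → ℝ≥0∞ := fun K => if K ∈ E then 0 else t K with ht'
  have hw2 : ∀ K, ∑' x, (π ⁻¹' {K}).indicator (fun x => ‖w' x‖ₑ ^ 2) x ≤ t' K ^ 2 := by
    intro K
    by_cases hK : K ∈ E
    · have : ∀ x, (π ⁻¹' {K}).indicator (fun x => ‖w' x‖ₑ ^ 2) x = 0 := by
        intro x
        by_cases hx : π x = K
        · rw [Set.indicator_of_mem (by simpa using hx)]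
          simp [hw', hx, hK]
        · rw [Set.indicator_of_notMem (by simpa using hx)]
      simp [this]
    · refine le_trans (ENNReal.tsum_le_tsum fun x => ?_) ((hw K).trans (by simp [ht', hK]))
      refine Set.indicator_le_indicator ?_
      simp only [hw']
      split_ifs <;> simp
  have hbd2 : ∀ K, t' K ≤ σ.toNNReal := by
    intro K
    rw [ENNReal.coe_toNNReal hσt]
    simp only [ht']
    split_ifs with hK
    · exact zero_le
    · rw [hE, Set.Finite.mem_toFinset] at hK
      exact not_lt.1 hK
  obtain ⟨T', hT', hn⟩ := h.exists_blockOperator π he hw2 hbd2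
  have hTT : T - ∑ K ∈ E, InnerProductSpace.rankOne ℂ (T (h (e K))) (h (e K)) = T' := by
    ext ξ
    refine h.ext_inner fun x => ?_
    rw [sub_apply, sum_apply, inner_sub_right, inner_sum, hT, hT']
    have h1 : ∀ K ∈ E, inner ℂ (h x) (InnerProductSpace.rankOne ℂ (T (h (e K))) (h (e K)) ξ) =
        if π x = K then w x * inner ℂ (h (e K)) ξ else 0 := by
      intro K _
      rw [InnerProductSpace.rankOne_apply, inner_smul_right, hT,
        orthonormal_iff_ite.1 h.orthonormal]
      by_cases hx : π x = K
      · simp [hx]; ring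
      · have : e (π x) ≠ e K := fun h => hx (he h)
        simp [hx, this]
    rw [Finset.sum_congr rfl h1, Finset.sum_ite_eq]
    simp only [hw']
    split_ifs <;> simp
  rw [hTT, ← ofReal_norm]
  refine (ENNReal.ofReal_le_ofReal hn).trans ?_
  rw [ENNReal.ofReal_coe_nnreal, ENNReal.coe_toNNReal hσt]

end Block

/-! ### Weak type estimates for sums of operators -/

section WeakSum

variable {H : Type*} [NormedAddCommGroup H] [InnerProductSpace ℂ H] [CompleteSpace H]

/-- A rank budget `m` is shared among infinitely many operators, the `N`-th receiving `m / ((N + 1)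
(N + 2))`; the reciprocals telescope to a sum at most `1`. -/
theorem sum_div_mul_succ_le (m n : ℕ) :
    ∑ N ∈ Finset.range n, m / ((N + 1) * (N + 2)) ≤ m := by
  have h : ∀ n : ℕ, (∑ N ∈ Finset.range n, ((m / ((N + 1) * (N + 2)) : ℕ) : ℝ)) ≤
      m * (1 - 1 / ((n : ℝ) + 1)) := by
    intro n
    induction n with
    | zero => simp
    | succ n ih =>
      rw [Finset.sum_range_succ]
      have h1 : ((m / ((n + 1) * (n + 2)) : ℕ) : ℝ) ≤ (m : ℝ) / (((n : ℝ) + 1) * (n + 2)) := by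
        refine Nat.cast_div_le.trans (le_of_eq ?_)
        push_cast; ring
      refine (add_le_add ih h1).trans (le_of_eq ?_)
      push_cast
      field_simp
      ring
  have h1 := h n
  have h2 : (m : ℝ) * (1 - 1 / ((n : ℝ) + 1)) ≤ m := by
    have : 0 ≤ 1 / ((n : ℝ) + 1) := by positivity
    have hm : (0 : ℝ) ≤ m := by positivity
    nlinarith
  exact_mod_cast h1.trans h2

theorem ENNReal.rpow_allocation_le {p : ℝ} (hp : 0 < p) (m N : ℕ) :
    (((m / ((N + 1) * (N + 2)) : ℕ) : ℝ≥0∞) + 1) ^ (-(1 / p)) ≤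
      ((m : ℝ≥0∞) + 1) ^ (-(1 / p)) * (((N : ℝ≥0∞) + 1) * (N + 2)) ^ (1 / p) := by
  set r := m / ((N + 1) * (N + 2)) with hr
  have h1 : (m : ℝ≥0∞) + 1 ≤ ((N : ℝ≥0∞) + 1) * (N + 2) * ((r : ℝ≥0∞) + 1) := by
    have : m + 1 ≤ (N + 1) * (N + 2) * (r + 1) := by
      have := Nat.lt_mul_div_succ m (show 0 < (N + 1) * (N + 2) by positivity)
      rw [hr]; omega
    exact_mod_cast this
  set A := ((N : ℝ≥0∞) + 1) * (N + 2)
  have hA0 : A ≠ 0 := by simp [A]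
  have hAt : A ≠ ⊤ := ENNReal.mul_ne_top (by simp)
    (ENNReal.add_ne_top.2 ⟨ENNReal.natCast_ne_top N, ENNReal.ofNat_ne_top⟩)
  have h3 := ENNReal.rpow_le_rpow_of_exponent_nonpos
    (show -(1 / p) ≤ 0 by simp only [Left.neg_nonpos_iff]; positivity) h1
  rw [ENNReal.mul_rpow_of_ne_top hAt (by simp)] at h3
  calc ((r : ℝ≥0∞) + 1) ^ (-(1 / p))
      = A ^ (-(1 / p)) * ((r : ℝ≥0∞) + 1) ^ (-(1 / p)) * A ^ (1 / p) := by
        rw [mul_right_comm, ← ENNReal.rpow_add _ _ hA0 hAt]; simp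
    _ ≤ _ := by gcongr

/-- A substitute for the triangle inequality in a weak ideal. Giving `T N` only its share of the
rank costs `((N + 1) (N + 2)) ^ (1 / p)`, which a sufficiently small `β N` absorbs. -/
theorem approxNumber_tsum_le {p : ℝ} (hp : 0 < p) {T : ℕ → H →L[ℂ] H} {β : ℕ → ℝ≥0∞} {V : ℝ≥0∞}
    (hT : ∀ N m, approxNumber (T N) m ≤ ((m : ℝ≥0∞) + 1) ^ (-(1 / p)) * (β N * V))
    (hβ : ∑' N : ℕ, (((N : ℝ≥0∞) + 1) * (N + 2)) ^ (1 / p) * β N < ⊤) (hV : V < ⊤) :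
    Summable T ∧ ∀ m, approxNumber (∑' N, T N) m ≤ ((m : ℝ≥0∞) + 1) ^ (-(1 / p)) *
      ((∑' N : ℕ, (((N : ℝ≥0∞) + 1) * (N + 2)) ^ (1 / p) * β N) * V) := by
  have hone : ∀ N : ℕ, (1 : ℝ≥0∞) ≤ (((N : ℝ≥0∞) + 1) * (N + 2)) ^ (1 / p) := by
    intro N
    have : (1 : ℝ≥0∞) ≤ ((N : ℝ≥0∞) + 1) * (N + 2) := by
      have : 1 ≤ (N + 1) * (N + 2) := by nlinarith
      exact_mod_cast this
    calc (1 : ℝ≥0∞) = 1 ^ (1 / p) := by simp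
      _ ≤ _ := ENNReal.rpow_le_rpow this (by positivity)
  have hnorm : ∀ N, ‖T N‖ₑ ≤ β N * V := by
    intro N
    have := hT N 0
    rwa [approxNumber_zero_right, Nat.cast_zero, zero_add, ENNReal.one_rpow, one_mul] at this
  have hsum : ∑' N, ‖T N‖ₑ < ⊤ := by
    refine lt_of_le_of_lt (ENNReal.tsum_le_tsum hnorm) ?_
    rw [ENNReal.tsum_mul_right]
    refine ENNReal.mul_lt_top (lt_of_le_of_lt (ENNReal.tsum_le_tsum fun N => ?_) hβ) hV
    exact le_mul_of_one_le_left' (hone N)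
  have hsm : Summable T := by
    refine Summable.of_norm ?_
    have := ENNReal.summable_toReal hsum.ne
    simpa using this
  refine ⟨hsm, fun m => ?_⟩
  set r : ℕ → ℕ := fun N => m / ((N + 1) * (N + 2)) with hr
  -- From `N = m` on no rank is spent, so the tail of the series can be estimated in operator norm.
  have hr0 : ∀ N, m ≤ N → r N = 0 := by
    intro N hN
    refine Nat.div_eq_of_lt ?_
    nlinarith
  have hterm : ∀ N, approxNumber (T N) (r N) ≤ ((m : ℝ≥0∞) + 1) ^ (-(1 / p)) *
      ((((N : ℝ≥0∞) + 1) * (N + 2)) ^ (1 / p) * β N * V) := by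
    intro N
    refine (hT N (r N)).trans ?_
    have h2 := ENNReal.rpow_allocation_le hp m N
    rw [← mul_assoc, ← mul_assoc, ← mul_assoc, mul_assoc _ (β N)]
    rw [mul_assoc _ (β N)]
    exact mul_le_mul_left h2 _
  have htail : ‖∑' N, T (N + m)‖ₑ ≤ ∑' N, approxNumber (T (N + m)) (r (N + m)) := by
    refine (enorm_tsum_le_tsum_enorm).trans (ENNReal.tsum_le_tsum fun N => ?_)
    rw [hr0 _ (by omega), approxNumber_zero_right]
  rw [← hsm.sum_add_tsum_nat_add m]
  calc approxNumber (∑ N ∈ Finset.range m, T N + ∑' N, T (N + m)) m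
      ≤ approxNumber (∑ N ∈ Finset.range m, T N + ∑' N, T (N + m))
          (∑ N ∈ Finset.range m, r N + 0) :=
        approxNumber_antitone _ (by simpa using sum_div_mul_succ_le m m)
    _ ≤ approxNumber (∑ N ∈ Finset.range m, T N) (∑ N ∈ Finset.range m, r N) +
          approxNumber (∑' N, T (N + m)) 0 := approxNumber_add_le _ _ _ _
    _ ≤ ∑ N ∈ Finset.range m, approxNumber (T N) (r N) +
          ∑' N, approxNumber (T (N + m)) (r (N + m)) := by
        rw [approxNumber_zero_right]
        exact add_le_add (approxNumber_sum_le _ _ _) htail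
    _ = ∑' N, approxNumber (T N) (r N) :=
        Summable.sum_add_tsum_nat_add' (f := fun N => approxNumber (T N) (r N)) ENNReal.summable
    _ ≤ ∑' N : ℕ, ((m : ℝ≥0∞) + 1) ^ (-(1 / p)) *
          ((((N : ℝ≥0∞) + 1) * (N + 2)) ^ (1 / p) * β N * V) := ENNReal.tsum_le_tsum hterm
    _ = _ := by rw [ENNReal.tsum_mul_left, ENNReal.tsum_mul_right]

end WeakSum

/-! ### The `d`-adic tree -/

section Tree

/-- The `N`-th ancestor of the node `(n, k)` of the `d`-adic tree. -/
def anc (d N : ℕ) (J : ℤ × ℤ) : ℤ × ℤ := (J.1 - N, J.2 / ((d ^ N : ℕ) : ℤ))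

/-- The descendants of a node of the `d`-adic tree, `N` generations below it. -/
def child (d N : ℕ) (K : ℤ × ℤ) (l : Fin (d ^ N)) : ℤ × ℤ :=
  (K.1 + N, K.2 * ((d ^ N : ℕ) : ℤ) + (l : ℕ))

variable (d : ℕ)

theorem anc_fst (N : ℕ) (J : ℤ × ℤ) : (anc d N J).1 = J.1 - N := rfl

theorem anc_zero (J : ℤ × ℤ) : anc d 0 J = J := by simp [anc]

theorem anc_anc (M N : ℕ) (J : ℤ × ℤ) : anc d M (anc d N J) = anc d (N + M) J := by
  simp only [anc, Prod.mk.injEq]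
  refine ⟨by push_cast; ring, ?_⟩
  rw [Int.ediv_ediv_of_nonneg (by positivity)]
  congr 1
  push_cast
  ring

variable [NeZero d]

/-- Every node is in a unique way a descendant `N` generations below some node. -/
def childEquiv (N : ℕ) : (ℤ × ℤ) × Fin (d ^ N) ≃ ℤ × ℤ where
  toFun p := child d N p.1 p.2
  invFun J := (anc d N J, ((Int.divModEquiv (d ^ N)) J.2).2)
  left_inv p := by
    obtain ⟨⟨n, k⟩, l⟩ := p
    have h := (Int.divModEquiv (d ^ N)).apply_symm_apply (k, l)
    rw [Int.divModEquiv_symm_apply] at h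
    have h1 := congrArg Prod.fst h
    have h2 := congrArg Prod.snd h
    ext1
    · ext1
      · simp [anc, child]
      · simpa [anc, child] using h1
    · exact h2
  right_inv J := by
    obtain ⟨n, k⟩ := J
    have h := (Int.divModEquiv (d ^ N)).symm_apply_apply k
    rw [Int.divModEquiv_symm_apply] at h
    ext1
    · simp [anc, child]
    · simpa [anc, child] using h

theorem anc_child (N : ℕ) (K : ℤ × ℤ) (l : Fin (d ^ N)) : anc d N (child d N K l) = K :=
  congrArg Prod.fst ((childEquiv d N).symm_apply_apply (K, l))

theorem exists_child_anc (N : ℕ) (J : ℤ × ℤ) : ∃ l, child d N (anc d N J) l = J :=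
  ⟨_, (childEquiv d N).apply_symm_apply J⟩

theorem ENNReal.tsum_eq_tsum_child (N : ℕ) (f : ℤ × ℤ → ℝ≥0∞) :
    ∑' J, f J = ∑' K, ∑ l, f (child d N K l) := by
  rw [← (childEquiv d N).tsum_eq, ENNReal.tsum_prod']
  simp [childEquiv]

theorem ENNReal.tsum_indicator_anc (N : ℕ) (f : ℤ × ℤ → ℝ≥0∞) (K : ℤ × ℤ) :
    ∑' J, (anc d N ⁻¹' {K}).indicator f J = ∑ l, f (child d N K l) := by
  rw [ENNReal.tsum_eq_tsum_child d N, tsum_eq_single K]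
  · refine Finset.sum_congr rfl fun l _ => ?_
    rw [Set.indicator_of_mem]
    simp [anc_child]
  · intro K' hK'
    refine Finset.sum_eq_zero fun l _ => ?_
    rw [Set.indicator_of_notMem]
    simpa [anc_child] using hK'

/-- The mean of a function over the descendants `N` generations below a node. -/
def treeMean (N : ℕ) (v : ℤ × ℤ → ℝ≥0∞) (K : ℤ × ℤ) : ℝ≥0∞ :=
  ((d : ℝ≥0∞) ^ N)⁻¹ * ∑ l, v (child d N K l)

theorem ENNReal.finset_rpow_sum_le {κ : Type*} (s : Finset κ) (f : κ → ℝ≥0∞) {r : ℝ} (hr0 : 0 < r)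
    (hr : r ≤ 1) : (∑ i ∈ s, f i) ^ r ≤ ∑ i ∈ s, f i ^ r := by
  classical
  induction s using Finset.induction_on with
  | empty => simp [hr0]
  | insert a s ha ih =>
    rw [Finset.sum_insert ha, Finset.sum_insert ha]
    exact (ENNReal.rpow_add_le_add_rpow _ _ hr0.le hr).trans (add_le_add_right ih _)

/-- Jensen's inequality for `r ≥ 1` and subadditivity of `x ^ r` for `r ≤ 1`. Every node is a
descendant of just one `K`, so the normalizing factor survives as a gain exponential in `N`. -/
theorem tsum_treeMean_rpow_le (N : ℕ) (v : ℤ × ℤ → ℝ≥0∞) {r : ℝ} (hr : 0 < r) :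
    ∑' K, treeMean d N v K ^ r ≤ (((d : ℝ≥0∞) ^ N)⁻¹) ^ (min 1 r) * ∑' J, v J ^ r := by
  have hd0 : (d : ℝ≥0∞) ^ N ≠ 0 := pow_ne_zero _ (by exact_mod_cast NeZero.ne d)
  have hdt : (d : ℝ≥0∞) ^ N ≠ ⊤ := ENNReal.pow_ne_top (ENNReal.natCast_ne_top d)
  rw [ENNReal.tsum_eq_tsum_child d N (fun J => v J ^ r), ← ENNReal.tsum_mul_left]
  refine ENNReal.tsum_le_tsum fun K => ?_
  rcases le_total 1 r with h | h
  · rw [min_eq_left h, ENNReal.rpow_one, treeMean, Finset.mul_sum, Finset.mul_sum]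
    refine ENNReal.rpow_arith_mean_le_arith_mean_rpow _ _ _ ?_ h
    rw [Finset.sum_const, Finset.card_univ, Fintype.card_fin, nsmul_eq_mul]
    push_cast
    exact ENNReal.mul_inv_cancel hd0 hdt
  · rw [min_eq_right h, treeMean, ENNReal.mul_rpow_of_nonneg _ _ hr.le]
    gcongr
    exact ENNReal.finset_rpow_sum_le _ _ hr h

end Tree

/-! ### Operators with almost diagonal matrices -/

theorem ENNReal.tsum_poly_mul_geometric_lt_top {a : ℝ} {ρ : ℝ≥0∞} (hρ : ρ < 1) :
    ∑' N : ℕ, ((N : ℝ≥0∞) + 2) ^ a * ρ ^ N < ⊤ := by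
  obtain ⟨k, hk⟩ := exists_nat_ge a
  lift ρ to ℝ≥0 using (hρ.trans ENNReal.one_lt_top).ne
  have hρ' : ρ < 1 := by exact_mod_cast hρ
  have h1 : Summable fun n : ℕ => (n : ℝ) ^ k * (ρ : ℝ) ^ n :=
    summable_pow_mul_geometric_of_norm_lt_one k (by simpa using hρ')
  have h2 : ∑' n : ℕ, ((n : ℝ≥0∞)) ^ k * (ρ : ℝ≥0∞) ^ n < ⊤ := by
    have h3 : ∀ n : ℕ, ((n : ℝ≥0∞)) ^ k * (ρ : ℝ≥0∞) ^ n =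
        (((n : ℝ≥0) ^ k * ρ ^ n : ℝ≥0) : ℝ≥0∞) := fun n => by push_cast; rfl
    simp_rw [h3]
    refine lt_top_iff_ne_top.2 (ENNReal.tsum_coe_ne_top_iff_summable.2 ?_)
    rw [← NNReal.summable_coe]
    simpa using h1
  have h4 : ∑' N : ℕ, ((N : ℝ≥0∞) + 2) ^ a * (ρ : ℝ≥0∞) ^ N ≤
      1 * 2 ^ a + ∑' N : ℕ, (3 : ℝ≥0∞) ^ k * ((N : ℝ≥0∞) ^ k * (ρ : ℝ≥0∞) ^ N) := by
    rw [tsum_eq_zero_add' ENNReal.summable, tsum_eq_zero_add' (f := fun N : ℕ =>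
      (3 : ℝ≥0∞) ^ k * ((N : ℝ≥0∞) ^ k * (ρ : ℝ≥0∞) ^ N)) ENNReal.summable]
    refine add_le_add (by simp) (le_add_left (ENNReal.tsum_le_tsum fun N => ?_))
    rw [← mul_assoc, ← mul_pow]
    gcongr
    calc (((N + 1 : ℕ) : ℝ≥0∞) + 2) ^ a ≤ (((N + 1 : ℕ) : ℝ≥0∞) + 2) ^ (k : ℝ) :=
          ENNReal.rpow_le_rpow_of_exponent_le (by
            have : 1 ≤ N + 1 + 2 := by omega
            exact_mod_cast this) hk
      _ ≤ _ := by
          rw [ENNReal.rpow_natCast]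
          gcongr
          have : N + 1 + 2 ≤ 3 * (N + 1) := by omega
          exact_mod_cast this
  refine h4.trans_lt ?_
  rw [ENNReal.tsum_mul_left]
  exact ENNReal.add_lt_top.2 ⟨ENNReal.mul_lt_top ENNReal.one_lt_top
    (ENNReal.rpow_ne_top_of_ne_zero two_ne_zero ENNReal.ofNat_ne_top).lt_top,
    ENNReal.mul_lt_top (ENNReal.pow_lt_top ENNReal.ofNat_lt_top) h2⟩

section AlmostDiagonal

variable {H : Type*} [NormedAddCommGroup H] [InnerProductSpace ℂ H]

theorem approxNumber_finset_sum_le {κ : Type*} [Fintype κ] {p : ℝ} (hp : 0 < p)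
    {T : κ → H →L[ℂ] H} {V : ℝ≥0∞}
    (hT : ∀ k m, approxNumber (T k) m ≤ ((m : ℝ≥0∞) + 1) ^ (-(1 / p)) * V) (m : ℕ) :
    approxNumber (∑ k, T k) m ≤ ((m : ℝ≥0∞) + 1) ^ (-(1 / p)) *
      ((Fintype.card κ : ℝ≥0∞) ^ (1 / p) * Fintype.card κ * V) := by
  rcases isEmpty_or_nonempty κ with hκ | hκ
  · have : approxNumber (∑ k, T k) m ≤ 0 := by
      refine (approxNumber_antitone _ (Nat.zero_le m)).trans ?_
      rw [approxNumber_zero_right, Finset.univ_eq_empty, Finset.sum_empty, ← ofReal_norm, norm_zero,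
        ENNReal.ofReal_zero]
    exact this.trans zero_le
  set c := Fintype.card κ with hc
  have hc0 : 0 < c := Fintype.card_pos
  set r := m / c with hr
  have h1 : approxNumber (∑ k, T k) m ≤ ∑ _k : κ, ((r : ℝ≥0∞) + 1) ^ (-(1 / p)) * V := by
    refine (approxNumber_antitone _ ?_).trans ((approxNumber_sum_le Finset.univ T
      (fun _ => r)).trans (Finset.sum_le_sum fun k _ => hT k r))
    rw [Finset.sum_const, Finset.card_univ, smul_eq_mul]
    exact Nat.mul_div_le m c
  have h2 : (m : ℝ≥0∞) + 1 ≤ c * ((r : ℝ≥0∞) + 1) := by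
    have : m + 1 ≤ c * (r + 1) := by
      have := Nat.lt_mul_div_succ m hc0
      rw [hr]; omega
    exact_mod_cast this
  have hc0' : (c : ℝ≥0∞) ≠ 0 := by exact_mod_cast hc0.ne'
  have hct : (c : ℝ≥0∞) ≠ ⊤ := ENNReal.natCast_ne_top c
  have h3 := ENNReal.rpow_le_rpow_of_exponent_nonpos
    (show -(1 / p) ≤ 0 by simp only [Left.neg_nonpos_iff]; positivity) h2
  rw [ENNReal.mul_rpow_of_ne_top hct (by simp)] at h3
  have h4 : ((r : ℝ≥0∞) + 1) ^ (-(1 / p)) ≤ ((m : ℝ≥0∞) + 1) ^ (-(1 / p)) * (c : ℝ≥0∞) ^ (1 / p) := by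
    calc ((r : ℝ≥0∞) + 1) ^ (-(1 / p))
        = (c : ℝ≥0∞) ^ (-(1 / p)) * ((r : ℝ≥0∞) + 1) ^ (-(1 / p)) * (c : ℝ≥0∞) ^ (1 / p) := by
          rw [mul_right_comm, ← ENNReal.rpow_add _ _ hc0' hct]; simp
      _ ≤ _ := by gcongr
  refine h1.trans ?_
  rw [Finset.sum_const, Finset.card_univ, nsmul_eq_mul]
  calc (c : ℝ≥0∞) * (((r : ℝ≥0∞) + 1) ^ (-(1 / p)) * V)
      ≤ c * (((m : ℝ≥0∞) + 1) ^ (-(1 / p)) * (c : ℝ≥0∞) ^ (1 / p) * V) := by gcongr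
    _ = _ := by ring

variable {S : Type*} [Fintype S] (d : ℕ) [NeZero d]

/-- The operator formed by the entries `w x` in the places `(x, (anc N x, i))`. -/
theorem HilbertBasis.approxNumber_shiftOperator_le (h : HilbertBasis ((ℤ × ℤ) × S) ℂ H) (N : ℕ)
    (i : S) {w : (ℤ × ℤ) × S → ℂ} {s : ℤ × ℤ → ℝ≥0∞} {A : ℝ≥0∞}
    (hw : ∀ J j, ‖w (J, j)‖ₑ ^ 2 ≤ A ^ 2 * (((d : ℝ≥0∞) ^ N)⁻¹ * s J ^ 2))
    {p : ℝ} (hp : 0 < p) (hs : ∑' J, s J ^ p < ⊤) (hA : A < ⊤) :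
    ∃ T : H →L[ℂ] H,
      (∀ ξ J j, inner ℂ (h (J, j)) (T ξ) = w (J, j) * inner ℂ (h (anc d N J, i)) ξ) ∧
      ∀ m, approxNumber T m ≤ ((m : ℝ≥0∞) + 1) ^ (-(1 / p)) *
        ((Fintype.card S : ℝ≥0∞) ^ (1 / 2 : ℝ) * A * (((d : ℝ≥0∞) ^ N)⁻¹) ^ (min 1 (p / 2) / p) *
          (∑' J, s J ^ p) ^ (1 / p)) := by
  set c := (Fintype.card S : ℝ≥0∞) with hc
  -- The block at `K` consists of the entries at its `d ^ N` descendants and `Fintype.card S`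
  -- indices; the factor `d ^ (-N)` in the hypothesis turns the sum of their squares into a mean.
  set t : ℤ × ℤ → ℝ≥0∞ := fun K => c ^ (1 / 2 : ℝ) * A * treeMean d N (fun J => s J ^ 2) K ^ (1 / 2 : ℝ)
    with ht
  have hsq : ∀ x : ℝ≥0∞, (x ^ (1 / 2 : ℝ)) ^ 2 = x := fun x => by
    rw [← ENNReal.rpow_natCast, ← ENNReal.rpow_mul]; simp
  have htp : ∀ K, t K ^ p = (c ^ (1 / 2 : ℝ) * A) ^ p * treeMean d N (fun J => s J ^ 2) K ^ (p / 2) := by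
    intro K
    rw [ht]
    beta_reduce
    rw [ENNReal.mul_rpow_of_nonneg _ _ hp.le, ← ENNReal.rpow_mul _ (1 / 2) p]
    congr 2; ring
  have hsum : ∑' K, t K ^ p ≤ (c ^ (1 / 2 : ℝ) * A) ^ p *
      ((((d : ℝ≥0∞) ^ N)⁻¹) ^ (min 1 (p / 2)) * ∑' J, s J ^ p) := by
    simp_rw [htp]
    rw [ENNReal.tsum_mul_left]
    gcongr
    refine (tsum_treeMean_rpow_le d N (fun J => s J ^ 2) (show 0 < p / 2 by positivity)).trans ?_
    refine mul_le_mul_right (ENNReal.tsum_le_tsum fun J => le_of_eq ?_) _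
    rw [← ENNReal.rpow_natCast, ← ENNReal.rpow_mul]
    congr 1; push_cast; ring
  have hdt : (((d : ℝ≥0∞) ^ N)⁻¹) ^ (min 1 (p / 2)) ≠ ⊤ := by
    refine ENNReal.rpow_ne_top_of_nonneg (by positivity) (ENNReal.inv_ne_top.2 (pow_ne_zero _ ?_))
    exact_mod_cast NeZero.ne d
  have hct : c ^ (1 / 2 : ℝ) ≠ ⊤ := ENNReal.rpow_ne_top_of_nonneg (by norm_num)
    (ENNReal.natCast_ne_top _)
  have hfin : ∑' K, t K ^ p < ⊤ := by
    refine hsum.trans_lt (ENNReal.mul_lt_top ?_ (ENNReal.mul_lt_top hdt.lt_top hs))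
    exact ENNReal.rpow_lt_top_of_nonneg hp.le (ENNReal.mul_ne_top hct hA.ne)
  have hw' : ∀ K, ∑' x : (ℤ × ℤ) × S, ((fun x : (ℤ × ℤ) × S => anc d N x.1) ⁻¹' {K}).indicator
      (fun x => ‖w x‖ₑ ^ 2) x ≤ t K ^ 2 := by
    intro K
    have h1 : ∀ (J : ℤ × ℤ) (j : S), ((fun x : (ℤ × ℤ) × S => anc d N x.1) ⁻¹' {K}).indicator
        (fun x => ‖w x‖ₑ ^ 2) (J, j) ≤
        (anc d N ⁻¹' {K}).indicator (fun J => A ^ 2 * (((d : ℝ≥0∞) ^ N)⁻¹ * s J ^ 2)) J := by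
      intro J j
      by_cases hJ : anc d N J = K
      · rw [Set.indicator_of_mem (by simpa using hJ), Set.indicator_of_mem (by simpa using hJ)]
        exact hw J j
      · rw [Set.indicator_of_notMem (by simpa using hJ)]
        exact zero_le
    rw [ENNReal.tsum_prod']
    calc _ ≤ ∑' (J : ℤ × ℤ) (_j : S), (anc d N ⁻¹' {K}).indicator
          (fun J => A ^ 2 * (((d : ℝ≥0∞) ^ N)⁻¹ * s J ^ 2)) J :=
          ENNReal.tsum_le_tsum fun J => ENNReal.tsum_le_tsum fun j => h1 J j
      _ = c * ∑ l, A ^ 2 * (((d : ℝ≥0∞) ^ N)⁻¹ * s (child d N K l) ^ 2) := by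
          simp_rw [tsum_fintype, Finset.sum_const, Finset.card_univ, nsmul_eq_mul]
          rw [ENNReal.tsum_mul_left, ENNReal.tsum_indicator_anc]
      _ = t K ^ 2 := by
          rw [ht]
          beta_reduce
          rw [mul_pow, mul_pow, hsq, hsq, treeMean, ← Finset.mul_sum, ← Finset.mul_sum]
          ring
  obtain ⟨T, hT1, hT2⟩ := h.approxNumber_blockOperator_le
    (fun x : (ℤ × ℤ) × S => anc d N x.1) (e := fun K => (K, i))
    (fun K K' hK => congrArg Prod.fst hK) hw' hp hfin
  refine ⟨T, fun ξ J j => hT1 ξ (J, j), fun m => (hT2 m).trans (mul_le_mul_right ?_ _)⟩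
  refine (ENNReal.rpow_le_rpow hsum (show 0 ≤ 1 / p by positivity)).trans (le_of_eq ?_)
  rw [ENNReal.mul_rpow_of_nonneg ((c ^ (1 / 2 : ℝ) * A) ^ p) _ (by positivity),
    ENNReal.mul_rpow_of_nonneg _ (∑' J, s J ^ p) (by positivity),
    ← ENNReal.rpow_mul, ← ENNReal.rpow_mul, mul_one_div_cancel hp.ne', ENNReal.rpow_one]
  ring_nf

variable [CompleteSpace H]

/-- The constant in the weak type estimate for almost diagonal matrices. -/
def almostDiagonalConst (d c : ℕ) (p : ℝ) : ℝ≥0∞ :=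
  ((2 * c : ℕ) : ℝ≥0∞) ^ (1 / p) * ((2 * c : ℕ) : ℝ≥0∞) *
    ∑' N : ℕ, (((N : ℝ≥0∞) + 1) * (N + 2)) ^ (1 / p) *
      ((c : ℝ≥0∞) ^ (1 / 2 : ℝ) * ((N : ℝ≥0∞) + 1) * (((d : ℝ≥0∞) ^ N)⁻¹) ^ (min 1 (p / 2) / p))

/-- The cost of sharing the rank and the factor `N + 1` are polynomial in `N`, against geometric
decay with ratio `ρ < 1`. -/
theorem tsum_almostDiagonalConst_lt_top {d : ℕ} (hd : 2 ≤ d) (c : ℕ) {p : ℝ} (hp : 0 < p) :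
    ∑' N : ℕ, (((N : ℝ≥0∞) + 1) * (N + 2)) ^ (1 / p) *
      ((c : ℝ≥0∞) ^ (1 / 2 : ℝ) * ((N : ℝ≥0∞) + 1) * (((d : ℝ≥0∞) ^ N)⁻¹) ^ (min 1 (p / 2) / p))
      < ⊤ := by
  set ρ : ℝ≥0∞ := ((d : ℝ≥0∞)⁻¹) ^ (min 1 (p / 2) / p) with hρ
  have hρ1 : ρ < 1 := by
    refine ENNReal.rpow_lt_one ?_ (by positivity)
    rw [ENNReal.inv_lt_one]
    exact_mod_cast hd
  have h1 : ∀ N : ℕ, (((N : ℝ≥0∞) + 1) * (N + 2)) ^ (1 / p) *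
      ((c : ℝ≥0∞) ^ (1 / 2 : ℝ) * ((N : ℝ≥0∞) + 1) * (((d : ℝ≥0∞) ^ N)⁻¹) ^ (min 1 (p / 2) / p)) ≤
      (c : ℝ≥0∞) ^ (1 / 2 : ℝ) * (((N : ℝ≥0∞) + 2) ^ (2 / p + 1) * ρ ^ N) := by
    intro N
    have h2 : (N : ℝ≥0∞) + 1 ≤ N + 2 := by gcongr; norm_num
    have h3 : (((d : ℝ≥0∞) ^ N)⁻¹) ^ (min 1 (p / 2) / p) = ρ ^ N := by
      rw [hρ, ENNReal.inv_pow, ← ENNReal.rpow_natCast, ← ENNReal.rpow_natCast,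
        ← ENNReal.rpow_mul, ← ENNReal.rpow_mul, mul_comm]
    have hN0 : (N : ℝ≥0∞) + 2 ≠ 0 := by simp
    have hNt : (N : ℝ≥0∞) + 2 ≠ ⊤ := ENNReal.add_ne_top.2 ⟨ENNReal.natCast_ne_top N, ENNReal.ofNat_ne_top⟩
    rw [h3]
    calc _ ≤ (((N : ℝ≥0∞) + 2) * (N + 2)) ^ (1 / p) * ((c : ℝ≥0∞) ^ (1 / 2 : ℝ) * ((N : ℝ≥0∞) + 2) * ρ ^ N) := by
          gcongr
      _ = _ := by
          rw [← sq, ← ENNReal.rpow_natCast, ← ENNReal.rpow_mul, ENNReal.rpow_add _ _ hN0 hNt,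
            ENNReal.rpow_one, show ((2 : ℕ) : ℝ) * (1 / p) = 2 / p by push_cast; ring]
          ring
  refine (ENNReal.tsum_le_tsum h1).trans_lt ?_
  rw [ENNReal.tsum_mul_left]
  exact ENNReal.mul_lt_top (ENNReal.rpow_lt_top_of_nonneg (by norm_num) (ENNReal.natCast_ne_top _))
    (ENNReal.tsum_poly_mul_geometric_lt_top hρ1)

theorem almostDiagonalConst_lt_top {d : ℕ} (hd : 2 ≤ d) (c : ℕ) {p : ℝ} (hp : 0 < p) :
    almostDiagonalConst d c p < ⊤ :=
  ENNReal.mul_lt_top (ENNReal.mul_lt_top (ENNReal.rpow_lt_top_of_nonneg (by positivity)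
    (ENNReal.natCast_ne_top _)) (ENNReal.natCast_lt_top _)) (tsum_almostDiagonalConst_lt_top hd c hp)

omit [NeZero d] in
theorem anc_injective {J : ℤ × ℤ} {M N : ℕ} (h : anc d M J = anc d N J) : M = N := by
  have := congrArg Prod.fst h
  simp only [anc_fst] at this
  omega

/-- Weak type estimate for operators with almost diagonal matrices in a basis indexed by the
`d`-adic tree. -/
theorem HilbertBasis.exists_almostDiagonal (hd : 2 ≤ d)
    (h : HilbertBasis ((ℤ × ℤ) × S) ℂ H)
    {M : (ℤ × ℤ) × S → (ℤ × ℤ) × S → ℂ} {s : ℤ × ℤ → ℝ≥0∞}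
    (hdown : ∀ N J j i, ‖M (J, j) (anc d N J, i)‖ₑ ^ 2 ≤
      ((N : ℝ≥0∞) + 1) ^ 2 * (((d : ℝ≥0∞) ^ N)⁻¹ * s J ^ 2))
    (hup : ∀ N J j i, ‖M (anc d N J, i) (J, j)‖ₑ ^ 2 ≤
      ((N : ℝ≥0∞) + 1) ^ 2 * (((d : ℝ≥0∞) ^ N)⁻¹ * s J ^ 2))
    (hzero : ∀ x y, (∀ N, anc d N x.1 ≠ y.1) → (∀ N, anc d N y.1 ≠ x.1) → M x y = 0)
    {p : ℝ} (hp : 0 < p) (hs : ∑' J, s J ^ p < ⊤) :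
    ∃ T : H →L[ℂ] H, (∀ x y, inner ℂ (h x) (T (h y)) = M x y) ∧
      ∀ m, approxNumber T m ≤ ((m : ℝ≥0∞) + 1) ^ (-(1 / p)) *
        (almostDiagonalConst d (Fintype.card S) p * (∑' J, s J ^ p) ^ (1 / p)) := by
  classical
  have hA : ∀ N : ℕ, (N : ℝ≥0∞) + 1 < ⊤ := fun N => by simp
  choose T hT hTa using fun (i : S) (N : ℕ) => h.approxNumber_shiftOperator_le d N i
    (w := fun x => M x (anc d N x.1, i)) (fun J j => hdown N J j i) hp hs (hA N)
  -- The entries in the rows of proper ancestors form adjoints of shift operators with conjugated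
  -- weights. The weight is `0` for `N = 0`, as the diagonal is already contained in the `T i 0`.
  choose U hU hUa using fun (i : S) (N : ℕ) => h.approxNumber_shiftOperator_le d N i
    (w := fun x => if N = 0 then 0 else (starRingEnd ℂ) (M (anc d N x.1, i) x)) (s := s)
    (A := (N : ℝ≥0∞) + 1) (fun J j => by
      split_ifs with hN
      · simp
      · rw [RCLike.enorm_conj]
        exact hup N J j i) hp hs (hA N)
  set V := (∑' J, s J ^ p) ^ (1 / p) with hV
  have hVt : V < ⊤ := ENNReal.rpow_lt_top_of_nonneg (by positivity) hs.ne
  have hconst := tsum_almostDiagonalConst_lt_top hd (Fintype.card S) hp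
  have h1 := fun i => approxNumber_tsum_le hp (hTa i) hconst hVt
  have h2 := fun i => approxNumber_tsum_le hp (T := fun N => ContinuousLinearMap.adjoint (U i N))
    (fun N m => (approxNumber_adjoint (U i N) m).trans_le (hUa i N m)) hconst hVt
  set F : S ⊕ S → H →L[ℂ] H := Sum.elim (fun i => ∑' N, T i N)
    (fun i => ∑' N, ContinuousLinearMap.adjoint (U i N)) with hF
  refine ⟨∑ k, F k, fun x y => ?_, fun m => ?_⟩
  · obtain ⟨J, j⟩ := x
    obtain ⟨K, l⟩ := y
    have hort := orthonormal_iff_ite.1 h.orthonormal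
    have e1 : ∀ i, inner ℂ (h (J, j)) ((∑' N, T i N) (h (K, l))) =
        ∑' N, if anc d N J = K ∧ i = l then M (J, j) (K, l) else 0 := by
      intro i
      have hsm := (h1 i).1.hasSum.mapL (ContinuousLinearMap.apply ℂ H (h (K, l)))
      have hsm2 := (hsm.mapL (innerSL ℂ (h (J, j)))).tsum_eq
      simp only [ContinuousLinearMap.apply_apply, innerSL_apply_apply] at hsm2
      rw [← hsm2]
      refine tsum_congr fun N => ?_
      rw [hT, hort]
      by_cases hc : anc d N J = K ∧ i = l
      · simp [hc]
      · rw [if_neg hc, if_neg (by simpa using hc), mul_zero]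
    have e2 : ∀ i, inner ℂ (h (J, j)) ((∑' N, ContinuousLinearMap.adjoint (U i N)) (h (K, l))) =
        ∑' N, if N ≠ 0 ∧ anc d N K = J ∧ i = j then M (J, j) (K, l) else 0 := by
      intro i
      have hsm := (h2 i).1.hasSum.mapL (ContinuousLinearMap.apply ℂ H (h (K, l)))
      have hsm2 := (hsm.mapL (innerSL ℂ (h (J, j)))).tsum_eq
      simp only [ContinuousLinearMap.apply_apply, innerSL_apply_apply] at hsm2
      rw [← hsm2]
      refine tsum_congr fun N => ?_
      rw [ContinuousLinearMap.adjoint_inner_right, ← inner_conj_symm, hU, hort]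
      by_cases hc : N ≠ 0 ∧ anc d N K = J ∧ i = j
      · obtain ⟨hc1, hc2, hc3⟩ := hc
        simp [hc1, hc2, hc3]
      · rw [if_neg hc]
        by_cases hN : N = 0
        · simp [hN]
        · rw [if_neg (fun h => hc ⟨hN, congrArg Prod.fst h, congrArg Prod.snd h⟩), mul_zero,
            map_zero]
    rw [sum_apply, inner_sum, Fintype.sum_sum_type]
    simp only [hF, Sum.elim_inl, Sum.elim_inr, e1, e2]
    -- At most one pair of index and distance contributes to a given entry: `l` with the distance
    -- from `J` up to `K`, or `j` with the distance from `K` up to `J`.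
    rw [Finset.sum_eq_single l, Finset.sum_eq_single j]
    · by_cases hJK : ∃ N, anc d N J = K
      · obtain ⟨N₀, hN₀⟩ := hJK
        rw [tsum_eq_single N₀, tsum_eq_single 0]
        · simp [hN₀]
        · intro N hN
          rw [if_neg]
          rintro ⟨-, hc, -⟩
          have a1 := congrArg Prod.fst hN₀
          have a2 := congrArg Prod.fst hc
          simp only [anc_fst] at a1 a2
          omega
        · intro N hN
          rw [if_neg]
          rintro ⟨hc, -⟩
          exact hN (anc_injective d (hc.trans hN₀.symm))
      · push Not at hJK
        have z1 : ∀ N, ¬(anc d N J = K ∧ l = l) := fun N hc => hJK N hc.1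
        have z2 : ∑' N, (if anc d N J = K ∧ l = l then M (J, j) (K, l) else 0) = 0 :=
          (tsum_congr fun N => if_neg (z1 N)).trans tsum_zero
        rw [z2, zero_add]
        by_cases hKJ : ∃ N, anc d N K = J
        · obtain ⟨N₀, hN₀⟩ := hKJ
          have hne : N₀ ≠ 0 := by
            rintro rfl
            rw [anc_zero] at hN₀
            exact hJK 0 (by rw [anc_zero, hN₀])
          rw [tsum_eq_single N₀]
          · simp [hN₀, hne]
          · intro N hN
            rw [if_neg]
            rintro ⟨-, hc, -⟩
            exact hN (anc_injective d (hc.trans hN₀.symm))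
        · push Not at hKJ
          rw [hzero _ _ hJK hKJ]
          simp
    · intro i _ hi
      simp [hi]
    · simp
    · intro i _ hi
      simp [hi]
    · simp
  · have h3 : ∀ k m, approxNumber (F k) m ≤ ((m : ℝ≥0∞) + 1) ^ (-(1 / p)) *
        ((∑' N : ℕ, (((N : ℝ≥0∞) + 1) * (N + 2)) ^ (1 / p) * ((Fintype.card S : ℝ≥0∞) ^ (1 / 2 : ℝ) *
          ((N : ℝ≥0∞) + 1) * (((d : ℝ≥0∞) ^ N)⁻¹) ^ (min 1 (p / 2) / p))) * V) := by
      rintro (i | i) m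
      · exact (h1 i).2 m
      · exact (h2 i).2 m
    refine (approxNumber_finset_sum_le hp h3 m).trans (le_of_eq ?_)
    rw [almostDiagonalConst, Fintype.card_sum, ← two_mul]
    ring

end AlmostDiagonal

/-! ### Sums of means over the tree -/

section TreeEnergy

variable (d : ℕ) [NeZero d]

/-- The sum of the means over all the generations below a node. -/
def treeEnergy (v : ℤ × ℤ → ℝ≥0∞) (K : ℤ × ℤ) : ℝ≥0∞ := ∑' N, treeMean d N v K

/-- The constant in the `ℓ^r` estimate for `treeEnergy`. -/
def treeEnergyConst (d : ℕ) (r : ℝ) : ℝ≥0∞ :=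
  (1 - (d : ℝ≥0∞)⁻¹ ^ (min 1 r / (2 * r)))⁻¹ ^ r * (1 - (d : ℝ≥0∞)⁻¹ ^ (min 1 r / 2))⁻¹

theorem treeEnergyConst_lt_top {d : ℕ} (hd : 2 ≤ d) {r : ℝ} (hr : 0 < r) :
    treeEnergyConst d r < ⊤ := by
  have h : ∀ z : ℝ, 0 < z → (1 - (d : ℝ≥0∞)⁻¹ ^ z)⁻¹ ≠ ⊤ := by
    intro z hz
    refine ENNReal.inv_ne_top.2 (tsub_pos_of_lt ?_).ne'
    refine ENNReal.rpow_lt_one ?_ hz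
    rw [ENNReal.inv_lt_one]
    exact_mod_cast hd
  exact ENNReal.mul_lt_top (ENNReal.rpow_lt_top_of_nonneg hr.le (h _ (by positivity)))
    (h _ (by positivity)).lt_top

/-- The sum is bounded by a weighted supremum, and the supremum by an `ℓ_r` sum. This treats all `r
> 0` at once, at the price of a geometric weight. -/
theorem ENNReal.tsum_rpow_le_of_geometric {ρ : ℝ≥0∞} (h0 : ρ ≠ 0) (ht : ρ ≠ ⊤) {r : ℝ} (hr : 0 < r)
    (x : ℕ → ℝ≥0∞) : (∑' N, x N) ^ r ≤ (1 - ρ)⁻¹ ^ r * ∑' N, ((ρ ^ N)⁻¹ * x N) ^ r := by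
  have h1 : ∑' N, x N ≤ (1 - ρ)⁻¹ * ⨆ N, (ρ ^ N)⁻¹ * x N := by
    rw [← ENNReal.tsum_geometric, ← ENNReal.tsum_mul_right]
    refine ENNReal.tsum_le_tsum fun N => ?_
    calc x N = ρ ^ N * ((ρ ^ N)⁻¹ * x N) := by
          rw [← mul_assoc, ENNReal.mul_inv_cancel (pow_ne_zero _ h0) (ENNReal.pow_ne_top ht), one_mul]
      _ ≤ _ := by
          gcongr
          exact le_iSup (fun N => (ρ ^ N)⁻¹ * x N) N
  refine (ENNReal.rpow_le_rpow h1 hr.le).trans ?_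
  rw [ENNReal.mul_rpow_of_nonneg _ _ hr.le]
  gcongr
  rw [← ENNReal.le_rpow_inv_iff hr]
  refine iSup_le fun N => ?_
  rw [ENNReal.le_rpow_inv_iff hr]
  exact ENNReal.le_tsum (f := fun N => ((ρ ^ N)⁻¹ * x N) ^ r) N

theorem tsum_treeEnergy_rpow_le (v : ℤ × ℤ → ℝ≥0∞) {r : ℝ} (hr : 0 < r) :
    ∑' K, treeEnergy d v K ^ r ≤ treeEnergyConst d r * ∑' J, v J ^ r := by
  have hd0 : (d : ℝ≥0∞) ≠ 0 := by exact_mod_cast NeZero.ne d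
  have hdt : (d : ℝ≥0∞) ≠ ⊤ := ENNReal.natCast_ne_top d
  have hi0 : (d : ℝ≥0∞)⁻¹ ≠ 0 := ENNReal.inv_ne_zero.2 hdt
  have hit : (d : ℝ≥0∞)⁻¹ ≠ ⊤ := ENNReal.inv_ne_top.2 hd0
  set m := min 1 r with hm
  -- Chosen so that the weights `ρ ^ (-N r)` use up exactly half of the gain `d ^ (-N m)` of the
  -- `N`-th mean; the other half sums over `N`.
  set ρ := (d : ℝ≥0∞)⁻¹ ^ (m / (2 * r)) with hρ
  have hρ0 : ρ ≠ 0 := (ENNReal.rpow_pos (pos_iff_ne_zero.2 hi0) hit).ne'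
  have hρt : ρ ≠ ⊤ := ENNReal.rpow_ne_top_of_ne_zero hi0 hit
  have key : ∀ N : ℕ, ((ρ ^ N)⁻¹) ^ r * (((d : ℝ≥0∞) ^ N)⁻¹) ^ m = ((d : ℝ≥0∞)⁻¹ ^ (m / 2)) ^ N := by
    intro N
    rw [hρ, ENNReal.inv_pow (a := (d : ℝ≥0∞)), ← ENNReal.rpow_natCast, ← ENNReal.rpow_natCast,
      ← ENNReal.rpow_natCast, ← ENNReal.rpow_mul, ← ENNReal.rpow_neg, ← ENNReal.rpow_mul,
      ← ENNReal.rpow_mul, ← ENNReal.rpow_mul, ← ENNReal.rpow_add _ _ hi0 hit]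
    congr 1
    field_simp
    ring
  calc ∑' K, treeEnergy d v K ^ r
      ≤ ∑' K, (1 - ρ)⁻¹ ^ r * ∑' N, ((ρ ^ N)⁻¹ * treeMean d N v K) ^ r :=
        ENNReal.tsum_le_tsum fun K => ENNReal.tsum_rpow_le_of_geometric hρ0 hρt hr _
    _ = (1 - ρ)⁻¹ ^ r * ∑' N, ((ρ ^ N)⁻¹) ^ r * ∑' K, treeMean d N v K ^ r := by
        rw [ENNReal.tsum_mul_left, ENNReal.tsum_comm]
        simp_rw [ENNReal.mul_rpow_of_nonneg _ _ hr.le, ENNReal.tsum_mul_left]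
    _ ≤ (1 - ρ)⁻¹ ^ r * ∑' N : ℕ, ((d : ℝ≥0∞)⁻¹ ^ (m / 2)) ^ N * ∑' J, v J ^ r := by
        refine mul_le_mul_right (ENNReal.tsum_le_tsum fun N => ?_) _
        rw [← key, mul_assoc]
        exact mul_le_mul_right (tsum_treeMean_rpow_le d N v hr) _
    _ = _ := by
        rw [ENNReal.tsum_mul_right, ENNReal.tsum_geometric, treeEnergyConst, mul_assoc]

omit [NeZero d]

theorem treeMean_add (N : ℕ) (v w : ℤ × ℤ → ℝ≥0∞) (K : ℤ × ℤ) :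
    treeMean d N (v + w) K = treeMean d N v K + treeMean d N w K := by
  simp [treeMean, Finset.sum_add_distrib, mul_add]

theorem treeEnergy_add (v w : ℤ × ℤ → ℝ≥0∞) (K : ℤ × ℤ) :
    treeEnergy d (v + w) K = treeEnergy d v K + treeEnergy d w K := by
  simp only [treeEnergy, treeMean_add, ENNReal.tsum_add]

end TreeEnergy

theorem ENNReal.finset_sum_rpow_le_card_mul {κ : Type*} (s : Finset κ) (f : κ → ℝ≥0∞) {r : ℝ}
    (hr : 0 < r) : (∑ i ∈ s, f i) ^ r ≤ (s.card : ℝ≥0∞) ^ r * ∑ i ∈ s, f i ^ r := by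
  rcases s.eq_empty_or_nonempty with rfl | hs
  · simp [hr]
  obtain ⟨i, hi, hmax⟩ := s.exists_max_image f hs
  calc (∑ i ∈ s, f i) ^ r ≤ (s.card * f i) ^ r := by
        gcongr
        simpa using Finset.sum_le_card_nsmul s f (f i) hmax
    _ = (s.card : ℝ≥0∞) ^ r * f i ^ r := ENNReal.mul_rpow_of_nonneg _ _ hr.le
    _ ≤ _ := by
        gcongr
        exact Finset.single_le_sum (f := fun i => f i ^ r) (fun _ _ => zero_le) hi

/-! ### Sums over subtrees and the Carleson embedding -/

section Subtree

/-- The children of a node of the `d`-adic tree. -/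
def kid (d : ℕ) (K : ℤ × ℤ) (j : Fin d) : ℤ × ℤ := (K.1 + 1, K.2 * d + (j : ℕ))

/-- The nodes of the `d`-adic tree that lie below a node. -/
def below (d : ℕ) (I : ℤ × ℤ) : Set (ℤ × ℤ) := {J | ∃ N, anc d N J = I}

/-- The sum of a function over the first `m` generations below a node. -/
def treeSum {R : Type*} [AddCommMonoid R] (d : ℕ) (v : ℤ × ℤ → R) : ℕ → ℤ × ℤ → R
  | 0, _ => 0
  | m + 1, I => v I + ∑ j, treeSum d v m (kid d I j)

theorem child_one (d : ℕ) (K : ℤ × ℤ) (j : Fin d) :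
    child d 1 K ((finCongr (pow_one d)).symm j) = kid d K j := by
  simp [child, kid]

theorem sum_child_one {R : Type*} [AddCommMonoid R] (d : ℕ) (v : ℤ × ℤ → R) (K : ℤ × ℤ) :
    ∑ l, v (child d 1 K l) = ∑ j, v (kid d K j) := by
  refine (Fintype.sum_equiv (finCongr (pow_one d)).symm _ _ fun j => ?_).symm
  rw [child_one]

theorem sum_child_zero {R : Type*} [AddCommMonoid R] (d : ℕ) (v : ℤ × ℤ → R) (K : ℤ × ℤ) :
    ∑ l, v (child d 0 K l) = v K := by
  refine (Fintype.sum_equiv (finCongr (pow_zero d)) _ (fun _ : Fin 1 => v K) fun l => ?_).trans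
    (by simp)
  have : (l : ℕ) = 0 := by
    have := l.2
    simp only [pow_zero] at this
    omega
  simp [child, this]

theorem kid_injective (d : ℕ) (K : ℤ × ℤ) : Function.Injective (kid d K) := by
  intro i j h
  have := congrArg Prod.snd h
  simp only [kid, add_right_inj, Nat.cast_inj] at this
  exact Fin.ext this

theorem treeSum_ofReal (d : ℕ) {v : ℤ × ℤ → ℝ} (hv : ∀ J, 0 ≤ v J) (m : ℕ) (I : ℤ × ℤ) :
    0 ≤ treeSum d v m I ∧
      treeSum d (fun J => ENNReal.ofReal (v J)) m I = ENNReal.ofReal (treeSum d v m I) := by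
  induction m generalizing I with
  | zero => simp [treeSum]
  | succ m ih =>
    have h1 : 0 ≤ ∑ j, treeSum d v m (kid d I j) := Finset.sum_nonneg fun j _ => (ih _).1
    refine ⟨add_nonneg (hv I) h1, ?_⟩
    rw [treeSum, treeSum, ENNReal.ofReal_add (hv I) h1,
      ENNReal.ofReal_sum_of_nonneg fun j _ => (ih _).1]
    simp_rw [(ih _).2]

theorem anc_one_eq_iff (d : ℕ) [NeZero d] (I J : ℤ × ℤ) :
    anc d 1 J = I ↔ ∃ j, kid d I j = J := by
  constructor
  · rintro rfl
    obtain ⟨l, hl⟩ := exists_child_anc d 1 J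
    refine ⟨finCongr (pow_one d) l, ?_⟩
    rw [← child_one, Equiv.symm_apply_apply, hl]
  · rintro ⟨j, rfl⟩
    rw [← child_one, anc_child]

variable (d : ℕ) [NeZero d]

theorem tsum_below (v : ℤ × ℤ → ℝ≥0∞) (I : ℤ × ℤ) :
    ∑' J, (below d I).indicator v J = ∑' N, ∑ l, v (child d N I l) := by
  simp_rw [← ENNReal.tsum_indicator_anc]
  rw [ENNReal.tsum_comm]
  refine tsum_congr fun J => ?_
  by_cases hJ : J ∈ below d I
  · obtain ⟨N, hN⟩ := id hJ
    rw [Set.indicator_of_mem hJ, tsum_eq_single N, Set.indicator_of_mem (by simpa using hN)]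
    intro M hM
    refine Set.indicator_of_notMem (fun h => hM ?_) _
    exact anc_injective d ((show anc d M J = I by simpa using h).trans hN.symm)
  · rw [Set.indicator_of_notMem hJ, ENNReal.tsum_eq_zero.2]
    exact fun N => Set.indicator_of_notMem (fun h => hJ ⟨N, by simpa using h⟩) _

/-- Sums over descendants are rewritten as sums over nodes with a prescribed ancestor, where
composition of ancestors replaces a bijection between index sets. -/
theorem sum_child_succ (N : ℕ) (v : ℤ × ℤ → ℝ≥0∞) (I : ℤ × ℤ) :
    ∑ l, v (child d (N + 1) I l) = ∑ j, ∑ l, v (child d N (kid d I j) l) := by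
  rw [← sum_child_one d (fun K => ∑ l, v (child d N K l)), ← ENNReal.tsum_indicator_anc,
    ← ENNReal.tsum_indicator_anc d 1 (fun K => ∑ l, v (child d N K l)),
    ENNReal.tsum_eq_tsum_child d N]
  refine tsum_congr fun K => ?_
  by_cases h : anc d 1 K = I
  · rw [Set.indicator_of_mem (show K ∈ anc d 1 ⁻¹' {I} from h)]
    refine Finset.sum_congr rfl fun l _ => Set.indicator_of_mem ?_ _
    simp [← anc_anc, anc_child, h]
  · rw [Set.indicator_of_notMem (show K ∉ anc d 1 ⁻¹' {I} from h)]
    refine Finset.sum_eq_zero fun l _ => Set.indicator_of_notMem ?_ _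
    simp [← anc_anc, anc_child, h]

theorem treeSum_eq_sum (v : ℤ × ℤ → ℝ≥0∞) (m : ℕ) (I : ℤ × ℤ) :
    treeSum d v m I = ∑ N ∈ Finset.range m, ∑ l, v (child d N I l) := by
  induction m generalizing I with
  | zero => simp [treeSum]
  | succ m ih =>
    rw [treeSum, Finset.sum_range_succ']
    simp_rw [sum_child_succ, ih]
    rw [Finset.sum_comm, add_comm]
    rw [sum_child_zero]

theorem treeSum_le_tsum_below (v : ℤ × ℤ → ℝ≥0∞) (m : ℕ) (I : ℤ × ℤ) :
    treeSum d v m I ≤ ∑' J, (below d I).indicator v J := by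
  rw [tsum_below, treeSum_eq_sum]
  exact ENNReal.sum_le_tsum _

theorem tsum_below_le {v : ℤ × ℤ → ℝ≥0∞} {I : ℤ × ℤ} {C : ℝ≥0∞} (h : ∀ m, treeSum d v m I ≤ C) :
    ∑' J, (below d I).indicator v J ≤ C := by
  rw [tsum_below, ENNReal.tsum_eq_iSup_nat]
  exact iSup_le fun m => (treeSum_eq_sum d v m I).symm.trans_le (h m)

omit [NeZero d] in
-- Any finite set of nodes lies below the nodes of one sufficiently coarse generation.
theorem tsum_le_of_below {g : ℤ × ℤ → ℝ≥0∞} {C : ℝ≥0∞}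
    (hg : ∀ n, ∑' k, ∑' J, (below d (n, k)).indicator g J ≤ C) : ∑' J, g J ≤ C := by
  rw [ENNReal.tsum_eq_iSup_sum]
  refine iSup_le fun s => ?_
  obtain ⟨n, hn⟩ : ∃ n : ℤ, ∀ J ∈ s, n ≤ J.1 := by
    obtain ⟨n, hn⟩ := (s.image Prod.fst).bddBelow
    exact ⟨n, fun J hJ => hn (Finset.mem_coe.2 (Finset.mem_image_of_mem _ hJ))⟩
  refine le_trans ?_ (hg n)
  rw [ENNReal.tsum_comm]
  refine le_trans (Finset.sum_le_sum fun J hJ => ?_) (ENNReal.sum_le_tsum s)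
  refine le_trans (le_of_eq ?_) (ENNReal.le_tsum (anc d (J.1 - n).toNat J).2)
  have h1 := hn J hJ
  rw [Set.indicator_of_mem]
  refine ⟨(J.1 - n).toNat, ?_⟩
  ext
  · simp only [anc_fst]
    omega
  · rfl

omit [NeZero d] in
/-- The Bellman function estimate behind the Carleson embedding theorem. -/
theorem treeSum_carleson_le {α σ F E : ℤ × ℤ → ℝ} {β : ℝ} (hα : ∀ J, 0 ≤ α J) (hβ : 0 < β)
    (hσ : ∀ J, 0 < σ J) (hσk : ∀ J, ∑ j, σ (kid d J j) = σ J)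
    (hA0 : ∀ m J, 0 ≤ treeSum d α m J)
    (hA : ∀ m J, treeSum d α m J ≤ β * σ J) (hF : ∀ J, 0 ≤ F J)
    (hFk : ∀ J, F J ≤ ∑ j, F (kid d J j)) (hEk : ∀ J, ∑ j, E (kid d J j) ≤ E J)
    (hFE : ∀ J, F J ^ 2 ≤ E J * σ J) (m : ℕ) (I : ℤ × ℤ) :
    treeSum d (fun J => α J * (F J / σ J) ^ 2) m I ≤
      4 * β * (E I - β * (F I ^ 2 / (β * σ I + treeSum d α m I))) := by
  induction m generalizing I with
  | zero =>
    simp only [treeSum, add_zero]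
    have := hσ I
    have h1 : β * (F I ^ 2 / (β * σ I)) = F I ^ 2 / σ I := by field_simp
    have h2 : F I ^ 2 / σ I ≤ E I := (div_le_iff₀ this).2 (hFE I)
    rw [h1]
    have := sub_nonneg.2 h2
    positivity
  | succ m ih =>
    have hσI := hσ I
    -- The Bellman function is `4 β (E - β F² / (β σ + A))`, with `A` the sum of `α` over the finite
    -- subtree; `w` holds the denominators at the children.
    set w : Fin d → ℝ := fun j => β * σ (kid d I j) + treeSum d α m (kid d I j) with hw
    have hw0 : ∀ j, 0 < w j := fun j => add_pos_of_pos_of_nonneg (mul_pos hβ (hσ _)) (hA0 _ _)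
    set W := ∑ j, w j with hW
    have hW1 : W = β * σ I + ∑ j, treeSum d α m (kid d I j) := by
      rw [hW, hw, Finset.sum_add_distrib, ← Finset.mul_sum, hσk]
    have hWpos : 0 < W := by
      rw [hW1]
      exact add_pos_of_pos_of_nonneg (mul_pos hβ hσI) (Finset.sum_nonneg fun j _ => hA0 _ _)
    have hWα : W + α I ≤ 2 * β * σ I := by
      have := hA (m + 1) I
      rw [treeSum] at this
      linarith
    -- Convexity of `F² / w`, in the form of the Cauchy-Schwarz inequality.
    have h1 : (F I) ^ 2 / W ≤ ∑ j, F (kid d I j) ^ 2 / w j := by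
      refine le_trans ?_ (Finset.sq_sum_div_le_sum_sq_div _ _ fun j _ => hw0 j)
      gcongr
      · exact hF I
      · exact hFk I
    have h2 : ∑ j, treeSum d (fun J => α J * (F J / σ J) ^ 2) m (kid d I j) ≤
        4 * β * (E I - β * (F I ^ 2 / W)) := by
      calc _ ≤ ∑ j, 4 * β * (E (kid d I j) - β * (F (kid d I j) ^ 2 / w j)) :=
            Finset.sum_le_sum fun j _ => ih _
        _ = 4 * β * (∑ j, E (kid d I j) - β * ∑ j, F (kid d I j) ^ 2 / w j) := by
            rw [← Finset.mul_sum, Finset.sum_sub_distrib, ← Finset.mul_sum]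
        _ ≤ _ := by
            have := hEk I
            gcongr
    have h3 : β * σ I + treeSum d α (m + 1) I = W + α I := by rw [treeSum, hW1]; ring
    -- The new term is paid for by enlarging the denominator by `α I`. The Carleson condition keeps
    -- both denominators below `2 β σ I`, so the drop is large enough; this fixes the constant `4`.
    have h4 : α I * (F I / σ I) ^ 2 ≤ 4 * β * (β * (F I ^ 2 / W) - β * (F I ^ 2 / (W + α I))) := by
      have hαI := hα I
      have e1 : 4 * β * (β * (F I ^ 2 / W) - β * (F I ^ 2 / (W + α I))) =
          α I * F I ^ 2 * (4 * β ^ 2 / (W * (W + α I))) := by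
        field_simp
        ring
      have e2 : α I * (F I / σ I) ^ 2 = α I * F I ^ 2 * (1 / σ I ^ 2) := by ring
      rw [e1, e2]
      refine mul_le_mul_of_nonneg_left ?_ (by positivity)
      rw [div_le_div_iff₀ (by positivity) (by positivity)]
      have : W * (W + α I) ≤ (2 * β * σ I) * (2 * β * σ I) := by
        gcongr
        linarith
      linarith
    rw [h3, treeSum]
    linarith

/-- The local Carleson embedding theorem on the `d`-adic tree. -/
theorem tsum_below_carleson_le {α σ F E : ℤ × ℤ → ℝ} {β : ℝ} (hα : ∀ J, 0 ≤ α J) (hβ : 0 < β)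
    (hσ : ∀ J, 0 < σ J) (hσk : ∀ J, ∑ j, σ (kid d J j) = σ J)
    (hA : ∀ J, ∑' K, (below d J).indicator (fun K => ENNReal.ofReal (α K)) K ≤
      ENNReal.ofReal (β * σ J))
    (hF : ∀ J, 0 ≤ F J)
    (hFk : ∀ J, F J ≤ ∑ j, F (kid d J j)) (hEk : ∀ J, ∑ j, E (kid d J j) ≤ E J)
    (hFE : ∀ J, F J ^ 2 ≤ E J * σ J) (I : ℤ × ℤ) :
    ∑' J, (below d I).indicator (fun J => ENNReal.ofReal (α J * (F J / σ J) ^ 2)) J ≤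
      ENNReal.ofReal (4 * β * E I) := by
  have hA0 := fun m J => (treeSum_ofReal d hα m J).1
  refine tsum_below_le d fun m => ?_
  rw [(treeSum_ofReal d (fun J => mul_nonneg (hα J) (sq_nonneg _)) m I).2]
  refine ENNReal.ofReal_le_ofReal ((treeSum_carleson_le d hα hβ hσ hσk hA0 (fun m J => ?_)
    hF hFk hEk hFE m I).trans ?_)
  · have := (treeSum_le_tsum_below d (fun K => ENNReal.ofReal (α K)) m J).trans (hA J)
    rw [(treeSum_ofReal d hα m J).2] at this
    exact (ENNReal.ofReal_le_ofReal_iff (mul_pos hβ (hσ J)).le).1 this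
  · have h1 := hA0 m I
    have h2 := hσ I
    gcongr
    have : 0 ≤ β * (F I ^ 2 / (β * σ I + treeSum d α m I)) := by positivity
    linarith

end Subtree

/-! ### The discrete Fourier transform -/

section Fourier

/-- The primitive `d`-th root of unity `e^{2πi/d}`. -/
def unitRoot (d : ℕ) : ℂ := Complex.exp (2 * Real.pi * Complex.I / d)

theorem isPrimitiveRoot_unitRoot (d : ℕ) [NeZero d] : IsPrimitiveRoot (unitRoot d) d :=
  Complex.isPrimitiveRoot_exp d (NeZero.ne d)

theorem norm_unitRoot (d : ℕ) [NeZero d] : ‖unitRoot d‖ = 1 :=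
  (isPrimitiveRoot_unitRoot d).norm'_eq_one (NeZero.ne d)

theorem conj_unitRoot_mul (d : ℕ) [NeZero d] : (starRingEnd ℂ) (unitRoot d) * unitRoot d = 1 := by
  rw [mul_comm, Complex.mul_conj, Complex.normSq_eq_norm_sq, norm_unitRoot]
  simp

theorem conj_unitRoot_pow_mul_eq_one_iff (d : ℕ) [NeZero d] {a b : ℕ} (ha : a < d) (hb : b < d) :
    (starRingEnd ℂ) (unitRoot d) ^ a * unitRoot d ^ b = 1 ↔ a = b := by
  have h := conj_unitRoot_mul d
  constructor
  · intro hab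
    have h1 : unitRoot d ^ a = unitRoot d ^ b := by
      calc unitRoot d ^ a = unitRoot d ^ a * ((starRingEnd ℂ) (unitRoot d) ^ a * unitRoot d ^ b) := by
            rw [hab, mul_one]
        _ = ((starRingEnd ℂ) (unitRoot d) * unitRoot d) ^ a * unitRoot d ^ b := by ring
        _ = _ := by rw [h, one_pow, one_mul]
    exact (isPrimitiveRoot_unitRoot d).pow_inj ha hb h1
  · rintro rfl
    rw [← mul_pow, h, one_pow]

theorem sum_conj_unitRoot_pow_mul (d : ℕ) [NeZero d] {a b : ℕ} (ha : a < d) (hb : b < d) :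
    ∑ j ∈ Finset.range d, ((starRingEnd ℂ) (unitRoot d) ^ a * unitRoot d ^ b) ^ j =
      if a = b then (d : ℂ) else 0 := by
  split_ifs with hab
  · rw [(conj_unitRoot_pow_mul_eq_one_iff d ha hb).2 hab]
    simp
  · have h1 := mt (conj_unitRoot_pow_mul_eq_one_iff d ha hb).1 hab
    rw [geom_sum_eq h1]
    have h2 : ((starRingEnd ℂ) (unitRoot d) ^ a * unitRoot d ^ b) ^ d = 1 := by
      have h3 := (isPrimitiveRoot_unitRoot d).pow_eq_one
      rw [mul_pow, ← pow_mul, ← pow_mul, mul_comm a, mul_comm b, pow_mul, pow_mul, ← map_pow, h3]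
      simp
    rw [h2, sub_self, zero_div]

theorem sum_Icc_eq_sum_range_sub {R : Type*} [AddCommGroup R] {d : ℕ} [NeZero d] (f : ℕ → R) :
    ∑ i : Finset.Icc 1 (d - 1), f i = ∑ i ∈ Finset.range d, f i - f 0 := by
  have h : Finset.range d = insert 0 (Finset.Icc 1 (d - 1)) := by
    have := NeZero.ne d
    ext i
    simp only [Finset.mem_range, Finset.mem_insert, Finset.mem_Icc]
    omega
  rw [h, Finset.sum_insert (by simp), add_sub_cancel_left]
  exact Finset.sum_coe_sort (Finset.Icc 1 (d - 1)) f

/-- Plancherel's identity for vectors with vanishing mean. -/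
theorem sum_norm_fourier_sq (d : ℕ) [NeZero d] (v : Fin d → ℂ) (hv : ∑ j, v j = 0) :
    ∑ i : Finset.Icc 1 (d - 1),
      ‖∑ j : Fin d, (starRingEnd ℂ) (unitRoot d ^ ((i : ℕ) * ((j : ℕ) + 1))) * v j‖ ^ 2 =
      d * ∑ j, ‖v j‖ ^ 2 := by
  set u := unitRoot d with hu
  set F : ℕ → ℂ := fun i => ∑ j : Fin d, (starRingEnd ℂ) (u ^ (i * ((j : ℕ) + 1))) * v j with hF
  have h0 : F 0 = 0 := by simp [hF, hv]
  rw [sum_Icc_eq_sum_range_sub (fun i => ‖F i‖ ^ 2), h0]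
  have h1 : ∀ i, ((‖F i‖ ^ 2 : ℝ) : ℂ) = ∑ j : Fin d, ∑ l : Fin d, v j * (starRingEnd ℂ) (v l) *
      ((starRingEnd ℂ) u * u * ((starRingEnd ℂ) u ^ (j : ℕ) * u ^ (l : ℕ))) ^ i := by
    intro i
    rw [← Complex.normSq_eq_norm_sq, ← Complex.mul_conj, hF, map_sum, Finset.sum_mul_sum]
    refine Finset.sum_congr rfl fun j _ => Finset.sum_congr rfl fun l _ => ?_
    simp only [map_mul, map_pow, Complex.conj_conj]
    rw [mul_comm i, mul_comm i, pow_mul, pow_mul]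
    ring
  rw [← Complex.ofReal_inj]
  push_cast
  have h2 : ∑ i ∈ Finset.range d, ((‖F i‖ ^ 2 : ℝ) : ℂ) = d * ∑ j, ((‖v j‖ ^ 2 : ℝ) : ℂ) := by
    simp_rw [h1]
    rw [Finset.sum_comm, Finset.mul_sum]
    refine Finset.sum_congr rfl fun j _ => ?_
    rw [Finset.sum_comm]
    simp_rw [← Finset.mul_sum, hu, conj_unitRoot_mul, one_mul,
      sum_conj_unitRoot_pow_mul d j.2 (Fin.is_lt _)]
    rw [Finset.sum_eq_single j]
    · rw [if_pos rfl, ← Complex.normSq_eq_norm_sq, ← Complex.mul_conj]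
      ring
    · intro l _ hl
      rw [if_neg (fun h => hl (Fin.ext h.symm)), mul_zero]
    · simp
  push_cast at h2
  rw [h2]
  simp

theorem sum_unitRoot_pow (d : ℕ) [NeZero d] (i : Finset.Icc 1 (d - 1)) :
    ∑ j : Fin d, unitRoot d ^ ((i : ℕ) * ((j : ℕ) + 1)) = 0 := by
  obtain ⟨i, hi⟩ := i
  rw [Finset.mem_Icc] at hi
  have hd := NeZero.pos d
  have h1 := sum_conj_unitRoot_pow_mul d (a := 0) (b := i) hd (by omega)
  rw [if_neg (by omega), ← Fin.sum_univ_eq_sum_range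
    (fun j => ((starRingEnd ℂ) (unitRoot d) ^ 0 * unitRoot d ^ i) ^ j)] at h1
  simp_rw [mul_add, pow_add, ← Finset.sum_mul, pow_mul]
  simp only [pow_zero, one_mul] at h1
  rw [h1, zero_mul]

theorem sum_conj_unitRoot_mul (d : ℕ) [NeZero d] (i i' : Finset.Icc 1 (d - 1)) :
    ∑ j : Fin d, (starRingEnd ℂ) (unitRoot d ^ ((i : ℕ) * ((j : ℕ) + 1))) *
      unitRoot d ^ ((i' : ℕ) * ((j : ℕ) + 1)) = if i = i' then (d : ℂ) else 0 := by
  have hi := Finset.mem_Icc.1 i.2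
  have hi' := Finset.mem_Icc.1 i'.2
  have hd := NeZero.pos d
  have h1 := sum_conj_unitRoot_pow_mul d (a := i) (b := i') (by omega) (by omega)
  rw [← Fin.sum_univ_eq_sum_range
    (fun j => ((starRingEnd ℂ) (unitRoot d) ^ (i : ℕ) * unitRoot d ^ (i' : ℕ)) ^ j)] at h1
  have h2 : ∀ j : Fin d, (starRingEnd ℂ) (unitRoot d ^ ((i : ℕ) * ((j : ℕ) + 1))) *
      unitRoot d ^ ((i' : ℕ) * ((j : ℕ) + 1)) =
      ((starRingEnd ℂ) (unitRoot d) ^ (i : ℕ) * unitRoot d ^ (i' : ℕ)) ^ (j : ℕ) *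
        ((starRingEnd ℂ) (unitRoot d) ^ (i : ℕ) * unitRoot d ^ (i' : ℕ)) := by
    intro j
    rw [← pow_succ, pow_mul, pow_mul, map_pow, map_pow, mul_pow]
  simp_rw [h2]
  rw [← Finset.sum_mul, h1]
  by_cases h : i = i'
  · subst h
    rw [if_pos rfl, if_pos rfl, (conj_unitRoot_pow_mul_eq_one_iff d (by omega) (by omega)).2 rfl,
      mul_one]
  · rw [if_neg h, if_neg (fun h' => h (Subtype.ext h')), zero_mul]

end Fourier

/-! ### Nodes of a `d`-adic system -/

namespace DAdicSystem

section Node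

variable {d : ℕ} {Ω : Type*} [MeasurableSpace Ω] {μ : Measure Ω} (D : DAdicSystem d μ)

/-- The `d`-adic interval with a given index. -/
def node (J : ℤ × ℤ) : Set Ω := D.I J.1 J.2

theorem measurableSet_node (J : ℤ × ℤ) : MeasurableSet (D.node J) := by
  have h := MeasurableSpace.measurableSet_generateFrom
    (s := {s | ∃ n k : ℤ, s = D.I n k}) ⟨J.1, J.2, rfl⟩
  rw [← D.generate] at h
  exact h

theorem node_eq_iUnion (J : ℤ × ℤ) : D.node J = ⋃ j, D.node (kid d J j) := D.children J.1 J.2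

theorem node_kid_subset (J : ℤ × ℤ) (j : Fin d) : D.node (kid d J j) ⊆ D.node J := by
  rw [D.node_eq_iUnion J]
  exact Set.subset_iUnion (fun j => D.node (kid d J j)) j

theorem exists_mem_node (n : ℤ) (x : Ω) : ∃ k, x ∈ D.node (n, k) := by
  have h := Set.mem_univ x
  rwa [← D.cover n, Set.mem_iUnion] at h

theorem disjoint_node {J K : ℤ × ℤ} (h : J.1 = K.1) (hne : J ≠ K) :
    Disjoint (D.node J) (D.node K) := by
  obtain ⟨n, k⟩ := J
  obtain ⟨m, l⟩ := K
  obtain rfl : n = m := h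
  exact D.disjoint n fun h => hne (congrArg (Prod.mk n) h)

theorem eq_of_mem_node {J K : ℤ × ℤ} (h : J.1 = K.1) {x : Ω} (hJ : x ∈ D.node J)
    (hK : x ∈ D.node K) : J = K := by
  by_contra hne
  exact Set.disjoint_left.1 (D.disjoint_node h hne) hJ hK

theorem disjoint_kid (J : ℤ × ℤ) :
    Pairwise fun i j => Disjoint (D.node (kid d J i)) (D.node (kid d J j)) :=
  fun _ _ hij => D.disjoint_node rfl fun h => hij (kid_injective d J h)

variable [NeZero d]

theorem node_subset_anc (N : ℕ) (J : ℤ × ℤ) : D.node J ⊆ D.node (anc d N J) := by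
  induction N with
  | zero => rw [anc_zero]
  | succ N ih =>
    rw [← anc_anc]
    obtain ⟨j, hj⟩ := (anc_one_eq_iff d (anc d 1 (anc d N J)) (anc d N J)).1 rfl
    have h := D.node_kid_subset (anc d 1 (anc d N J)) j
    rw [hj] at h
    exact ih.trans h

theorem node_subset_of_mem_below {I J : ℤ × ℤ} (h : J ∈ below d I) : D.node J ⊆ D.node I := by
  obtain ⟨N, rfl⟩ := h
  exact D.node_subset_anc N J

theorem below_or_below_or_disjoint (J K : ℤ × ℤ) :
    J ∈ below d K ∨ K ∈ below d J ∨ Disjoint (D.node J) (D.node K) := by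
  have key : ∀ J K : ℤ × ℤ, K.1 ≤ J.1 → J ∈ below d K ∨ Disjoint (D.node J) (D.node K) := by
    intro J K h
    by_cases hJ : anc d (J.1 - K.1).toNat J = K
    · exact Or.inl ⟨_, hJ⟩
    · refine Or.inr (Set.disjoint_of_subset_left (D.node_subset_anc (J.1 - K.1).toNat J)
        (D.disjoint_node ?_ hJ))
      rw [anc_fst]
      omega
  rcases le_total K.1 J.1 with h | h
  · rcases key J K h with h | h
    · exact Or.inl h
    · exact Or.inr (Or.inr h)
  · rcases key K J h with h | h
    · exact Or.inr (Or.inl h)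
    · exact Or.inr (Or.inr h.symm)

omit [NeZero d] in
theorem measure_node (J : ℤ × ℤ) : μ (D.node J) = (d : ℝ≥0∞) ^ (-J.1) := D.measure_eq J.1 J.2

theorem measure_node_ne_zero (J : ℤ × ℤ) : μ (D.node J) ≠ 0 := by
  rw [measure_node]
  exact (ENNReal.zpow_pos (by exact_mod_cast NeZero.ne d) (ENNReal.natCast_ne_top d) _).ne'

theorem measure_node_ne_top (J : ℤ × ℤ) : μ (D.node J) ≠ ⊤ := by
  rw [measure_node]
  exact (ENNReal.zpow_lt_top (by exact_mod_cast NeZero.ne d) (ENNReal.natCast_ne_top d) _).ne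

end Node

/-- The length of the `d`-adic intervals with a given index. -/
def _root_.nodeSize (d : ℕ) (J : ℤ × ℤ) : ℝ := (d : ℝ) ^ (-J.1)

section Size

variable {d : ℕ} [NeZero d]

theorem _root_.nodeSize_pos (J : ℤ × ℤ) : 0 < nodeSize d J :=
  zpow_pos (by exact_mod_cast NeZero.pos d) _

theorem _root_.nodeSize_kid (J : ℤ × ℤ) (j : Fin d) : nodeSize d (kid d J j) = nodeSize d J / d := by
  have : (d : ℝ) ≠ 0 := by exact_mod_cast NeZero.ne d
  rw [nodeSize, nodeSize, kid, neg_add, zpow_add₀ this]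
  simp [div_eq_mul_inv]

theorem _root_.sum_nodeSize_kid (J : ℤ × ℤ) : ∑ j, nodeSize d (kid d J j) = nodeSize d J := by
  have : (d : ℝ) ≠ 0 := by exact_mod_cast NeZero.ne d
  simp_rw [nodeSize_kid]
  simp
  field_simp

theorem _root_.nodeSize_anc (N : ℕ) (J : ℤ × ℤ) :
    nodeSize d (anc d N J) = (d : ℝ) ^ N * nodeSize d J := by
  have : (d : ℝ) ≠ 0 := by exact_mod_cast NeZero.ne d
  rw [nodeSize, nodeSize, anc_fst, ← zpow_natCast, ← zpow_add₀ this]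
  congr 1
  ring

end Size

section Average

variable {d : ℕ} {Ω : Type*} [MeasurableSpace Ω] {μ : Measure Ω} (D : DAdicSystem d μ) [NeZero d]

theorem measure_node_eq_ofReal (J : ℤ × ℤ) : μ (D.node J) = ENNReal.ofReal (nodeSize d J) := by
  have hd : (0 : ℝ) < d := by exact_mod_cast NeZero.pos d
  rw [measure_node, nodeSize, ← Real.rpow_intCast, ← ENNReal.ofReal_rpow_of_pos hd,
    ENNReal.ofReal_natCast, ENNReal.rpow_intCast]

theorem measureReal_node (J : ℤ × ℤ) : μ.real (D.node J) = nodeSize d J := by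
  rw [measureReal_def, measure_node_eq_ofReal, ENNReal.toReal_ofReal (nodeSize_pos J).le]

/-- The mean of a function over a node. -/
def avg (g : Ω → ℂ) (J : ℤ × ℤ) : ℂ := ⨍ y in D.node J, g y ∂μ

theorem setIntegral_node (g : Ω → ℂ) (J : ℤ × ℤ) :
    ∫ x in D.node J, g x ∂μ = nodeSize d J * D.avg g J := by
  have := (nodeSize_pos (d := d) J).ne'
  rw [avg, setAverage_eq, measureReal_node, Complex.real_smul, ← mul_assoc, ← Complex.ofReal_mul,
    mul_inv_cancel₀ this, Complex.ofReal_one, one_mul]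

omit [NeZero d] in
theorem setIntegral_node_eq_sum {E : Type*} [NormedAddCommGroup E] [NormedSpace ℝ E]
    {g : Ω → E} {J : ℤ × ℤ} (hg : IntegrableOn g (D.node J) μ) :
    ∫ x in D.node J, g x ∂μ = ∑ j, ∫ x in D.node (kid d J j), g x ∂μ := by
  rw [D.node_eq_iUnion J, integral_iUnion_fintype (fun j => D.measurableSet_node _)
    (D.disjoint_kid J) fun j => hg.mono_set (D.node_kid_subset J j)]

theorem avg_eq_sum {g : Ω → ℂ} {J : ℤ × ℤ} (hg : IntegrableOn g (D.node J) μ) :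
    ∑ j, D.avg g (kid d J j) = d * D.avg g J := by
  have h := D.setIntegral_node_eq_sum hg
  simp_rw [setIntegral_node, nodeSize_kid] at h
  have h1 : (d : ℂ) ≠ 0 := by exact_mod_cast NeZero.ne d
  have h2 : (nodeSize d J : ℂ) ≠ 0 := by exact_mod_cast (nodeSize_pos J).ne'
  rw [← Finset.mul_sum] at h
  push_cast at h
  field_simp at h
  rw [← h, mul_comm]

theorem avg_const (c : ℂ) (J : ℤ × ℤ) : D.avg (fun _ => c) J = c :=
  setAverage_const (D.measure_node_ne_zero J) (D.measure_node_ne_top J) c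

omit [NeZero d] in
theorem avg_congr {f g : Ω → ℂ} {J : ℤ × ℤ} (h : ∀ x ∈ D.node J, f x = g x) :
    D.avg f J = D.avg g J :=
  setAverage_congr_fun (D.measurableSet_node J) (Eventually.of_forall h)

end Average

end DAdicSystem

/-! ### Haar wavelets and Haar coefficients -/

theorem exists_mem_below_kid {d : ℕ} [NeZero d] {J K : ℤ × ℤ} (h : J ∈ below d K) (hne : J ≠ K) :
    ∃ j, J ∈ below d (kid d K j) := by
  obtain ⟨N, hN⟩ := h
  cases N with
  | zero => exact absurd (by rw [← hN, anc_zero]) hne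
  | succ N =>
    rw [← anc_anc] at hN
    obtain ⟨j, hj⟩ := (anc_one_eq_iff d _ _).1 hN
    exact ⟨j, N, hj.symm⟩

/-- The value of a Haar wavelet on a child of its interval. -/
def haarVal (d : ℕ) (J : ℤ × ℤ) (i : ℕ) (j : Fin d) : ℂ :=
  (((d : ℝ) ^ ((J.1 : ℝ) / 2) : ℝ) : ℂ) * unitRoot d ^ (i * ((j : ℕ) + 1))

theorem norm_haarVal_sq {d : ℕ} [NeZero d] (J : ℤ × ℤ) (i : ℕ) (j : Fin d) :
    ‖haarVal d J i j‖ ^ 2 = (nodeSize d J)⁻¹ := by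
  have hd : (0 : ℝ) < d := by exact_mod_cast NeZero.pos d
  rw [haarVal, norm_mul, norm_pow, norm_unitRoot, one_pow, mul_one, Complex.norm_real,
    Real.norm_of_nonneg (by positivity), ← Real.rpow_natCast, ← Real.rpow_mul hd.le, nodeSize,
    ← Real.rpow_intCast, ← Real.rpow_neg hd.le]
  congr 1
  push_cast
  ring

theorem sum_haarVal {d : ℕ} [NeZero d] (J : ℤ × ℤ) (i : Finset.Icc 1 (d - 1)) :
    ∑ j, haarVal d J i j = 0 := by
  simp_rw [haarVal]
  rw [← Finset.mul_sum, sum_unitRoot_pow, mul_zero]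

theorem sum_conj_haarVal_mul {d : ℕ} [NeZero d] (J : ℤ × ℤ) (i i' : Finset.Icc 1 (d - 1)) :
    ∑ j, (starRingEnd ℂ) (haarVal d J i j) * haarVal d J i' j =
      if i = i' then (d : ℂ) / nodeSize d J else 0 := by
  have hd : (0 : ℝ) < d := by exact_mod_cast NeZero.pos d
  have h1 : (((d : ℝ) ^ ((J.1 : ℝ) / 2) : ℝ) : ℂ) * (((d : ℝ) ^ ((J.1 : ℝ) / 2) : ℝ) : ℂ) =
      ((nodeSize d J)⁻¹ : ℝ) := by
    rw [← Complex.ofReal_mul, ← Real.rpow_add hd, nodeSize, ← Real.rpow_intCast,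
      ← Real.rpow_neg hd.le]
    congr 2
    push_cast
    ring
  simp_rw [haarVal, map_mul, Complex.conj_ofReal, mul_mul_mul_comm]
  rw [← Finset.mul_sum, sum_conj_unitRoot_mul, h1]
  split_ifs
  · push_cast
    ring
  · simp

namespace DAdicSystem

variable {d : ℕ} {Ω : Type*} [MeasurableSpace Ω] {μ : Measure Ω} (D : DAdicSystem d μ)

theorem haar_eq_sum (J : ℤ × ℤ) (i : ℕ) (x : Ω) :
    D.haar J.1 J.2 i x =
      ∑ j, (D.node (kid d J j)).indicator (fun _ => haarVal d J i j) x := by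
  rw [haar, Finset.mul_sum]
  refine Finset.sum_congr rfl fun j _ => ?_
  by_cases h : x ∈ D.node (kid d J j)
  · rw [Set.indicator_of_mem h]
    exact congrArg _ (Set.indicator_of_mem (s := D.I (J.1 + 1) (J.2 * d + (j : ℕ))) h _)
  · rw [Set.indicator_of_notMem h]
    exact (congrArg _ (Set.indicator_of_notMem
      (s := D.I (J.1 + 1) (J.2 * d + (j : ℕ))) h _)).trans (mul_zero _)

theorem sum_indicator_kid {E : Type*} [AddCommMonoid E] {J : ℤ × ℤ} {j : Fin d} {x : Ω}
    (hx : x ∈ D.node (kid d J j)) (f : Fin d → Ω → E) :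
    ∑ l, (D.node (kid d J l)).indicator (f l) x = f j x := by
  rw [Finset.sum_eq_single j, Set.indicator_of_mem hx]
  · intro l _ hl
    exact Set.indicator_of_notMem (fun h => Set.disjoint_left.1 (D.disjoint_kid J hl) h hx) _
  · simp

theorem sum_indicator_kid_of_notMem {E : Type*} [AddCommMonoid E] {J : ℤ × ℤ} {x : Ω}
    (hx : x ∉ D.node J) (f : Fin d → Ω → E) :
    ∑ l, (D.node (kid d J l)).indicator (f l) x = 0 :=
  Finset.sum_eq_zero fun l _ => Set.indicator_of_notMem (fun h => hx (D.node_kid_subset J l h)) _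

theorem exists_mem_kid {J : ℤ × ℤ} {x : Ω} (hx : x ∈ D.node J) : ∃ j, x ∈ D.node (kid d J j) := by
  rwa [D.node_eq_iUnion, Set.mem_iUnion] at hx

theorem haar_of_mem_kid {J : ℤ × ℤ} {i : ℕ} {j : Fin d} {x : Ω} (hx : x ∈ D.node (kid d J j)) :
    D.haar J.1 J.2 i x = haarVal d J i j := by
  rw [haar_eq_sum, D.sum_indicator_kid hx]

theorem haar_of_notMem {J : ℤ × ℤ} {i : ℕ} {x : Ω} (hx : x ∉ D.node J) :
    D.haar J.1 J.2 i x = 0 := by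
  rw [haar_eq_sum, D.sum_indicator_kid_of_notMem hx]

theorem measurable_haar (J : ℤ × ℤ) (i : ℕ) : Measurable (D.haar J.1 J.2 i) := by
  simp_rw [funext (D.haar_eq_sum J i)]
  exact Finset.measurable_sum _ fun j _ => measurable_const.indicator (D.measurableSet_node _)

variable [NeZero d]

theorem norm_haar_sq_le (J : ℤ × ℤ) (i : ℕ) (x : Ω) :
    ‖D.haar J.1 J.2 i x‖ ^ 2 ≤ (nodeSize d J)⁻¹ := by
  by_cases hx : x ∈ D.node J
  · obtain ⟨j, hj⟩ := D.exists_mem_kid hx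
    rw [D.haar_of_mem_kid hj, norm_haarVal_sq]
  · rw [D.haar_of_notMem hx]
    simp [(nodeSize_pos J).le]

theorem memLp_haar (J : ℤ × ℤ) (i : ℕ) (p : ℝ≥0∞) : MemLp (D.haar J.1 J.2 i) p μ := by
  simp_rw [funext (D.haar_eq_sum J i)]
  exact memLp_finsetSum _ fun j _ => memLp_indicator_const p (D.measurableSet_node _) _
    (Or.inr (D.measure_node_ne_top _))

omit [NeZero d] in
theorem conj_haar_mul (J : ℤ × ℤ) (i : ℕ) (g : Ω → ℂ) (x : Ω) :
    (starRingEnd ℂ) (D.haar J.1 J.2 i x) * g x =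
      ∑ j, (D.node (kid d J j)).indicator
        (fun x => (starRingEnd ℂ) (haarVal d J i j) * g x) x := by
  by_cases hx : x ∈ D.node J
  · obtain ⟨j, hj⟩ := D.exists_mem_kid hx
    rw [D.sum_indicator_kid hj, D.haar_of_mem_kid hj]
  · rw [D.sum_indicator_kid_of_notMem hx, D.haar_of_notMem hx]
    simp

omit [NeZero d] in
theorem haarCoeff_eq_sum {g : Ω → ℂ} {J : ℤ × ℤ} (hg : IntegrableOn g (D.node J) μ) (i : ℕ) :
    D.haarCoeff g J.1 J.2 i =
      ∑ j, (starRingEnd ℂ) (haarVal d J i j) * ∫ x in D.node (kid d J j), g x ∂μ := by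
  rw [haarCoeff]
  simp_rw [conj_haar_mul]
  rw [integral_finsetSum]
  · refine Finset.sum_congr rfl fun j _ => ?_
    rw [integral_indicator (D.measurableSet_node _), integral_const_mul]
  · intro j _
    rw [integrable_indicator_iff (D.measurableSet_node _)]
    exact (hg.mono_set (D.node_kid_subset J j)).const_mul _

omit [NeZero d] in
theorem haarCoeff_congr {f g : Ω → ℂ} {J : ℤ × ℤ} (h : ∀ x ∈ D.node J, f x = g x) (i : ℕ) :
    D.haarCoeff f J.1 J.2 i = D.haarCoeff g J.1 J.2 i := by
  refine integral_congr_ae (Eventually.of_forall fun x => ?_)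
  by_cases hx : x ∈ D.node J
  · simp only [h x hx]
  · simp only [D.haar_of_notMem hx, map_zero, zero_mul]

theorem integrableOn_const_node (c : ℂ) (J : ℤ × ℤ) :
    IntegrableOn (fun _ => c) (D.node J) μ :=
  integrableOn_const (D.measure_node_ne_top J)

theorem haarCoeff_const (c : ℂ) (J : ℤ × ℤ) (i : Finset.Icc 1 (d - 1)) :
    D.haarCoeff (fun _ => c) J.1 J.2 i = 0 := by
  rw [D.haarCoeff_eq_sum (D.integrableOn_const_node c J)]
  simp_rw [setIntegral_node, avg_const, nodeSize_kid]
  rw [← Finset.sum_mul, ← map_sum, sum_haarVal, map_zero, zero_mul]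

omit [NeZero d] in
theorem haarCoeff_add {f g : Ω → ℂ} {J : ℤ × ℤ} (hf : IntegrableOn f (D.node J) μ)
    (hg : IntegrableOn g (D.node J) μ) (i : ℕ) :
    D.haarCoeff (fun x => f x + g x) J.1 J.2 i =
      D.haarCoeff f J.1 J.2 i + D.haarCoeff g J.1 J.2 i := by
  rw [D.haarCoeff_eq_sum hf, D.haarCoeff_eq_sum hg,
    D.haarCoeff_eq_sum (g := fun x => f x + g x) (hf.add hg), ← Finset.sum_add_distrib]
  refine Finset.sum_congr rfl fun j _ => ?_
  rw [integral_add (hf.mono_set (D.node_kid_subset J j)) (hg.mono_set (D.node_kid_subset J j)),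
    mul_add]

omit [NeZero d] in
theorem haarCoeff_const_mul (c : ℂ) (g : Ω → ℂ) (J : ℤ × ℤ) (i : ℕ) :
    D.haarCoeff (fun x => c * g x) J.1 J.2 i = c * D.haarCoeff g J.1 J.2 i := by
  rw [haarCoeff, haarCoeff, ← integral_const_mul]
  congr 1
  ext x
  ring

omit [NeZero d] in
theorem haarCoeff_sub {f g : Ω → ℂ} {J : ℤ × ℤ} (hf : IntegrableOn f (D.node J) μ)
    (hg : IntegrableOn g (D.node J) μ) (i : ℕ) :
    D.haarCoeff (fun x => f x - g x) J.1 J.2 i =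
      D.haarCoeff f J.1 J.2 i - D.haarCoeff g J.1 J.2 i := by
  have h := D.haarCoeff_add (g := fun x => -1 * g x) hf (hg.const_mul (-1)) i
  rw [haarCoeff_const_mul] at h
  simpa [sub_eq_add_neg] using h

theorem haarCoeff_sub_const {g : Ω → ℂ} {J : ℤ × ℤ} (hg : IntegrableOn g (D.node J) μ) (c : ℂ)
    (i : Finset.Icc 1 (d - 1)) :
    D.haarCoeff (fun x => g x - c) J.1 J.2 i = D.haarCoeff g J.1 J.2 i := by
  rw [D.haarCoeff_sub hg (D.integrableOn_const_node c J), haarCoeff_const, sub_zero]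

/-- The energy of the Haar coefficients of a function at a node. -/
theorem sum_norm_haarCoeff_sq {g : Ω → ℂ} {J : ℤ × ℤ} (hg : IntegrableOn g (D.node J) μ) :
    ∑ i : Finset.Icc 1 (d - 1), ‖D.haarCoeff g J.1 J.2 i‖ ^ 2 =
      nodeSize d J / d * ∑ j, ‖D.avg g (kid d J j) - D.avg g J‖ ^ 2 := by
  have hd : (0 : ℝ) < d := by exact_mod_cast NeZero.pos d
  have hσ := nodeSize_pos (d := d) J
  set v : Fin d → ℂ := fun j => D.avg g (kid d J j) - D.avg g J with hv
  have hv0 : ∑ j, v j = 0 := by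
    rw [hv, Finset.sum_sub_distrib, D.avg_eq_sum hg]
    simp
  set r : ℝ := (d : ℝ) ^ ((J.1 : ℝ) / 2) with hr
  have h1 : ∀ i : Finset.Icc 1 (d - 1), D.haarCoeff g J.1 J.2 i = ((r * (nodeSize d J / d) : ℝ) : ℂ) *
      ∑ j : Fin d, (starRingEnd ℂ) (unitRoot d ^ ((i : ℕ) * ((j : ℕ) + 1))) * v j := by
    intro i
    rw [← D.haarCoeff_sub_const hg (D.avg g J), D.haarCoeff_eq_sum
      (g := fun x => g x - D.avg g J) (hg.sub (D.integrableOn_const_node _ _)), Finset.mul_sum]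
    refine Finset.sum_congr rfl fun j _ => ?_
    rw [integral_sub (hg.mono_set (D.node_kid_subset J j)) (D.integrableOn_const_node _ _),
      D.setIntegral_node, D.setIntegral_node, D.avg_const, nodeSize_kid, haarVal]
    simp only [map_mul, Complex.conj_ofReal, hv]
    push_cast
    ring
  have h2 : r ^ 2 = (nodeSize d J)⁻¹ := by
    rw [hr, ← Real.rpow_natCast, ← Real.rpow_mul hd.le, nodeSize, ← Real.rpow_intCast,
      ← Real.rpow_neg hd.le]
    congr 1
    push_cast
    ring
  simp_rw [h1, norm_mul, mul_pow, Complex.norm_real, Real.norm_eq_abs, sq_abs]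
  rw [← Finset.mul_sum, sum_norm_fourier_sq d v hv0, mul_pow, h2]
  simp only [hv]
  field_simp

theorem avg_kid_eq_of_haarCoeff_eq_zero {g : Ω → ℂ} {J : ℤ × ℤ} (hg : IntegrableOn g (D.node J) μ)
    (h : ∀ i : Finset.Icc 1 (d - 1), D.haarCoeff g J.1 J.2 i = 0) (j : Fin d) :
    D.avg g (kid d J j) = D.avg g J := by
  have h1 := D.sum_norm_haarCoeff_sq hg
  have hσ := nodeSize_pos (d := d) J
  have hd : (0 : ℝ) < d := by exact_mod_cast NeZero.pos d
  simp only [h, norm_zero, ne_eq, OfNat.ofNat_ne_zero, not_false_eq_true, zero_pow,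
    Finset.sum_const_zero] at h1
  have h2 := (mul_eq_zero.1 h1.symm).resolve_left (by positivity)
  rw [Finset.sum_eq_zero_iff_of_nonneg (fun _ _ => by positivity)] at h2
  exact sub_eq_zero.1 (norm_eq_zero.1 (pow_eq_zero_iff two_ne_zero |>.1 (h2 j (Finset.mem_univ j))))

/-! ### Uniqueness -/

omit [NeZero d] in
theorem ae_of_forall_node {p : Ω → Prop} (n : ℤ)
    (h : ∀ J : ℤ × ℤ, J.1 = n → ∀ᵐ x ∂μ, x ∈ D.node J → p x) : ∀ᵐ x ∂μ, p x := by
  have h1 : ∀ᵐ x ∂μ, ∀ k : ℤ, x ∈ D.node (n, k) → p x := ae_all_iff.2 fun k => h (n, k) rfl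
  filter_upwards [h1] with x hx
  obtain ⟨k, hk⟩ := D.exists_mem_node n x
  exact hx k hk

theorem isPiSystem_node : IsPiSystem {s | ∃ n k : ℤ, s = D.I n k} := by
  rintro _ ⟨n, k, rfl⟩ _ ⟨m, l, rfl⟩ hne
  change (D.node (n, k) ∩ D.node (m, l)).Nonempty at hne
  change ∃ n' k', D.node (n, k) ∩ D.node (m, l) = D.I n' k'
  rcases D.below_or_below_or_disjoint (n, k) (m, l) with h | h | h
  · exact ⟨n, k, Set.inter_eq_left.2 (D.node_subset_of_mem_below h)⟩
  · exact ⟨m, l, Set.inter_eq_right.2 (D.node_subset_of_mem_below h)⟩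
  · exact absurd h (Set.not_disjoint_iff_nonempty_inter.2 hne)

/-- Within a fixed node, the sets over which `g` has vanishing integral form a λ-system containing
the traces of all nodes. The nodes form a π-system that generates the σ-algebra. -/
theorem ae_eq_zero_of_setIntegral_node {g : Ω → ℂ} (hg : ∀ J, IntegrableOn g (D.node J) μ)
    (h : ∀ J, ∫ x in D.node J, g x ∂μ = 0) : g =ᵐ[μ] 0 := by
  refine D.ae_of_forall_node 0 fun I hI => ?_
  rw [← ae_restrict_iff' (D.measurableSet_node I)]
  refine (hg I).ae_eq_zero_of_forall_setIntegral_eq_zero fun s hs _ => ?_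
  induction s, hs using MeasurableSpace.induction_on_inter D.generate D.isPiSystem_node with
  | empty => simp
  | basic t ht =>
    obtain ⟨n, k, rfl⟩ := ht
    change ∫ x in D.node (n, k), g x ∂(μ.restrict (D.node I)) = 0
    rw [Measure.restrict_restrict (D.measurableSet_node _)]
    rcases D.below_or_below_or_disjoint (n, k) I with h1 | h1 | h1
    · rw [Set.inter_eq_left.2 (D.node_subset_of_mem_below h1), h]
    · rw [Set.inter_eq_right.2 (D.node_subset_of_mem_below h1), h]
    · simp [Set.disjoint_iff_inter_eq_empty.1 h1]
  | compl t ht ih =>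
    have h1 := integral_add_compl ht (hg I)
    rw [h I, ih (measure_lt_top_of_subset (Set.subset_univ t) (by simp [D.measure_node_ne_top])),
      zero_add] at h1
    exact h1
  | iUnion f hf hfm ih =>
    rw [integral_iUnion hfm hf (hg I).integrableOn]
    simp_rw [fun i => ih i (measure_lt_top_of_subset (Set.subset_univ (f i))
      (by simp [D.measure_node_ne_top]))]
    exact tsum_zero

theorem avg_eq_avg_anc {g : Ω → ℂ} (hg : ∀ J, IntegrableOn g (D.node J) μ)
    (h : ∀ J : ℤ × ℤ, ∀ i : Finset.Icc 1 (d - 1), D.haarCoeff g J.1 J.2 i = 0) (J : ℤ × ℤ) (N : ℕ) :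
    D.avg g J = D.avg g (anc d N J) := by
  induction N with
  | zero => rw [anc_zero]
  | succ N ih =>
    rw [ih, ← anc_anc]
    obtain ⟨j, hj⟩ := (anc_one_eq_iff d (anc d 1 (anc d N J)) (anc d N J)).1 rfl
    conv_lhs => rw [← hj]
    exact D.avg_kid_eq_of_haarCoeff_eq_zero (hg _) (h _) j

/-- A function with vanishing Haar coefficients, whose means decay, vanishes. -/
theorem ae_eq_zero_of_haarCoeff {g : Ω → ℂ} (hg : ∀ J, IntegrableOn g (D.node J) μ)
    (h : ∀ J : ℤ × ℤ, ∀ i : Finset.Icc 1 (d - 1), D.haarCoeff g J.1 J.2 i = 0)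
    (hlim : ∀ J, Tendsto (fun N => D.avg g (anc d N J)) atTop (𝓝 0)) : g =ᵐ[μ] 0 := by
  refine D.ae_eq_zero_of_setIntegral_node hg fun J => ?_
  have h1 := hlim J
  simp_rw [← D.avg_eq_avg_anc hg h J] at h1
  rw [setIntegral_node, tendsto_nhds_unique tendsto_const_nhds h1, mul_zero]

/-! ### The Haar basis -/

theorem norm_integral_mul_sq_le {ν : Measure Ω} {f g : Ω → ℂ} (hf : MemLp f 2 ν) (hg : MemLp g 2 ν) :
    ‖∫ x, f x * g x ∂ν‖ ^ 2 ≤ (∫ x, ‖f x‖ ^ 2 ∂ν) * ∫ x, ‖g x‖ ^ 2 ∂ν := by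
  have h := integral_mul_norm_le_Lp_mul_Lq (μ := ν) (f := f) (g := g) Real.HolderConjugate.two_two
    (by simpa using hf) (by simpa using hg)
  have hsq : ∀ x : ℝ, x ^ (2 : ℝ) = x ^ 2 := fun x => by norm_cast
  simp_rw [hsq] at h
  have h1 : ‖∫ x, f x * g x ∂ν‖ ≤ ∫ x, ‖f x‖ * ‖g x‖ ∂ν := by
    refine (norm_integral_le_integral_norm _).trans (le_of_eq ?_)
    simp_rw [norm_mul]
  have h2 : ∀ x : ℝ, 0 ≤ x → (x ^ (1 / 2 : ℝ)) ^ 2 = x := fun x hx => by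
    rw [← Real.rpow_natCast, ← Real.rpow_mul hx]
    simp
  have ha : 0 ≤ ∫ x, ‖f x‖ ^ 2 ∂ν := integral_nonneg fun x => by positivity
  have hb : 0 ≤ ∫ x, ‖g x‖ ^ 2 ∂ν := integral_nonneg fun x => by positivity
  calc _ ≤ ((∫ x, ‖f x‖ ^ 2 ∂ν) ^ (1 / 2 : ℝ) * (∫ x, ‖g x‖ ^ 2 ∂ν) ^ (1 / 2 : ℝ)) ^ 2 := by
        gcongr
        exact h1.trans h
    _ = _ := by rw [mul_pow, h2 _ ha, h2 _ hb]

theorem norm_setIntegral_node_sq_le {f : Ω → ℂ} {J : ℤ × ℤ} (hf : MemLp f 2 (μ.restrict (D.node J))) :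
    ‖∫ x in D.node J, f x ∂μ‖ ^ 2 ≤ (∫ x in D.node J, ‖f x‖ ^ 2 ∂μ) * nodeSize d J := by
  have : IsFiniteMeasure (μ.restrict (D.node J)) :=
    ⟨by simpa using (D.measure_node_ne_top J).lt_top⟩
  have h := norm_integral_mul_sq_le hf (memLp_const (1 : ℂ))
  simpa [D.measureReal_node] using h

theorem integrableOn_node_of_memLp {f : Ω → ℂ} {J : ℤ × ℤ} (hf : MemLp f 2 (μ.restrict (D.node J))) :
    IntegrableOn f (D.node J) μ := by
  have : IsFiniteMeasure (μ.restrict (D.node J)) :=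
    ⟨by simpa using (D.measure_node_ne_top J).lt_top⟩
  exact hf.integrable one_le_two

theorem tendsto_nodeSize_anc (hd : 2 ≤ d) (J : ℤ × ℤ) :
    Tendsto (fun N => (nodeSize d (anc d N J))⁻¹) atTop (𝓝 0) := by
  simp_rw [nodeSize_anc]
  refine tendsto_inv_atTop_zero.comp (Tendsto.atTop_mul_const (nodeSize_pos J) ?_)
  exact tendsto_pow_atTop_atTop_of_one_lt (by exact_mod_cast hd)

/-- Cauchy-Schwarz bounds the squared mean by `‖f‖² / |K|`, and the ancestors grow without bound.
This rules out non-zero functions in `L²` orthogonal to all wavelets. -/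
theorem tendsto_avg_anc_of_memLp (hd : 2 ≤ d) {f : Ω → ℂ} (hf : MemLp f 2 μ) (J : ℤ × ℤ) :
    Tendsto (fun N => D.avg f (anc d N J)) atTop (𝓝 0) := by
  set E := ∫ x, ‖f x‖ ^ 2 ∂μ with hE
  have h1 : ∀ K, ‖D.avg f K‖ ^ 2 ≤ E * (nodeSize d K)⁻¹ := by
    intro K
    have hσ := nodeSize_pos (d := d) K
    have h2 := D.norm_setIntegral_node_sq_le (hf.restrict (D.node K))
    have h3 : ∫ x in D.node K, ‖f x‖ ^ 2 ∂μ ≤ E :=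
      setIntegral_le_integral (hf.integrable_norm_pow two_ne_zero) (Eventually.of_forall fun x => by positivity)
    rw [setIntegral_node, norm_mul, Complex.norm_real, Real.norm_of_nonneg hσ.le, mul_pow] at h2
    have h4 : nodeSize d K ^ 2 * ‖D.avg f K‖ ^ 2 ≤ E * nodeSize d K := h2.trans (by gcongr)
    rw [← div_eq_mul_inv, le_div_iff₀ hσ]
    nlinarith
  have h2 : Tendsto (fun N => ‖D.avg f (anc d N J)‖ ^ 2) atTop (𝓝 0) := by
    have h3 := (tendsto_nodeSize_anc hd J).const_mul E
    rw [mul_zero] at h3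
    exact squeeze_zero (fun N => by positivity) (fun N => h1 _) h3
  rw [tendsto_zero_iff_norm_tendsto_zero]
  have h3 := h2.sqrt
  simpa [Real.sqrt_sq] using h3

/-- The Haar wavelets as elements of `L²`. -/
def haarLp (x : (ℤ × ℤ) × Finset.Icc 1 (d - 1)) : Lp ℂ 2 μ :=
  (D.memLp_haar x.1 x.2 2).toLp (D.haar x.1.1 x.1.2 x.2)

theorem inner_haarLp (x : (ℤ × ℤ) × Finset.Icc 1 (d - 1)) (f : Lp ℂ 2 μ) :
    inner ℂ (D.haarLp x) f = D.haarCoeff f x.1.1 x.1.2 x.2 := by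
  rw [L2.inner_def, haarCoeff]
  refine integral_congr_ae ?_
  filter_upwards [(D.memLp_haar x.1 x.2 2).coeFn_toLp] with y hy
  rw [RCLike.inner_apply, haarLp, hy, mul_comm]

omit [NeZero d] in
theorem haarCoeff_congr_ae {f g : Ω → ℂ} (h : f =ᵐ[μ] g) (J : ℤ × ℤ) (i : ℕ) :
    D.haarCoeff f J.1 J.2 i = D.haarCoeff g J.1 J.2 i :=
  integral_congr_ae (h.mono fun x hx => by simp only [hx])

theorem inner_haarLp_toLp (x : (ℤ × ℤ) × Finset.Icc 1 (d - 1)) {f : Ω → ℂ} (hf : MemLp f 2 μ) :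
    inner ℂ (D.haarLp x) (hf.toLp f) = D.haarCoeff f x.1.1 x.1.2 x.2 := by
  rw [inner_haarLp]
  exact D.haarCoeff_congr_ae hf.coeFn_toLp _ _

theorem haarCoeff_eq_zero_of_const {g : Ω → ℂ} {J : ℤ × ℤ} {c : ℂ} (h : ∀ x ∈ D.node J, g x = c)
    (i : Finset.Icc 1 (d - 1)) : D.haarCoeff g J.1 J.2 i = 0 := by
  rw [D.haarCoeff_congr (g := fun _ => c) h, haarCoeff_const]

theorem haar_const_of_below {J K : ℤ × ℤ} (h : J ∈ below d K) (hne : J ≠ K) (i : ℕ) :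
    ∃ j, J ∈ below d (kid d K j) ∧ ∀ x ∈ D.node J, D.haar K.1 K.2 i x = haarVal d K i j := by
  obtain ⟨j, hj⟩ := exists_mem_below_kid h hne
  exact ⟨j, hj, fun x hx => D.haar_of_mem_kid (D.node_subset_of_mem_below hj hx)⟩

theorem inner_haarLp_haarLp_of_below {x y : (ℤ × ℤ) × Finset.Icc 1 (d - 1)} (h : x.1 ∈ below d y.1)
    (hne : x.1 ≠ y.1) : inner ℂ (D.haarLp x) (D.haarLp y) = 0 := by
  obtain ⟨j, -, hj⟩ := D.haar_const_of_below h hne y.2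
  exact (D.inner_haarLp_toLp x _).trans (D.haarCoeff_eq_zero_of_const hj _)

/-- Of two wavelets on distinct nested nodes, the larger is constant on the support of the smaller,
which has mean zero. On one node the claim is orthogonality of characters. -/
theorem orthonormal_haarLp : Orthonormal ℂ D.haarLp := by
  classical
  rw [orthonormal_iff_ite]
  rintro ⟨J, i⟩ ⟨K, l⟩
  by_cases hJK : J = K
  · subst hJK
    refine (D.inner_haarLp_toLp (J, i) (D.memLp_haar J l 2)).trans ?_
    have hσ : (nodeSize d J : ℂ) ≠ 0 := by exact_mod_cast (nodeSize_pos J).ne'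
    have hd : (d : ℂ) ≠ 0 := by exact_mod_cast NeZero.ne d
    rw [D.haarCoeff_eq_sum (D.integrableOn_node_of_memLp ((D.memLp_haar J l 2).restrict _))]
    simp_rw [setIntegral_node, nodeSize_kid, fun j => (D.avg_congr (J := kid d J j) (fun x hx =>
      D.haar_of_mem_kid (i := l) hx)).trans (D.avg_const _ _)]
    have h1 := sum_conj_haarVal_mul J i l
    calc _ = (∑ j, (starRingEnd ℂ) (haarVal d J i j) * haarVal d J l j) *
          ((nodeSize d J / d : ℝ) : ℂ) := by
          rw [Finset.sum_mul]
          exact Finset.sum_congr rfl fun j _ => by ring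
      _ = _ := by
          rw [h1]
          by_cases hil : i = l
          · subst hil
            rw [if_pos rfl, if_pos rfl]
            push_cast
            field_simp
          · rw [if_neg hil, if_neg (fun h => hil (congrArg Prod.snd h)), zero_mul]
  · rw [if_neg (fun h => hJK (congrArg Prod.fst h))]
    rcases D.below_or_below_or_disjoint J K with h | h | h
    · exact D.inner_haarLp_haarLp_of_below h hJK
    · rw [← inner_conj_symm, D.inner_haarLp_haarLp_of_below h (Ne.symm hJK), map_zero]
    · exact (D.inner_haarLp_toLp (J, i) _).trans (D.haarCoeff_eq_zero_of_const (c := 0)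
        (fun x hx => D.haar_of_notMem (Set.disjoint_left.1 h hx)) _)

/-- The Haar wavelets form an orthonormal basis of `L²`. -/
theorem exists_haarBasis (hd : 2 ≤ d) :
    ∃ h : HilbertBasis ((ℤ × ℤ) × Finset.Icc 1 (d - 1)) ℂ (Lp ℂ 2 μ), ∀ x, h x = D.haarLp x := by
  have hsp : (Submodule.span ℂ (Set.range D.haarLp))ᗮ = ⊥ := by
    rw [Submodule.eq_bot_iff]
    intro f hf
    rw [Lp.eq_zero_iff_ae_eq_zero]
    refine D.ae_eq_zero_of_haarCoeff
      (fun J => D.integrableOn_node_of_memLp ((Lp.memLp f).restrict _))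
      (fun J i => ?_) (D.tendsto_avg_anc_of_memLp hd (Lp.memLp f))
    have h1 : D.haarLp (J, i) ∈ Submodule.span ℂ (Set.range D.haarLp) :=
      Submodule.subset_span (Set.mem_range_self (J, i))
    exact (D.inner_haarLp (J, i) f).symm.trans (Submodule.inner_right_of_mem_orthogonal h1 hf)
  exact ⟨HilbertBasis.mkOfOrthogonalEqBot D.orthonormal_haarLp hsp,
    congrFun (HilbertBasis.coe_mkOfOrthogonalEqBot _ _)⟩

end DAdicSystem

/-! ### Energies of Haar coefficients and deviations from the mean -/

theorem norm_toLp_sq {Ω : Type*} [MeasurableSpace Ω] {μ : Measure Ω} {f : Ω → ℂ}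
    (hf : MemLp f 2 μ) : ‖hf.toLp f‖ ^ 2 = ∫ x, ‖f x‖ ^ 2 ∂μ := by
  have h1 : ((‖hf.toLp f‖ ^ 2 : ℝ) : ℂ) = ((∫ x, ‖f x‖ ^ 2 ∂μ : ℝ) : ℂ) := by
    push_cast
    rw [← integral_complex_ofReal]
    refine (inner_self_eq_norm_sq_to_K (𝕜 := ℂ) (hf.toLp f)).symm.trans ?_
    rw [L2.inner_def]
    refine integral_congr_ae ?_
    filter_upwards [hf.coeFn_toLp] with x hx
    rw [hx, inner_self_eq_norm_sq_to_K]
    simp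
  exact_mod_cast h1

theorem norm_Lp_sq {Ω : Type*} [MeasurableSpace Ω] {μ : Measure Ω} (f : Lp ℂ 2 μ) :
    ‖f‖ ^ 2 = ∫ x, ‖f x‖ ^ 2 ∂μ := by
  rw [← norm_toLp_sq (Lp.memLp f), Lp.toLp_coeFn]

theorem enorm_sq_eq_ofReal {E : Type*} [SeminormedAddCommGroup E] (x : E) :
    ‖x‖ₑ ^ 2 = ENNReal.ofReal (‖x‖ ^ 2) := by
  rw [← ofReal_norm, ENNReal.ofReal_pow (norm_nonneg x)]

namespace DAdicSystem

variable {d : ℕ} {Ω : Type*} [MeasurableSpace Ω] {μ : Measure Ω} (D : DAdicSystem d μ)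

/-- The energy of the Haar coefficients at a node. -/
def nodeEnergy (g : Ω → ℂ) (J : ℤ × ℤ) : ℝ :=
  ∑ i : Finset.Icc 1 (d - 1), ‖D.haarCoeff g J.1 J.2 i‖ ^ 2

/-- The energy of the Haar coefficients at all the nodes below a node. -/
def energy (g : Ω → ℂ) (I : ℤ × ℤ) : ℝ≥0∞ :=
  ∑' J, (below d I).indicator (fun J => ENNReal.ofReal (D.nodeEnergy g J)) J

/-- The deviation from its mean of the restriction of a function to a node. -/
def dev (g : Ω → ℂ) (I : ℤ × ℤ) : Ω → ℂ := (D.node I).indicator fun x => g x - D.avg g I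

theorem nodeEnergy_nonneg (g : Ω → ℂ) (J : ℤ × ℤ) : 0 ≤ D.nodeEnergy g J :=
  Finset.sum_nonneg fun _ _ => by positivity

theorem norm_haarCoeff_sq_le (g : Ω → ℂ) (J : ℤ × ℤ) (i : Finset.Icc 1 (d - 1)) :
    ‖D.haarCoeff g J.1 J.2 i‖ ^ 2 ≤ D.nodeEnergy g J :=
  Finset.single_le_sum (f := fun i : Finset.Icc 1 (d - 1) => ‖D.haarCoeff g J.1 J.2 i‖ ^ 2)
    (fun _ _ => by positivity) (Finset.mem_univ i)

theorem dev_of_mem {g : Ω → ℂ} {I : ℤ × ℤ} {x : Ω} (hx : x ∈ D.node I) :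
    D.dev g I x = g x - D.avg g I := Set.indicator_of_mem hx _

theorem dev_of_notMem {g : Ω → ℂ} {I : ℤ × ℤ} {x : Ω} (hx : x ∉ D.node I) :
    D.dev g I x = 0 := Set.indicator_of_notMem hx _

theorem _root_.mem_below_self (I : ℤ × ℤ) : I ∈ below d I := ⟨0, anc_zero d I⟩

theorem nodeEnergy_le_energy (g : Ω → ℂ) (I : ℤ × ℤ) :
    ENNReal.ofReal (D.nodeEnergy g I) ≤ D.energy g I := by
  refine le_trans ?_ (ENNReal.le_tsum I)
  rw [Set.indicator_of_mem (mem_below_self I)]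

variable [NeZero d]

theorem integrable_dev {g : Ω → ℂ} {I : ℤ × ℤ} (hg : IntegrableOn g (D.node I) μ) :
    Integrable (D.dev g I) μ :=
  (integrable_indicator_iff (D.measurableSet_node I)).2 (hg.sub (D.integrableOn_const_node _ I))

theorem integral_dev {g : Ω → ℂ} {I : ℤ × ℤ} (hg : IntegrableOn g (D.node I) μ) :
    ∫ x, D.dev g I x ∂μ = 0 := by
  rw [dev, integral_indicator (D.measurableSet_node I), integral_sub hg
    (D.integrableOn_const_node _ I), setIntegral_node, setIntegral_node, avg_const, sub_self]

theorem haarCoeff_dev_of_below {g : Ω → ℂ} {I : ℤ × ℤ} (hg : IntegrableOn g (D.node I) μ)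
    {J : ℤ × ℤ} (hJ : J ∈ below d I) (i : Finset.Icc 1 (d - 1)) :
    D.haarCoeff (D.dev g I) J.1 J.2 i = D.haarCoeff g J.1 J.2 i := by
  have hJI := D.node_subset_of_mem_below hJ
  rw [← D.haarCoeff_sub_const (hg.mono_set hJI) (D.avg g I)]
  exact D.haarCoeff_congr (fun x hx => D.dev_of_mem (hJI hx)) _

/-- A function supported on a node, with vanishing integral, has no Haar coefficients at nodes
that do not lie below it. -/
theorem haarCoeff_eq_zero_of_not_below {f : Ω → ℂ} {I : ℤ × ℤ} (hf : ∀ x ∉ D.node I, f x = 0)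
    (hf0 : ∫ x, f x ∂μ = 0) {J : ℤ × ℤ} (hJ : J ∉ below d I) (i : Finset.Icc 1 (d - 1)) :
    D.haarCoeff f J.1 J.2 i = 0 := by
  rcases D.below_or_below_or_disjoint J I with h | h | h
  · exact absurd h hJ
  · obtain ⟨j, -, hj⟩ := D.haar_const_of_below h (fun h' => hJ (h' ▸ mem_below_self I)) i
    have h1 : ∀ x, (starRingEnd ℂ) (D.haar J.1 J.2 i x) * f x =
        (starRingEnd ℂ) (haarVal d J i j) * f x := by
      intro x
      by_cases hx : x ∈ D.node I
      · rw [hj x hx]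
      · rw [hf x hx, mul_zero, mul_zero]
    rw [haarCoeff]
    simp_rw [h1]
    rw [integral_const_mul, hf0, mul_zero]
  · exact D.haarCoeff_eq_zero_of_const (fun x hx => hf x (Set.disjoint_left.1 h hx)) i

theorem haarCoeff_dev_of_not_below {g : Ω → ℂ} {I : ℤ × ℤ} (hg : IntegrableOn g (D.node I) μ)
    {J : ℤ × ℤ} (hJ : J ∉ below d I) (i : Finset.Icc 1 (d - 1)) :
    D.haarCoeff (D.dev g I) J.1 J.2 i = 0 :=
  D.haarCoeff_eq_zero_of_not_below (fun _ hx => D.dev_of_notMem hx) (D.integral_dev hg) hJ i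

omit [NeZero d] in
theorem tsum_indicator_haarCoeff (g : Ω → ℂ) (I : ℤ × ℤ) :
    ∑' x : (ℤ × ℤ) × Finset.Icc 1 (d - 1), ‖(Prod.fst ⁻¹' below d I).indicator
      (fun x : (ℤ × ℤ) × Finset.Icc 1 (d - 1) => D.haarCoeff g x.1.1 x.1.2 x.2) x‖ₑ ^ 2 =
        D.energy g I := by
  rw [ENNReal.tsum_prod', energy]
  refine tsum_congr fun J => ?_
  rw [tsum_fintype]
  by_cases hJ : J ∈ below d I
  · rw [Set.indicator_of_mem hJ, nodeEnergy, ENNReal.ofReal_sum_of_nonneg fun _ _ => by positivity]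
    refine Finset.sum_congr rfl fun i _ => ?_
    rw [Set.indicator_of_mem (show (J, i) ∈ Prod.fst ⁻¹' below d I from hJ), enorm_sq_eq_ofReal]
  · rw [Set.indicator_of_notMem hJ]
    refine Finset.sum_eq_zero fun i _ => ?_
    rw [Set.indicator_of_notMem (show (J, i) ∉ Prod.fst ⁻¹' below d I from hJ)]
    simp

theorem energy_eq_of_memLp (hd : 2 ≤ d) {g : Ω → ℂ} {I : ℤ × ℤ}
    (hg : IntegrableOn g (D.node I) μ) (h : MemLp (D.dev g I) 2 μ) :
    D.energy g I = ENNReal.ofReal (∫ x, ‖D.dev g I x‖ ^ 2 ∂μ) := by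
  obtain ⟨H, hH⟩ := D.exists_haarBasis hd
  rw [← norm_toLp_sq h, ← enorm_sq_eq_ofReal, ← H.tsum_enorm_sq, ← tsum_indicator_haarCoeff]
  refine tsum_congr fun x => ?_
  rw [hH, D.inner_haarLp_toLp]
  by_cases hx : x.1 ∈ below d I
  · rw [Set.indicator_of_mem (by exact hx), D.haarCoeff_dev_of_below hg hx]
  · rw [Set.indicator_of_notMem (by exact hx), D.haarCoeff_dev_of_not_below hg hx]

/-- The Riesz-Fischer theorem on a node: a function with square summable Haar coefficients is square
integrable. -/
theorem memLp_dev (hd : 2 ≤ d) {g : Ω → ℂ} {I : ℤ × ℤ}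
    (hg : IntegrableOn g (D.node I) μ) (h : D.energy g I < ⊤) : MemLp (D.dev g I) 2 μ := by
  obtain ⟨H, hH⟩ := D.exists_haarBasis hd
  obtain ⟨G, hG⟩ := H.exists_coord ((D.tsum_indicator_haarCoeff g I).trans_lt h)
  have hGi : ∀ J, IntegrableOn G (D.node J) μ := fun J =>
    D.integrableOn_node_of_memLp ((Lp.memLp G).restrict _)
  have hdi := D.integrable_dev hg
  -- `G` is the `L²` function with the coefficients of the deviation. The difference has no Haar
  -- coefficients, and its means over ancestors decay: those of `G` by square integrability, those
  -- of the deviation because it is integrable.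
  have h1 : (fun x => G x - D.dev g I x) =ᵐ[μ] 0 := by
    refine D.ae_eq_zero_of_haarCoeff (fun J => (hGi J).sub hdi.integrableOn) (fun J i => ?_)
      fun J => ?_
    · rw [D.haarCoeff_sub (hGi J) hdi.integrableOn, ← D.inner_haarLp (J, i), ← hH, hG]
      by_cases hJ : J ∈ below d I
      · rw [Set.indicator_of_mem (by exact hJ), D.haarCoeff_dev_of_below hg hJ, sub_self]
      · rw [Set.indicator_of_notMem (by exact hJ), D.haarCoeff_dev_of_not_below hg hJ, sub_self]
    · have h2 : Tendsto (fun N => D.avg (D.dev g I) (anc d N J)) atTop (𝓝 0) := by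
        have h3 := (tendsto_nodeSize_anc hd J).mul_const (∫ x, ‖D.dev g I x‖ ∂μ)
        rw [zero_mul] at h3
        refine squeeze_zero_norm (fun N => ?_) h3
        have hσ := nodeSize_pos (d := d) (anc d N J)
        have h4 : ‖∫ x in D.node (anc d N J), D.dev g I x ∂μ‖ ≤ ∫ x, ‖D.dev g I x‖ ∂μ :=
          (norm_integral_le_integral_norm _).trans (setIntegral_le_integral hdi.norm
            (Eventually.of_forall fun x => norm_nonneg _))
        rw [setIntegral_node, norm_mul, Complex.norm_real, Real.norm_of_nonneg hσ.le] at h4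
        rwa [inv_mul_eq_div, le_div_iff₀' hσ]
      have h3 := (D.tendsto_avg_anc_of_memLp hd (Lp.memLp G) J).sub h2
      rw [sub_zero] at h3
      refine h3.congr fun N => ?_
      have hσ : (nodeSize d (anc d N J) : ℂ) ≠ 0 := by exact_mod_cast (nodeSize_pos (anc d N J)).ne'
      refine mul_left_cancel₀ hσ ?_
      rw [mul_sub, ← D.setIntegral_node, ← D.setIntegral_node, ← D.setIntegral_node,
        integral_sub (hGi _) hdi.integrableOn]
  refine (memLp_congr_ae ?_).1 (Lp.memLp G)
  filter_upwards [h1] with x hx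
  exact sub_eq_zero.1 hx

theorem memLp_indicator_const (c : ℂ) (I : ℤ × ℤ) :
    MemLp ((D.node I).indicator fun _ => c) 2 μ :=
  MeasureTheory.memLp_indicator_const 2 (D.measurableSet_node I) c (Or.inr (D.measure_node_ne_top I))

theorem memLp_indicator_node (hd : 2 ≤ d) {g : Ω → ℂ} {I : ℤ × ℤ}
    (hg : IntegrableOn g (D.node I) μ) (h : D.energy g I < ⊤) :
    MemLp ((D.node I).indicator g) 2 μ := by
  have h1 := (D.memLp_dev hd hg h).add (D.memLp_indicator_const (D.avg g I) I)
  refine (memLp_congr_ae (Eventually.of_forall fun x => ?_)).1 h1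
  by_cases hx : x ∈ D.node I
  · simp [D.dev_of_mem hx, hx]
  · simp [D.dev_of_notMem hx, hx]

end DAdicSystem

namespace DAdicSystem

variable {d : ℕ} {Ω : Type*} [MeasurableSpace Ω] {μ : Measure Ω} (D : DAdicSystem d μ)

/-! ### Conditional expectations and `BMO` -/

theorem condExpect_of_mem {J : ℤ × ℤ} {x : Ω} (hx : x ∈ D.node J) (g : Ω → ℂ) :
    D.condExpect J.1 g x = D.avg g J := by
  rw [condExpect, tsum_eq_single J.2]
  · exact Set.indicator_of_mem hx _
  · intro k hk
    refine Set.indicator_of_notMem (fun h => hk ?_) _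
    exact congrArg Prod.snd (D.eq_of_mem_node (J := (J.1, k)) (K := J) rfl h hx)

theorem condExpect_of_mem' {J : ℤ × ℤ} {n : ℤ} (hn : J.1 = n) {x : Ω} (hx : x ∈ D.node J)
    (g : Ω → ℂ) : D.condExpect n g x = D.avg g J := by
  rw [← hn, D.condExpect_of_mem hx]

theorem lcondExpect_of_mem {J : ℤ × ℤ} {x : Ω} (hx : x ∈ D.node J) (g : Ω → ℝ≥0∞) :
    D.lcondExpect J.1 g x = ⨍⁻ y in D.node J, g y ∂μ := by
  rw [lcondExpect, tsum_eq_single J.2]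
  · exact Set.indicator_of_mem hx _
  · intro k hk
    refine Set.indicator_of_notMem (fun h => hk ?_) _
    exact congrArg Prod.snd (D.eq_of_mem_node (J := (J.1, k)) (K := J) rfl h hx)

theorem measurable_condExpect (n : ℤ) (g : Ω → ℂ) : Measurable (D.condExpect n g) := by
  intro s _
  have h : D.condExpect n g ⁻¹' s = ⋃ k ∈ {k : ℤ | D.avg g (n, k) ∈ s}, D.node (n, k) := by
    ext x
    obtain ⟨k, hk⟩ := D.exists_mem_node n x
    have hx := D.condExpect_of_mem hk g
    simp only [Set.mem_preimage, Set.mem_iUnion, exists_prop, Set.mem_ofPred_eq]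
    constructor
    · exact fun h => ⟨k, by rwa [← hx], hk⟩
    · rintro ⟨l, hl, hxl⟩
      rwa [D.condExpect_of_mem hxl g]
  rw [h]
  exact MeasurableSet.biUnion (Set.to_countable _) fun k _ => D.measurableSet_node _

theorem measurable_martDiff (n : ℤ) (g : Ω → ℂ) : Measurable (D.martDiff n g) :=
  (D.measurable_condExpect n g).sub (D.measurable_condExpect (n - 1) g)

variable [NeZero d]

omit [NeZero d] in
theorem lintegral_node_eq_sum (f : Ω → ℝ≥0∞) (J : ℤ × ℤ) :
    ∫⁻ x in D.node J, f x ∂μ = ∑ j, ∫⁻ x in D.node (kid d J j), f x ∂μ := by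
  rw [D.node_eq_iUnion J, lintegral_iUnion (fun j => D.measurableSet_node _) (D.disjoint_kid J),
    tsum_fintype]

omit [NeZero d] in
theorem martDiff_of_mem_kid {J : ℤ × ℤ} {j : Fin d} {x : Ω} (hx : x ∈ D.node (kid d J j))
    (g : Ω → ℂ) : D.martDiff (J.1 + 1) g x = D.avg g (kid d J j) - D.avg g J := by
  rw [martDiff, D.condExpect_of_mem' (n := J.1 + 1) (J := kid d J j) rfl hx,
    D.condExpect_of_mem' (n := J.1 + 1 - 1) (J := J) (by ring) (D.node_kid_subset J j hx)]

theorem lintegral_martDiff {g : Ω → ℂ} {J : ℤ × ℤ} (hg : IntegrableOn g (D.node J) μ) :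
    ∫⁻ x in D.node J, ‖D.martDiff (J.1 + 1) g x‖ₑ ^ 2 ∂μ = ENNReal.ofReal (D.nodeEnergy g J) := by
  have hσ := nodeSize_pos (d := d) J
  rw [lintegral_node_eq_sum, nodeEnergy, D.sum_norm_haarCoeff_sq hg, Finset.mul_sum,
    ENNReal.ofReal_sum_of_nonneg fun _ _ => by positivity]
  refine Finset.sum_congr rfl fun j _ => ?_
  rw [setLIntegral_congr_fun (D.measurableSet_node _) (fun x hx => by
    rw [D.martDiff_of_mem_kid hx]), setLIntegral_const, measure_node_eq_ofReal, nodeSize_kid,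
    enorm_sq_eq_ofReal, mul_comm, ENNReal.ofReal_mul (by positivity)]

theorem lintegral_martDiff_add {g : Ω → ℂ} {I : ℤ × ℤ} (hg : IntegrableOn g (D.node I) μ) (k : ℕ) :
    ∫⁻ x in D.node I, ‖D.martDiff (I.1 + 1 + k) g x‖ₑ ^ 2 ∂μ =
      ∑ l, ENNReal.ofReal (D.nodeEnergy g (child d k I l)) := by
  induction k generalizing I with
  | zero =>
    rw [sum_child_zero d (fun J => ENNReal.ofReal (D.nodeEnergy g J)), ← D.lintegral_martDiff hg]
    simp
  | succ k ih =>
    rw [sum_child_succ d k (fun J => ENNReal.ofReal (D.nodeEnergy g J)), lintegral_node_eq_sum]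
    refine Finset.sum_congr rfl fun j _ => ?_
    rw [← ih (hg.mono_set (D.node_kid_subset I j))]
    have h : I.1 + 1 + ((k + 1 : ℕ) : ℤ) = (kid d I j).1 + 1 + k := by
      simp only [kid]
      push_cast
      ring
    rw [h]

theorem lintegral_tsum_martDiff {g : Ω → ℂ} {I : ℤ × ℤ} (hg : IntegrableOn g (D.node I) μ) :
    ∫⁻ x in D.node I, ∑' k : ℕ, ‖D.martDiff (I.1 + 1 + k) g x‖ₑ ^ 2 ∂μ = D.energy g I := by
  rw [lintegral_tsum fun k => ((D.measurable_martDiff _ g).enorm.pow_const 2).aemeasurable, energy,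
    tsum_below]
  exact tsum_congr fun k => D.lintegral_martDiff_add hg k

/-- The conditional expectation in the `BMO` norm is constant on `I`, with value energy over
measure. As `I` has positive measure, the essential supremum bounds this value. -/
theorem energy_le_bmoNorm_sq_mul {a : Ω → ℂ} (ha : D.LocallyIntegrable a) (I : ℤ × ℤ) :
    D.energy a I ≤ D.bmoNorm a ^ 2 * μ (D.node I) := by
  set F : Ω → ℝ≥0∞ := fun x => ∑' k : ℕ, ‖D.martDiff (I.1 + 1 + k) a x‖ₑ ^ 2 with hF
  have h1 : essSup (D.lcondExpect I.1 F) μ ≤ D.bmoNorm a ^ 2 := by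
    have h2 : essSup (D.lcondExpect I.1 F) μ ^ (1 / 2 : ℝ) ≤ D.bmoNorm a :=
      le_iSup (fun n : ℤ => essSup (D.lcondExpect n fun x =>
        ∑' k : ℕ, ‖D.martDiff (n + 1 + k) a x‖ₑ ^ 2) μ ^ (1 / 2 : ℝ)) I.1
    calc _ = (essSup (D.lcondExpect I.1 F) μ ^ (1 / 2 : ℝ)) ^ 2 := by
          rw [← ENNReal.rpow_natCast, ← ENNReal.rpow_mul]
          simp
      _ ≤ _ := by gcongr
  have h2 : ∃ x ∈ D.node I, D.lcondExpect I.1 F x ≤ essSup (D.lcondExpect I.1 F) μ := by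
    by_contra! h
    refine D.measure_node_ne_zero I (measure_mono_null (fun x hx => ?_)
      (ae_iff.1 (ENNReal.ae_le_essSup (D.lcondExpect I.1 F))))
    exact not_le.2 (h x hx)
  obtain ⟨x, hx, hxF⟩ := h2
  rw [D.lcondExpect_of_mem hx, setLAverage_eq, D.lintegral_tsum_martDiff (ha I.1 I.2)] at hxF
  rw [← ENNReal.div_le_iff (D.measure_node_ne_zero I) (D.measure_node_ne_top I)]
  exact hxF.trans h1

/-! ### The Carleson embedding -/

theorem norm_avg_eq (f : Ω → ℂ) (J : ℤ × ℤ) :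
    ‖D.avg f J‖ = ‖∫ x in D.node J, f x ∂μ‖ / nodeSize d J := by
  have hσ := nodeSize_pos (d := d) J
  rw [setIntegral_node, norm_mul, Complex.norm_real, Real.norm_of_nonneg hσ.le,
    mul_div_cancel_left₀ _ hσ.ne']

/-- The tree version is applied with `F = |∫ f|` and `E = ∫ |f|²` over nodes, below each node of a
generation; the `E` of one generation add up to `‖f‖²`. -/
theorem tsum_carleson_le {g : Ω → ℂ} {β : ℝ} (hβ : 0 < β)
    (hA : ∀ J, D.energy g J ≤ ENNReal.ofReal (β * nodeSize d J)) {f : Ω → ℂ} (hf : MemLp f 2 μ) :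
    ∑' J, ENNReal.ofReal (D.nodeEnergy g J * ‖D.avg f J‖ ^ 2) ≤
      ENNReal.ofReal (4 * β * ∫ x, ‖f x‖ ^ 2 ∂μ) := by
  have hfi := hf.integrable_norm_pow two_ne_zero
  have hf1 : ∀ J, IntegrableOn f (D.node J) μ := fun J =>
    D.integrableOn_node_of_memLp (hf.restrict _)
  set E : ℤ × ℤ → ℝ := fun J => ∫ x in D.node J, ‖f x‖ ^ 2 ∂μ with hE
  have hE0 : ∀ J, 0 ≤ E J := fun J => integral_nonneg fun x => by positivity
  simp_rw [D.norm_avg_eq f]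
  refine tsum_le_of_below d fun n => ?_
  have hloc : ∀ I, ∑' J, (below d I).indicator (fun J => ENNReal.ofReal (D.nodeEnergy g J *
      (‖∫ x in D.node J, f x ∂μ‖ / nodeSize d J) ^ 2)) J ≤ ENNReal.ofReal (4 * β * E I) := by
    refine tsum_below_carleson_le d (D.nodeEnergy_nonneg g) hβ nodeSize_pos sum_nodeSize_kid hA
      (F := fun J => ‖∫ x in D.node J, f x ∂μ‖) (fun J => norm_nonneg _) (fun J => ?_)
      (fun J => ?_) fun J => D.norm_setIntegral_node_sq_le (hf.restrict _)
    · rw [D.setIntegral_node_eq_sum (hf1 J)]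
      exact norm_sum_le _ _
    · exact (D.setIntegral_node_eq_sum hfi.integrableOn).symm.le
  calc _ ≤ ∑' k, ENNReal.ofReal (4 * β * E (n, k)) := ENNReal.tsum_le_tsum fun k => hloc (n, k)
    _ = ENNReal.ofReal (4 * β) * ∑' k, ENNReal.ofReal (E (n, k)) := by
        rw [← ENNReal.tsum_mul_left]
        exact tsum_congr fun k => ENNReal.ofReal_mul (by positivity)
    _ = ENNReal.ofReal (4 * β) * ENNReal.ofReal (∫ x, ‖f x‖ ^ 2 ∂μ) := by
        congr 1
        rw [ofReal_integral_eq_lintegral_ofReal hfi (Eventually.of_forall fun x => by positivity),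
          ← setLIntegral_univ, ← D.cover n,
          lintegral_iUnion (s := D.I n) (fun k => D.measurableSet_node (n, k))
            (D.disjoint n)]
        exact tsum_congr fun k => ofReal_integral_eq_lintegral_ofReal hfi.integrableOn
          (Eventually.of_forall fun x => by positivity)
    _ = _ := (ENNReal.ofReal_mul (by positivity)).symm

/-! ### The paraproduct -/

omit [NeZero d] in
theorem avg_congr_ae {f g : Ω → ℂ} (h : f =ᵐ[μ] g) (J : ℤ × ℤ) : D.avg f J = D.avg g J := by
  rw [avg, avg, setAverage_eq, setAverage_eq, integral_congr_ae (ae_restrict_of_ae h)]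

theorem integrableOn_Lp (f : Lp ℂ 2 μ) (J : ℤ × ℤ) : IntegrableOn f (D.node J) μ :=
  D.integrableOn_node_of_memLp ((Lp.memLp f).restrict _)

/-- The mean over a node as a linear functional on `L²`. -/
def avgLp (J : ℤ × ℤ) : Lp ℂ 2 μ →ₗ[ℂ] ℂ where
  toFun f := D.avg f J
  map_add' f g := by
    rw [D.avg_congr_ae (Lp.coeFn_add f g), avg, avg, avg, setAverage_eq, setAverage_eq,
      setAverage_eq, ← smul_add, ← integral_add (D.integrableOn_Lp f J) (D.integrableOn_Lp g J)]
    rfl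
  map_smul' c f := by
    rw [D.avg_congr_ae (Lp.coeFn_smul c f), avg, avg, setAverage_eq, setAverage_eq,
      RingHom.id_apply, smul_comm c, ← integral_smul c]
    rfl

/-- The matrix description of the paraproduct in the Haar basis. -/
def HasParaproductMatrix (a : Ω → ℂ) (P : Lp ℂ 2 μ →L[ℂ] Lp ℂ 2 μ) : Prop :=
  ∀ (f : Lp ℂ 2 μ) (x : (ℤ × ℤ) × Finset.Icc 1 (d - 1)),
    inner ℂ (D.haarLp x) (P f) = D.haarCoeff a x.1.1 x.1.2 x.2 * D.avg f x.1

theorem exists_hasParaproductMatrix (hd : 2 ≤ d) {a : Ω → ℂ} {β : ℝ} (hβ : 0 < β)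
    (hA : ∀ J, D.energy a J ≤ ENNReal.ofReal (β * nodeSize d J)) :
    ∃ P, D.HasParaproductMatrix a P := by
  obtain ⟨h, hh⟩ := D.exists_haarBasis hd
  obtain ⟨P, hP, -⟩ := h.exists_operator
    (fun x => D.haarCoeff a x.1.1 x.1.2 x.2 • D.avgLp x.1) (Real.toNNReal (√(4 * β))) fun f => by
    calc _ = ∑' J, ENNReal.ofReal (D.nodeEnergy a J * ‖D.avg f J‖ ^ 2) := by
          rw [ENNReal.tsum_prod']
          refine tsum_congr fun J => ?_
          rw [tsum_fintype, nodeEnergy, Finset.sum_mul,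
            ENNReal.ofReal_sum_of_nonneg fun _ _ => by positivity]
          refine Finset.sum_congr rfl fun i _ => ?_
          rw [enorm_sq_eq_ofReal, ← mul_pow, ← norm_mul]
          rfl
      _ ≤ ENNReal.ofReal (4 * β * ∫ x, ‖f x‖ ^ 2 ∂μ) := D.tsum_carleson_le hβ hA (Lp.memLp f)
      _ = _ := by
          rw [← norm_Lp_sq, mul_pow, enorm_sq_eq_ofReal, ENNReal.ofReal_mul (by positivity)]
          congr 1
          change _ = ENNReal.ofReal (√(4 * β)) ^ 2
          rw [← ENNReal.ofReal_pow (by positivity), Real.sq_sqrt (by positivity)]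
  exact ⟨P, fun f x => by rw [← hh, hP]; rfl⟩

end DAdicSystem

/-- The blocks of the expansion of a vector in a Hilbert basis. -/
theorem HilbertBasis.exists_hasSum_blocks {ι κ H : Type*} [NormedAddCommGroup H]
    [InnerProductSpace ℂ H] [CompleteSpace H] (h : HilbertBasis ι ℂ H) (π : ι → κ) (y : H) :
    ∃ G : κ → H, HasSum G y ∧
      ∀ k i, inner ℂ (h i) (G k) = (π ⁻¹' {k}).indicator (fun i => inner ℂ (h i) y) i := by
  classical
  set F : (Σ k, {i // π i = k}) → H := fun s => inner ℂ (h s.2.1) y • h s.2.1 with hF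
  have h1 : HasSum F y := by
    refine ((Equiv.sigmaFiberEquiv π).hasSum_iff (f := fun i => inner ℂ (h i) y • h i)).2 ?_
    simpa only [h.repr_apply_apply] using h.hasSum_repr y
  have h2 : ∀ k, Summable fun i : {i // π i = k} => F ⟨k, i⟩ := fun k => h1.summable.sigma_factor k
  refine ⟨fun k => ∑' i : {i // π i = k}, F ⟨k, i⟩, h1.sigma fun k => (h2 k).hasSum, fun k i => ?_⟩
  have h3 := ((h2 k).hasSum.mapL (innerSL ℂ (h i))).tsum_eq
  simp only [innerSL_apply_apply] at h3
  rw [← h3]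
  simp only [hF, inner_smul_right, orthonormal_iff_ite.1 h.orthonormal]
  by_cases hi : π i = k
  · rw [Set.indicator_of_mem (by simpa using hi), tsum_eq_single (⟨i, hi⟩ : {i // π i = k})]
    · simp
    · intro i' hi'
      rw [if_neg (fun h => hi' (Subtype.ext h.symm)), mul_zero]
  · rw [Set.indicator_of_notMem (by simpa using hi)]
    refine (tsum_congr fun i' : {i // π i = k} => ?_).trans tsum_zero
    rw [if_neg (fun hii : i = i' => hi (hii ▸ i'.2)), mul_zero]

/-! ### The paraproduct as an unconditionally convergent series -/

namespace DAdicSystem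

variable {d : ℕ} {Ω : Type*} [MeasurableSpace Ω] {μ : Measure Ω} (D : DAdicSystem d μ)

/-- Induction over the nodes, upwards from a given level. -/
theorem _root_.node_induction {d : ℕ} (n : ℤ) {p : ℤ × ℤ → Prop} (h0 : ∀ J : ℤ × ℤ, n ≤ J.1 → p J)
    (hs : ∀ J : ℤ × ℤ, J.1 < n → (∀ j, p (kid d J j)) → p J) (J : ℤ × ℤ) : p J := by
  obtain ⟨m, hm⟩ : ∃ m : ℕ, n - J.1 ≤ m := ⟨(n - J.1).toNat, Int.self_le_toNat _⟩
  induction m generalizing J with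
  | zero => exact h0 J (by simpa using hm)
  | succ m ih =>
    rcases le_or_gt n J.1 with h | h
    · exact h0 J h
    · refine hs J h fun j => ih _ ?_
      simp only [kid]
      push_cast at hm
      linarith

theorem integrableOn_of_kid {g : Ω → ℂ} {J : ℤ × ℤ}
    (h : ∀ j, IntegrableOn g (D.node (kid d J j)) μ) : IntegrableOn g (D.node J) μ := by
  rw [D.node_eq_iUnion J]
  exact integrableOn_finite_iUnion.2 h

variable {D} in
theorem LocallyIntegrable.integrableOn_node {g : Ω → ℂ} (hg : D.LocallyIntegrable g) (J : ℤ × ℤ) :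
    IntegrableOn g (D.node J) μ := hg J.1 J.2

variable [NeZero d]

/-- The `k`-th term `dₖa · fₖ₋₁` of the paraproduct. -/
def paraTerm (a f : Ω → ℂ) (k : ℤ) (x : Ω) : ℂ := D.martDiff k a x * D.condExpect (k - 1) f x

theorem condExpect_of_mem_below {J : ℤ × ℤ} {n : ℤ} (hn : n ≤ J.1) (g : Ω → ℂ) :
    ∃ c, ∀ x ∈ D.node J, D.condExpect n g x = c :=
  ⟨_, fun x hx => D.condExpect_of_mem' (J := anc d (J.1 - n).toNat J)
    (by rw [anc_fst]; omega) (D.node_subset_anc _ J hx) g⟩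

theorem paraTerm_const (a f : Ω → ℂ) {k : ℤ} {J : ℤ × ℤ} (hk : k ≤ J.1) :
    ∃ c, ∀ x ∈ D.node J, D.paraTerm a f k x = c := by
  obtain ⟨c1, h1⟩ := D.condExpect_of_mem_below hk a
  obtain ⟨c2, h2⟩ := D.condExpect_of_mem_below (n := k - 1) (J := J) (by omega) a
  obtain ⟨c3, h3⟩ := D.condExpect_of_mem_below (n := k - 1) (J := J) (by omega) f
  exact ⟨(c1 - c2) * c3, fun x hx => by rw [paraTerm, martDiff, h1 x hx, h2 x hx, h3 x hx]⟩

theorem integrableOn_paraTerm (a f : Ω → ℂ) (k : ℤ) (J : ℤ × ℤ) :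
    IntegrableOn (D.paraTerm a f k) (D.node J) μ := by
  induction J using node_induction (d := d) k with
  | h0 J hJ =>
    obtain ⟨c, hc⟩ := D.paraTerm_const a f hJ
    exact (D.integrableOn_const_node c J).congr_fun (fun x hx => (hc x hx).symm)
      (D.measurableSet_node J)
  | hs J _ ih => exact D.integrableOn_of_kid ih

omit [NeZero d] in
theorem paraTerm_of_mem_kid {a f : Ω → ℂ} {J : ℤ × ℤ} {j : Fin d} {x : Ω}
    (hx : x ∈ D.node (kid d J j)) :
    D.paraTerm a f (J.1 + 1) x = (D.avg a (kid d J j) - D.avg a J) * D.avg f J := by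
  rw [paraTerm, D.martDiff_of_mem_kid hx,
    D.condExpect_of_mem' (n := J.1 + 1 - 1) (J := J) (by ring) (D.node_kid_subset J j hx)]

theorem setIntegral_paraTerm_kid {a : Ω → ℂ} (ha : D.LocallyIntegrable a) (f : Ω → ℂ) (J : ℤ × ℤ)
    (j : Fin d) :
    ∫ x in D.node (kid d J j), D.paraTerm a f (J.1 + 1) x ∂μ =
      D.avg f J * ∫ x in D.node (kid d J j), (a x - D.avg a J) ∂μ := by
  rw [setIntegral_node, D.avg_congr (fun x hx => D.paraTerm_of_mem_kid hx), avg_const,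
    integral_sub (ha.integrableOn_node _) (D.integrableOn_const_node _ _), setIntegral_node, setIntegral_node,
    avg_const]
  ring

theorem setIntegral_paraTerm_eq_zero {a : Ω → ℂ} (ha : D.LocallyIntegrable a) (f : Ω → ℂ) (k : ℤ)
    (J : ℤ × ℤ) (hJ : J.1 < k) : ∫ x in D.node J, D.paraTerm a f k x ∂μ = 0 := by
  induction J using node_induction (d := d) (k - 1) with
  | h0 J h =>
    obtain rfl : k = J.1 + 1 := by omega
    rw [D.setIntegral_node_eq_sum (D.integrableOn_paraTerm a f _ J)]
    simp_rw [D.setIntegral_paraTerm_kid ha f J]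
    have h1 : IntegrableOn (fun x => a x - D.avg a J) (D.node J) μ :=
      (ha.integrableOn_node J).sub (D.integrableOn_const_node _ J)
    rw [← Finset.mul_sum, ← D.setIntegral_node_eq_sum h1,
      integral_sub (ha.integrableOn_node _) (D.integrableOn_const_node _ _), setIntegral_node, setIntegral_node,
      avg_const, sub_self, mul_zero]
  | hs J h ih =>
    rw [D.setIntegral_node_eq_sum (D.integrableOn_paraTerm a f _ J)]
    refine Finset.sum_eq_zero fun j _ => ih j ?_
    simp only [kid]
    omega

/-- The `k`-th term is constant on nodes of generation at least `k` and has vanishing integral over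
coarser ones, so only generation `k - 1` carries Haar coefficients. -/
theorem haarCoeff_paraTerm {a : Ω → ℂ} (ha : D.LocallyIntegrable a) (f : Ω → ℂ) (k : ℤ)
    (x : (ℤ × ℤ) × Finset.Icc 1 (d - 1)) :
    D.haarCoeff (D.paraTerm a f k) x.1.1 x.1.2 x.2 =
      ((fun x : (ℤ × ℤ) × Finset.Icc 1 (d - 1) => x.1.1 + 1) ⁻¹' {k}).indicator
        (fun x => D.haarCoeff a x.1.1 x.1.2 x.2 * D.avg f x.1) x := by
  obtain ⟨J, i⟩ := x
  by_cases hJ : J.1 + 1 = k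
  · subst hJ
    rw [Set.indicator_of_mem (by exact rfl), D.haarCoeff_eq_sum (D.integrableOn_paraTerm a f _ J)]
    simp_rw [D.setIntegral_paraTerm_kid ha f J]
    rw [← D.haarCoeff_sub_const (ha.integrableOn_node J) (D.avg a J) i, D.haarCoeff_eq_sum
      (g := fun x => a x - D.avg a J) ((ha.integrableOn_node J).sub (D.integrableOn_const_node _ J)),
      Finset.sum_mul]
    exact Finset.sum_congr rfl fun j _ => by ring
  · rw [Set.indicator_of_notMem (by exact hJ)]
    rcases le_or_gt k J.1 with h | h
    · obtain ⟨c, hc⟩ := D.paraTerm_const a f h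
      exact D.haarCoeff_eq_zero_of_const hc i
    · rw [D.haarCoeff_eq_sum (D.integrableOn_paraTerm a f _ J)]
      refine Finset.sum_eq_zero fun j _ => ?_
      rw [D.setIntegral_paraTerm_eq_zero ha f k, mul_zero]
      simp only [kid]
      omega

/-- Grouping the Haar expansion of `P f` by generation preserves unconditional convergence, and
uniqueness of Haar coefficients identifies the `k`-th group with the `k`-th term of the series. -/
theorem isParaproduct_of_hasParaproductMatrix (hd : 2 ≤ d) {a : Ω → ℂ} (ha : D.LocallyIntegrable a)
    {P : Lp ℂ 2 μ →L[ℂ] Lp ℂ 2 μ} (hP : D.HasParaproductMatrix a P) : D.IsParaproduct a P := by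
  intro f
  obtain ⟨h, hh⟩ := D.exists_haarBasis hd
  obtain ⟨G, hG, hGc⟩ := h.exists_hasSum_blocks (fun x => x.1.1 + 1) (P f)
  have h1 : ∀ k, G k =ᵐ[μ] D.paraTerm a f k := by
    intro k
    have hi := fun J => D.integrableOn_paraTerm a f k J
    have h2 : (fun x => G k x - D.paraTerm a f k x) =ᵐ[μ] 0 := by
      refine D.ae_eq_zero_of_haarCoeff (fun J => (D.integrableOn_Lp (G k) J).sub (hi J))
        (fun J i => ?_) fun J => ?_
      · rw [D.haarCoeff_sub (D.integrableOn_Lp (G k) J) (hi J), D.haarCoeff_paraTerm ha f k (J, i),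
          ← D.inner_haarLp (J, i), ← hh, hGc, sub_eq_zero]
        refine congrFun (congrArg _ (funext fun x => ?_)) (J, i)
        rw [hh, hP]
      -- Square integrability of the term is not known beforehand. Its integrals over coarse nodes
      -- vanish, so far up the means are those of `G k`.
      · refine (D.tendsto_avg_anc_of_memLp hd (Lp.memLp (G k)) J).congr' ?_
        filter_upwards [eventually_gt_atTop (J.1 - k).toNat] with N hN
        have hσ : (nodeSize d (anc d N J) : ℂ) ≠ 0 := by
          exact_mod_cast (nodeSize_pos (anc d N J)).ne'
        refine mul_left_cancel₀ hσ ?_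
        rw [← D.setIntegral_node, ← D.setIntegral_node, integral_sub (D.integrableOn_Lp _ _) (hi _),
          D.setIntegral_paraTerm_eq_zero ha f k _ (by rw [anc_fst]; omega), sub_zero]
    filter_upwards [h2] with x hx
    exact sub_eq_zero.1 hx
  have h2 : ∀ s : Finset ℤ, eLpNorm (fun x => P f x - ∑ k ∈ s, D.martDiff k a x *
      D.condExpect (k - 1) f x) 2 μ = ‖P f - ∑ k ∈ s, G k‖ₑ := by
    intro s
    rw [Lp.enorm_def]
    refine eLpNorm_congr_ae ?_
    filter_upwards [Lp.coeFn_sub (P f) (∑ k ∈ s, G k), Lp.coeFn_finsetSum s G,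
      (Finset.eventually_all s).2 fun k _ => h1 k] with x h3 h4 h5
    rw [h3, Pi.sub_apply, h4, Finset.sum_apply]
    congr 1
    exact Finset.sum_congr rfl fun k hk => (h5 k hk).symm
  simp_rw [h2]
  have h3 : Tendsto (fun s : Finset ℤ => P f - ∑ k ∈ s, G k) atTop (𝓝 0) := by
    have := (tendsto_const_nhds (x := P f)).sub hG
    rwa [sub_self] at this
  simpa using h3.enorm

end DAdicSystem

namespace DAdicSystem

variable {d : ℕ} {Ω : Type*} [MeasurableSpace Ω] {μ : Measure Ω} (D : DAdicSystem d μ) [NeZero d]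

/-! ### Products of deviations -/

theorem memLp_haar_mul {g : Ω → ℂ} (hg : MemLp g 2 μ) (J : ℤ × ℤ) (i : ℕ) :
    MemLp (fun x => D.haar J.1 J.2 i x * g x) 2 μ := by
  refine hg.of_le_mul (c := √(nodeSize d J)⁻¹)
    ((D.measurable_haar J i).aestronglyMeasurable.mul hg.1) (Eventually.of_forall fun x => ?_)
  rw [norm_mul]
  gcongr
  exact Real.le_sqrt_of_sq_le (D.norm_haar_sq_le J i x)

theorem norm_integral_haar_mul_sq_le {f g : Ω → ℂ} (hf : MemLp f 2 μ) (hg : MemLp g 2 μ)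
    (J : ℤ × ℤ) (i : ℕ) :
    ‖∫ x, D.haar J.1 J.2 i x * f x * g x ∂μ‖ ^ 2 ≤
      (nodeSize d J)⁻¹ * (∫ x, ‖f x‖ ^ 2 ∂μ) * ∫ x, ‖g x‖ ^ 2 ∂μ := by
  have hf' := D.memLp_haar_mul hf J i
  refine (norm_integral_mul_sq_le hf' hg).trans ?_
  have h1 : ∫ x, ‖D.haar J.1 J.2 i x * f x‖ ^ 2 ∂μ ≤ (nodeSize d J)⁻¹ * ∫ x, ‖f x‖ ^ 2 ∂μ := by
    rw [← integral_const_mul]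
    refine integral_mono (hf'.integrable_norm_pow two_ne_zero)
      ((hf.integrable_norm_pow two_ne_zero).const_mul _) fun x => ?_
    simp only [norm_mul, mul_pow]
    gcongr
    exact D.norm_haar_sq_le J i x
  have h2 : 0 ≤ ∫ x, ‖g x‖ ^ 2 ∂μ := integral_nonneg fun x => by positivity
  gcongr

theorem norm_haarCoeff_mul_sq_le {f g : Ω → ℂ} (hf : MemLp f 2 μ) (hg : MemLp g 2 μ)
    (J : ℤ × ℤ) (i : ℕ) :
    ‖D.haarCoeff (fun x => f x * g x) J.1 J.2 i‖ ^ 2 ≤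
      (nodeSize d J)⁻¹ * (∫ x, ‖f x‖ ^ 2 ∂μ) * ∫ x, ‖g x‖ ^ 2 ∂μ := by
  have h := D.norm_integral_haar_mul_sq_le hf.star hg.star J i
  simp only [Pi.star_apply, norm_star] at h
  refine le_trans (le_of_eq ?_) h
  rw [haarCoeff, ← RCLike.norm_conj, ← integral_conj]
  congr 3
  ext x
  simp [mul_assoc]

theorem avg_dev_of_below {g : Ω → ℂ} {I J : ℤ × ℤ} (hg : IntegrableOn g (D.node I) μ)
    (hJ : J ∈ below d I) : D.avg (D.dev g I) J = D.avg g J - D.avg g I := by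
  have hJI := D.node_subset_of_mem_below hJ
  have hσ : (nodeSize d J : ℂ) ≠ 0 := by exact_mod_cast (nodeSize_pos J).ne'
  refine mul_left_cancel₀ hσ ?_
  rw [D.avg_congr (g := fun x => g x - D.avg g I) fun x hx => D.dev_of_mem (hJI hx),
    ← D.setIntegral_node, integral_sub (hg.mono_set hJI) (D.integrableOn_const_node _ _),
    setIntegral_node, setIntegral_node, avg_const, mul_sub]

theorem integral_norm_dev_sq (hd : 2 ≤ d) {g : Ω → ℂ} {I : ℤ × ℤ}
    (hg : IntegrableOn g (D.node I) μ) (h : D.energy g I < ⊤) :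
    ∫ x, ‖D.dev g I x‖ ^ 2 ∂μ = (D.energy g I).toReal := by
  rw [D.energy_eq_of_memLp hd hg (D.memLp_dev hd hg h), ENNReal.toReal_ofReal]
  exact integral_nonneg fun x => by positivity

/-- On `J`, each deviation from the mean over `I` is the deviation from the mean over `J` plus a
constant. The product of the two constants has no Haar coefficient. -/
theorem haarCoeff_dev_mul_dev (hd : 2 ≤ d) {a b : Ω → ℂ} {I J : ℤ × ℤ}
    (ha : D.LocallyIntegrable a) (hb : D.LocallyIntegrable b)
    (hea : ∀ J, D.energy a J < ⊤) (heb : ∀ J, D.energy b J < ⊤)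
    (hJ : J ∈ below d I) (i : Finset.Icc 1 (d - 1)) :
    D.haarCoeff (fun x => D.dev a I x * D.dev b I x) J.1 J.2 i =
      D.haarCoeff (fun x => D.dev a J x * D.dev b J x) J.1 J.2 i +
        D.avg (D.dev b I) J * D.haarCoeff a J.1 J.2 i +
        D.avg (D.dev a I) J * D.haarCoeff b J.1 J.2 i := by
  have hJI := D.node_subset_of_mem_below hJ
  have ha1 := ha.integrableOn_node
  have hb1 := hb.integrableOn_node
  have h1 : IntegrableOn (fun x => D.dev a J x * D.dev b J x) (D.node J) μ :=
    ((D.memLp_dev hd (ha1 J) (hea J)).integrable_mul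
      (D.memLp_dev hd (hb1 J) (heb J))).integrableOn
  have h2 : IntegrableOn (fun x => D.avg (D.dev b I) J * (a x - D.avg a J)) (D.node J) μ :=
    ((ha1 J).sub (D.integrableOn_const_node _ J)).const_mul _
  have h3 : IntegrableOn (fun x => D.avg (D.dev a I) J * (b x - D.avg b J)) (D.node J) μ :=
    ((hb1 J).sub (D.integrableOn_const_node _ J)).const_mul _
  rw [← D.haarCoeff_sub_const (ha1 J) (D.avg a J) i, ← D.haarCoeff_sub_const (hb1 J) (D.avg b J) i,
    ← haarCoeff_const_mul, ← haarCoeff_const_mul, ← D.haarCoeff_add h1 h2,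
    ← D.haarCoeff_add (f := fun x => D.dev a J x * D.dev b J x +
      D.avg (D.dev b I) J * (a x - D.avg a J)) (h1.add h2) h3,
    ← D.haarCoeff_sub_const (g := fun x => D.dev a I x * D.dev b I x) (J := J)
      (((D.memLp_dev hd (ha1 I) (hea I)).integrable_mul
        (D.memLp_dev hd (hb1 I) (heb I))).integrableOn)
      (D.avg (D.dev a I) J * D.avg (D.dev b I) J)]
  refine D.haarCoeff_congr (fun x hx => ?_) i
  rw [D.dev_of_mem (hJI hx), D.dev_of_mem (hJI hx), D.dev_of_mem hx, D.dev_of_mem hx,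
    D.avg_dev_of_below (ha1 I) hJ, D.avg_dev_of_below (hb1 I) hJ]
  ring

/-- The product of the deviations of two functions with Carleson energies is square integrable, if
the energies of one of them are summable. -/
theorem memLp_dev_mul_dev (hd : 2 ≤ d) {a b : Ω → ℂ} {α β : ℝ}
    (ha : D.LocallyIntegrable a) (hb : D.LocallyIntegrable b) (hα : 0 < α) (hβ : 0 < β)
    (hea : ∀ J, D.energy a J ≤ ENNReal.ofReal (α * nodeSize d J))
    (heb : ∀ J, D.energy b J ≤ ENNReal.ofReal (β * nodeSize d J))
    (hbb : ∀ I, ∑' J, (below d I).indicator (D.energy b) J < ⊤) (I : ℤ × ℤ) :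
    MemLp (fun x => D.dev a I x * D.dev b I x) 2 μ := by
  have hea' : ∀ J, D.energy a J < ⊤ := fun J => (hea J).trans_lt ENNReal.ofReal_lt_top
  have heb' : ∀ J, D.energy b J < ⊤ := fun J => (heb J).trans_lt ENNReal.ofReal_lt_top
  have ha1 := ha.integrableOn_node
  have hb1 := hb.integrableOn_node
  set g : Ω → ℂ := fun x => D.dev a I x * D.dev b I x with hg
  have hma := fun J => D.memLp_dev hd (ha1 J) (hea' J)
  have hmb := fun J => D.memLp_dev hd (hb1 J) (heb' J)
  have hgi : IntegrableOn g (D.node I) μ := ((hma I).integrable_mul (hmb I)).integrableOn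
  -- For the product of deviations on `J`, Cauchy-Schwarz and the bound `α |J|` on the energy of `a`
  -- give `α` times the energy of `b`. The other two terms are summed by Carleson embedding, each
  -- tested on the deviation of the other function; Riesz-Fischer then gives square integrability.
  have hcoef : ∀ J ∈ below d I, ENNReal.ofReal (D.nodeEnergy g J) ≤
      3 * (ENNReal.ofReal ((d - 1 : ℕ) * α) * D.energy b J +
        ENNReal.ofReal (D.nodeEnergy a J * ‖D.avg (D.dev b I) J‖ ^ 2) +
        ENNReal.ofReal (D.nodeEnergy b J * ‖D.avg (D.dev a I) J‖ ^ 2)) := by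
    intro J hJ
    have hσ := nodeSize_pos (d := d) J
    have h3 : ∀ x y z : ℂ, ‖x + y + z‖ ^ 2 ≤ 3 * (‖x‖ ^ 2 + ‖y‖ ^ 2 + ‖z‖ ^ 2) := by
      intro x y z
      have := norm_add₃_le (a := x) (b := y) (c := z)
      have h0 := norm_nonneg (x + y + z)
      nlinarith [sq_nonneg (‖x‖ - ‖y‖), sq_nonneg (‖y‖ - ‖z‖), sq_nonneg (‖x‖ - ‖z‖)]
    have h4 : ∀ i : Finset.Icc 1 (d - 1), ‖D.haarCoeff g J.1 J.2 i‖ ^ 2 ≤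
        3 * (α * (D.energy b J).toReal +
          ‖D.haarCoeff a J.1 J.2 i‖ ^ 2 * ‖D.avg (D.dev b I) J‖ ^ 2 +
          ‖D.haarCoeff b J.1 J.2 i‖ ^ 2 * ‖D.avg (D.dev a I) J‖ ^ 2) := by
      intro i
      rw [hg, D.haarCoeff_dev_mul_dev hd ha hb hea' heb' hJ]
      refine (h3 _ _ _).trans ?_
      have h5 := D.norm_haarCoeff_mul_sq_le (hma J) (hmb J) J i
      rw [D.integral_norm_dev_sq hd (ha1 J) (hea' J),
        D.integral_norm_dev_sq hd (hb1 J) (heb' J)] at h5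
      have h6 : (D.energy a J).toReal ≤ α * nodeSize d J :=
        ENNReal.toReal_le_of_le_ofReal (by positivity) (hea J)
      have h7 : (nodeSize d J)⁻¹ * (D.energy a J).toReal ≤ α := by
        rw [inv_mul_le_iff₀ hσ, mul_comm]
        exact h6
      have h8 := h5.trans (mul_le_mul_of_nonneg_right h7 ENNReal.toReal_nonneg)
      rw [norm_mul, norm_mul, mul_pow, mul_pow]
      linarith
    have h5 : D.nodeEnergy g J ≤ 3 * ((d - 1 : ℕ) * α * (D.energy b J).toReal +
        D.nodeEnergy a J * ‖D.avg (D.dev b I) J‖ ^ 2 +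
        D.nodeEnergy b J * ‖D.avg (D.dev a I) J‖ ^ 2) := by
      refine (Finset.sum_le_sum fun i _ => h4 i).trans (le_of_eq ?_)
      rw [← Finset.mul_sum, Finset.sum_add_distrib, Finset.sum_add_distrib, Finset.sum_const,
        ← Finset.sum_mul, ← Finset.sum_mul, nodeEnergy, nodeEnergy, Finset.card_univ,
        Fintype.card_coe, Nat.card_Icc, add_tsub_cancel_right, nsmul_eq_mul, mul_assoc (_ : ℝ) α]
    refine (ENNReal.ofReal_le_ofReal h5).trans (le_of_eq ?_)
    have e1 := D.nodeEnergy_nonneg a J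
    have e2 := D.nodeEnergy_nonneg b J
    rw [ENNReal.ofReal_mul (by norm_num), ENNReal.ofReal_add (by positivity) (by positivity),
      ENNReal.ofReal_add (by positivity) (by positivity),
      ENNReal.ofReal_mul (p := (d - 1 : ℕ) * α) (by positivity),
      ENNReal.ofReal_toReal (heb' J).ne]
    norm_num
  have hE : D.energy g I < ⊤ := by
    calc D.energy g I ≤ ∑' J, 3 * (ENNReal.ofReal ((d - 1 : ℕ) * α) *
          (below d I).indicator (D.energy b) J +
          ENNReal.ofReal (D.nodeEnergy a J * ‖D.avg (D.dev b I) J‖ ^ 2) +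
          ENNReal.ofReal (D.nodeEnergy b J * ‖D.avg (D.dev a I) J‖ ^ 2)) := by
          refine ENNReal.tsum_le_tsum fun J => ?_
          by_cases hJ : J ∈ below d I
          · rw [Set.indicator_of_mem hJ, Set.indicator_of_mem hJ]
            exact hcoef J hJ
          · rw [Set.indicator_of_notMem hJ]
            exact zero_le
      _ < ⊤ := by
          rw [ENNReal.tsum_mul_left, ENNReal.tsum_add, ENNReal.tsum_add, ENNReal.tsum_mul_left]
          refine ENNReal.mul_lt_top (by norm_num) (ENNReal.add_lt_top.2
            ⟨ENNReal.add_lt_top.2 ⟨ENNReal.mul_lt_top ENNReal.ofReal_lt_top (hbb I), ?_⟩, ?_⟩)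
          · exact (D.tsum_carleson_le hα hea (hmb I)).trans_lt ENNReal.ofReal_lt_top
          · exact (D.tsum_carleson_le hβ heb (hma I)).trans_lt ENNReal.ofReal_lt_top
  refine (memLp_congr_ae (Eventually.of_forall fun x => ?_)).1 (D.memLp_indicator_node hd hgi hE)
  by_cases hx : x ∈ D.node I
  · simp [hx]
  · simp [hx, hg, D.dev_of_notMem hx]

end DAdicSystem

namespace DAdicSystem

variable {d : ℕ} {Ω : Type*} [MeasurableSpace Ω] {μ : Measure Ω} (D : DAdicSystem d μ)

/-! ### The paraproduct of a Haar wavelet -/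

/-- The image `∑ₗ h_K|_{K_l} 1_{K_l} (a - a_{K_l})` of a Haar wavelet under the paraproduct. -/
def paraHaar (a : Ω → ℂ) (K : ℤ × ℤ) (i : ℕ) (x : Ω) : ℂ :=
  ∑ l, haarVal d K i l * D.dev a (kid d K l) x

theorem sum_mul_dev_of_mem {c : Fin d → ℂ} {a : Ω → ℂ} {K : ℤ × ℤ} {l : Fin d} {x : Ω}
    (hx : x ∈ D.node (kid d K l)) :
    ∑ j, c j * D.dev a (kid d K j) x = c l * D.dev a (kid d K l) x := by
  rw [Finset.sum_eq_single l]
  · intro j _ hj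
    rw [D.dev_of_notMem (fun h => Set.disjoint_left.1 (D.disjoint_kid K hj) h hx), mul_zero]
  · simp

theorem paraHaar_of_mem {a : Ω → ℂ} {K : ℤ × ℤ} {i : ℕ} {l : Fin d} {x : Ω}
    (hx : x ∈ D.node (kid d K l)) :
    D.paraHaar a K i x = haarVal d K i l * D.dev a (kid d K l) x := D.sum_mul_dev_of_mem hx

theorem paraHaar_of_notMem {a : Ω → ℂ} {K : ℤ × ℤ} {i : ℕ} {x : Ω} (hx : x ∉ D.node K) :
    D.paraHaar a K i x = 0 := by
  refine Finset.sum_eq_zero fun l _ => ?_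
  rw [D.dev_of_notMem (fun h => hx (D.node_kid_subset K l h)), mul_zero]

variable [NeZero d]

theorem memLp_paraHaar (hd : 2 ≤ d) {a : Ω → ℂ} (ha : D.LocallyIntegrable a)
    (hea : ∀ J, D.energy a J < ⊤) (K : ℤ × ℤ) (i : ℕ) : MemLp (D.paraHaar a K i) 2 μ :=
  memLp_finsetSum _ fun _ _ => (D.memLp_dev hd (ha.integrableOn_node _) (hea _)).const_mul _

theorem integral_paraHaar {a : Ω → ℂ} (ha : D.LocallyIntegrable a) (K : ℤ × ℤ) (i : ℕ) :
    ∫ x, D.paraHaar a K i x ∂μ = 0 := by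
  simp_rw [paraHaar]
  rw [integral_finsetSum _ fun l _ => (D.integrable_dev (ha.integrableOn_node _)).const_mul _]
  refine Finset.sum_eq_zero fun l _ => ?_
  rw [integral_const_mul, D.integral_dev (ha.integrableOn_node _), mul_zero]

theorem setIntegral_paraHaar_kid {a : Ω → ℂ} (ha : D.LocallyIntegrable a) (K : ℤ × ℤ) (i : ℕ)
    (l : Fin d) : ∫ x in D.node (kid d K l), D.paraHaar a K i x ∂μ = 0 := by
  rw [setIntegral_congr_fun (D.measurableSet_node _) fun x hx => D.paraHaar_of_mem hx,
    integral_const_mul, setIntegral_eq_integral_of_forall_compl_eq_zero fun x hx =>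
      D.dev_of_notMem hx, D.integral_dev (ha.integrableOn_node _), mul_zero]

theorem integral_haar (K : ℤ × ℤ) (i : Finset.Icc 1 (d - 1)) :
    ∫ x, D.haar K.1 K.2 i x ∂μ = 0 := by
  have h := D.haarCoeff_const 1 K i
  simp only [haarCoeff, mul_one] at h
  rw [integral_conj] at h
  simpa using h

theorem avg_haar_of_not_below {J K : ℤ × ℤ} (h : J ∉ below d K ∨ J = K)
    (i : Finset.Icc 1 (d - 1)) : D.avg (D.haar K.1 K.2 i) J = 0 := by
  have key : K ∈ below d J → D.avg (D.haar K.1 K.2 i) J = 0 := by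
    intro hK
    have hσ : (nodeSize d J : ℂ) ≠ 0 := by exact_mod_cast (nodeSize_pos J).ne'
    refine mul_left_cancel₀ hσ ?_
    rw [← setIntegral_node, setIntegral_eq_integral_of_forall_compl_eq_zero fun x hx =>
      D.haar_of_notMem fun h => hx (D.node_subset_of_mem_below hK h), integral_haar, mul_zero]
  rcases h with h | rfl
  · rcases D.below_or_below_or_disjoint J K with h1 | h1 | h1
    · exact absurd h1 h
    · exact key h1
    · rw [D.avg_congr (g := fun _ => 0) fun x hx => D.haar_of_notMem (Set.disjoint_left.1 h1 hx),
        avg_const]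
  · exact key (mem_below_self J)

/-- Strictly below `K` the wavelet is a constant and factors out of the coefficient; at `K` itself
and at nodes not below it both sides vanish. This identifies `paraHaar` with the image of the
wavelet. -/
theorem haarCoeff_paraHaar {a : Ω → ℂ} (ha : D.LocallyIntegrable a)
    (J K : ℤ × ℤ) (j i : Finset.Icc 1 (d - 1)) :
    D.haarCoeff (D.paraHaar a K i) J.1 J.2 j =
      D.haarCoeff a J.1 J.2 j * D.avg (D.haar K.1 K.2 i) J := by
  by_cases hJ : J ∈ below d K
  · by_cases hne : J = K
    · subst hne
      have hint : IntegrableOn (D.paraHaar a J i) (D.node J) μ :=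
        (integrable_finsetSum _ fun l _ =>
          (D.integrable_dev (ha.integrableOn_node (kid d J l))).const_mul
            (haarVal d J i l)).integrableOn
      rw [D.avg_haar_of_not_below (Or.inr rfl), mul_zero, D.haarCoeff_eq_sum hint]
      refine Finset.sum_eq_zero fun l _ => ?_
      rw [D.setIntegral_paraHaar_kid ha, mul_zero]
    · obtain ⟨l, hl, hv⟩ := D.haar_const_of_below hJ hne i
      rw [D.avg_congr (g := fun _ => haarVal d K i l) hv, avg_const,
        D.haarCoeff_congr (g := fun x => haarVal d K i l * D.dev a (kid d K l) x)
          (fun x hx => D.paraHaar_of_mem (D.node_subset_of_mem_below hl hx)), haarCoeff_const_mul,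
        D.haarCoeff_dev_of_below (ha.integrableOn_node _) hl, mul_comm]
  · rw [D.avg_haar_of_not_below (Or.inl hJ), mul_zero]
    exact D.haarCoeff_eq_zero_of_not_below (fun x hx => D.paraHaar_of_notMem hx)
      (D.integral_paraHaar ha K i) hJ j

theorem coeFn_haarLp (x : (ℤ × ℤ) × Finset.Icc 1 (d - 1)) :
    D.haarLp x =ᵐ[μ] D.haar x.1.1 x.1.2 x.2 := (D.memLp_haar x.1 x.2 2).coeFn_toLp

theorem paraproduct_haarLp (hd : 2 ≤ d) {a : Ω → ℂ} (ha : D.LocallyIntegrable a)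
    (hea : ∀ J, D.energy a J < ⊤) {P : Lp ℂ 2 μ →L[ℂ] Lp ℂ 2 μ} (hP : D.HasParaproductMatrix a P)
    (y : (ℤ × ℤ) × Finset.Icc 1 (d - 1)) :
    P (D.haarLp y) = (D.memLp_paraHaar hd ha hea y.1 y.2).toLp (D.paraHaar a y.1 y.2) := by
  obtain ⟨h, hh⟩ := D.exists_haarBasis hd
  refine h.ext_inner fun x => ?_
  rw [hh, hP, D.inner_haarLp_toLp, D.haarCoeff_paraHaar ha,
    D.avg_congr_ae (D.coeFn_haarLp y)]

/-- On each child `|h_K|² = 1 / |K|`, and the energies of `a` at the children add up to at most `A²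
|K|`. -/
theorem integral_norm_paraHaar_sq_le (hd : 2 ≤ d) {a : Ω → ℂ} {A : ℝ}
    (ha : D.LocallyIntegrable a)
    (hea : ∀ J, D.energy a J ≤ ENNReal.ofReal (A ^ 2 * nodeSize d J)) (K : ℤ × ℤ) (i : ℕ) :
    ∫ x, ‖D.paraHaar a K i x‖ ^ 2 ∂μ ≤ A ^ 2 := by
  have hea' : ∀ J, D.energy a J < ⊤ := fun J => (hea J).trans_lt ENNReal.ofReal_lt_top
  have hσ := nodeSize_pos (d := d) K
  have hint := (D.memLp_paraHaar hd ha hea' K i).integrable_norm_pow two_ne_zero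
  rw [← setIntegral_eq_integral_of_forall_compl_eq_zero (s := D.node K) fun x hx => by
    rw [D.paraHaar_of_notMem hx]; simp, D.setIntegral_node_eq_sum hint.integrableOn]
  have h1 : ∀ l, ∫ x in D.node (kid d K l), ‖D.paraHaar a K i x‖ ^ 2 ∂μ ≤
      (nodeSize d K)⁻¹ * (A ^ 2 * nodeSize d (kid d K l)) := by
    intro l
    rw [setIntegral_congr_fun (g := fun x => (nodeSize d K)⁻¹ * ‖D.dev a (kid d K l) x‖ ^ 2)
      (D.measurableSet_node _) fun x hx => by
        simp only [D.paraHaar_of_mem hx, norm_mul, mul_pow, norm_haarVal_sq], integral_const_mul,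
      setIntegral_eq_integral_of_forall_compl_eq_zero fun x hx => by
        rw [D.dev_of_notMem hx]; simp, D.integral_norm_dev_sq hd (ha.integrableOn_node _) (hea' _)]
    have := nodeSize_pos (d := d) (kid d K l)
    gcongr
    exact ENNReal.toReal_le_of_le_ofReal (by positivity) (hea _)
  refine (Finset.sum_le_sum fun l _ => h1 l).trans (le_of_eq ?_)
  rw [← Finset.mul_sum, ← Finset.mul_sum, sum_nodeSize_kid]
  field_simp

end DAdicSystem

namespace DAdicSystem

variable {d : ℕ} {Ω : Type*} [MeasurableSpace Ω] {μ : Measure Ω} (D : DAdicSystem d μ) [NeZero d]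

/-! ### The matrix of the commutator -/

/-- The entries of the commutator of the paraproduct with a multiplication operator in the Haar
basis. -/
def commMatrix (a b : Ω → ℂ) (x y : (ℤ × ℤ) × Finset.Icc 1 (d - 1)) : ℂ :=
  D.haarCoeff a x.1.1 x.1.2 x.2 * D.avg (fun t => b t * D.haar y.1.1 y.1.2 y.2 t) x.1 -
    D.haarCoeff (fun t => b t * D.paraHaar a y.1 y.2 t) x.1.1 x.1.2 x.2

theorem commMatrix_eq_zero (a b : Ω → ℂ) {x y : (ℤ × ℤ) × Finset.Icc 1 (d - 1)}
    (h : Disjoint (D.node x.1) (D.node y.1)) : D.commMatrix a b x y = 0 := by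
  rw [commMatrix, D.avg_congr (g := fun _ => 0), avg_const, mul_zero,
    D.haarCoeff_eq_zero_of_const (c := 0), sub_zero]
  · intro t ht
    rw [D.paraHaar_of_notMem (Set.disjoint_left.1 h ht), mul_zero]
  · intro t ht
    rw [D.haar_of_notMem (Set.disjoint_left.1 h ht), mul_zero]

section Bounds

variable {a b : Ω → ℂ} {A : ℝ}

theorem integral_norm_indicator_one_sq (K : ℤ × ℤ) :
    ∫ x, ‖(D.node K).indicator (fun _ => (1 : ℂ)) x‖ ^ 2 ∂μ = nodeSize d K := by
  have h : ∀ x, ‖(D.node K).indicator (fun _ => (1 : ℂ)) x‖ ^ 2 =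
      (D.node K).indicator (fun _ => (1 : ℝ)) x := by
    intro x
    by_cases hx : x ∈ D.node K
    · simp [hx]
    · simp [hx]
  simp_rw [h]
  rw [integral_indicator_const _ (D.measurableSet_node K), measureReal_node]
  simp

theorem norm_integral_mul_haar_sq_le (hd : 2 ≤ d) (hb : D.LocallyIntegrable b)
    (heb : ∀ J, D.energy b J < ⊤) (K : ℤ × ℤ) (i : Finset.Icc 1 (d - 1)) :
    ‖∫ t, b t * D.haar K.1 K.2 i t ∂μ‖ ^ 2 ≤ (D.energy b K).toReal := by
  have hσ := nodeSize_pos (d := d) K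
  have hdev := D.memLp_dev hd (hb.integrableOn_node K) (heb K)
  have h1 : ∫ t, b t * D.haar K.1 K.2 i t ∂μ =
      ∫ t, D.haar K.1 K.2 i t * (D.node K).indicator (fun _ => (1 : ℂ)) t * D.dev b K t ∂μ := by
    have h2 : ∀ t, b t * D.haar K.1 K.2 i t =
        D.haar K.1 K.2 i t * (D.node K).indicator (fun _ => (1 : ℂ)) t * D.dev b K t +
          D.avg b K * D.haar K.1 K.2 i t := by
      intro t
      by_cases ht : t ∈ D.node K
      · rw [Set.indicator_of_mem ht, D.dev_of_mem ht]
        ring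
      · rw [D.haar_of_notMem ht]
        ring
    simp_rw [h2]
    rw [integral_add, integral_const_mul, integral_haar, mul_zero, add_zero]
    · exact (D.memLp_haar_mul (D.memLp_indicator_const 1 K) K i).integrable_mul hdev
    · exact (memLp_one_iff_integrable.1 (D.memLp_haar K i 1)).const_mul _
  rw [h1]
  refine (D.norm_integral_haar_mul_sq_le (D.memLp_indicator_const 1 K) hdev K i).trans (le_of_eq ?_)
  rw [integral_norm_indicator_one_sq, D.integral_norm_dev_sq hd (hb.integrableOn_node K) (heb K),
    inv_mul_cancel₀ hσ.ne', one_mul]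

/-- Here the column node `K` is the smaller one. In both terms the mean of `b` over `K` drops out,
because `h_K` and its image have no mean and no coefficient at `J`, respectively. Each term squared
is at most `A² E_b(K) / |J|`, and squaring the difference doubles their sum. -/
theorem norm_commMatrix_up_sq_le (hd : 2 ≤ d) (ha : D.LocallyIntegrable a)
    (hb : D.LocallyIntegrable b) (hea : ∀ J, D.energy a J ≤ ENNReal.ofReal (A ^ 2 * nodeSize d J))
    (heb : ∀ J, D.energy b J < ⊤) {x y : (ℤ × ℤ) × Finset.Icc 1 (d - 1)}
    (h : y.1 ∈ below d x.1) :
    ‖D.commMatrix a b x y‖ ^ 2 ≤ 4 * A ^ 2 * ((D.energy b y.1).toReal / nodeSize d x.1) := by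
  obtain ⟨J, j⟩ := x
  obtain ⟨K, i⟩ := y
  change K ∈ below d J at h
  have hea' : ∀ J, D.energy a J < ⊤ := fun J => (hea J).trans_lt ENNReal.ofReal_lt_top
  have hσ := nodeSize_pos (d := d) J
  have he0 : 0 ≤ (D.energy b K).toReal := ENNReal.toReal_nonneg
  have hKJ := D.node_subset_of_mem_below h
  have hdev := D.memLp_dev hd (hb.integrableOn_node K) (heb K)
  have hψ := D.memLp_paraHaar hd ha hea' K i
  have hJK : J ∉ below d K ∨ J = K := by
    obtain ⟨N, hN⟩ := h
    by_cases hJ : J ∈ below d K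
    · right
      obtain ⟨M, hM⟩ := hJ
      have h1 := congrArg Prod.fst hN
      have h2 := congrArg Prod.fst hM
      simp only [anc_fst] at h1 h2
      obtain rfl : N = 0 := by omega
      rw [← hN, anc_zero]
    · exact Or.inl hJ
  have t1 : ‖D.haarCoeff a J.1 J.2 j * D.avg (fun t => b t * D.haar K.1 K.2 i t) J‖ ^ 2 ≤
      A ^ 2 * ((D.energy b K).toReal / nodeSize d J) := by
    have e1 : ‖D.haarCoeff a J.1 J.2 j‖ ^ 2 ≤ A ^ 2 * nodeSize d J := by
      refine (D.norm_haarCoeff_sq_le a J j).trans ?_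
      exact (ENNReal.ofReal_le_ofReal_iff (by positivity)).1 ((D.nodeEnergy_le_energy a J).trans (hea J))
    have e2 := D.norm_integral_mul_haar_sq_le hd hb heb K i
    rw [norm_mul, mul_pow, norm_avg_eq, setIntegral_eq_integral_of_forall_compl_eq_zero fun t ht => by
      rw [D.haar_of_notMem fun h' => ht (hKJ h'), mul_zero], div_pow]
    calc _ ≤ A ^ 2 * nodeSize d J * ((D.energy b K).toReal / nodeSize d J ^ 2) := by gcongr
      _ = _ := by field_simp
  have t2 : ‖D.haarCoeff (fun t => b t * D.paraHaar a K i t) J.1 J.2 j‖ ^ 2 ≤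
      A ^ 2 * ((D.energy b K).toReal / nodeSize d J) := by
    have e1 : D.haarCoeff (fun t => b t * D.paraHaar a K i t) J.1 J.2 j =
        D.haarCoeff (fun t => D.dev b K t * D.paraHaar a K i t) J.1 J.2 j := by
      have e2 : (fun t => b t * D.paraHaar a K i t) = fun t => D.dev b K t * D.paraHaar a K i t +
          D.avg b K * D.paraHaar a K i t := by
        ext t
        by_cases ht : t ∈ D.node K
        · rw [D.dev_of_mem ht]
          ring
        · rw [D.paraHaar_of_notMem ht]
          ring
      rw [e2, D.haarCoeff_add
        (f := fun t => D.dev b K t * D.paraHaar a K i t) (hdev.integrable_mul hψ).integrableOn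
        ((D.integrableOn_node_of_memLp (hψ.restrict _)).const_mul _), haarCoeff_const_mul,
        D.haarCoeff_paraHaar ha, D.avg_haar_of_not_below hJK, mul_zero, mul_zero, add_zero]
    rw [e1]
    refine (D.norm_haarCoeff_mul_sq_le hdev hψ J j).trans ?_
    rw [D.integral_norm_dev_sq hd (hb.integrableOn_node K) (heb K)]
    calc _ ≤ (nodeSize d J)⁻¹ * (D.energy b K).toReal * A ^ 2 := by
          gcongr
          exact D.integral_norm_paraHaar_sq_le hd ha hea K i
      _ = _ := by ring
  rw [commMatrix]
  dsimp only
  have h3 := norm_sub_le (D.haarCoeff a J.1 J.2 j * D.avg (fun t => b t * D.haar K.1 K.2 i t) J)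
    (D.haarCoeff (fun t => b t * D.paraHaar a K i t) J.1 J.2 j)
  refine (pow_le_pow_left₀ (norm_nonneg _) h3 2).trans ((add_sq_le).trans ?_)
  linarith

/-- The energy at a single node bounds the jump of the mean from parent to child by `√d A`; the
jumps add up along the branch. -/
theorem norm_avg_sub_avg_anc_le (ha : D.LocallyIntegrable a) (hA : 0 ≤ A)
    (hea : ∀ J, D.energy a J ≤ ENNReal.ofReal (A ^ 2 * nodeSize d J)) (n : ℕ) (J : ℤ × ℤ) :
    ‖D.avg a J - D.avg a (anc d n J)‖ ≤ n * (√d * A) := by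
  induction n with
  | zero => simp [anc_zero]
  | succ n ih =>
    set L := anc d n J with hL
    have h1 : ‖D.avg a L - D.avg a (anc d 1 L)‖ ≤ √d * A := by
      obtain ⟨j, hj⟩ := (anc_one_eq_iff d (anc d 1 L) L).1 rfl
      set K := anc d 1 L with hK
      have hσ := nodeSize_pos (d := d) K
      have hd0 : (0 : ℝ) < d := by exact_mod_cast NeZero.pos d
      have e1 : D.nodeEnergy a K ≤ A ^ 2 * nodeSize d K :=
        (ENNReal.ofReal_le_ofReal_iff (by positivity)).1 ((D.nodeEnergy_le_energy a K).trans (hea K))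
      rw [nodeEnergy, D.sum_norm_haarCoeff_sq (ha.integrableOn_node K)] at e1
      have e2 : ‖D.avg a L - D.avg a K‖ ^ 2 ≤ ∑ j, ‖D.avg a (kid d K j) - D.avg a K‖ ^ 2 := by
        rw [← hj]
        exact Finset.single_le_sum (f := fun j => ‖D.avg a (kid d K j) - D.avg a K‖ ^ 2)
          (fun _ _ => by positivity) (Finset.mem_univ j)
      have e3 : ‖D.avg a L - D.avg a K‖ ^ 2 ≤ d * A ^ 2 := by
        refine e2.trans ?_
        rw [div_mul_eq_mul_div, div_le_iff₀ hd0] at e1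
        refine le_of_mul_le_mul_left (e1.trans (le_of_eq ?_)) hσ
        ring
      refine abs_le_of_sq_le_sq' ?_ (by positivity) |>.2
      rwa [mul_pow, Real.sq_sqrt hd0.le]
    rw [← anc_anc]
    calc _ = ‖(D.avg a J - D.avg a L) + (D.avg a L - D.avg a (anc d 1 L))‖ := by
          rw [sub_add_sub_cancel]
      _ ≤ n * (√d * A) + √d * A := (norm_add_le _ _).trans (add_le_add ih h1)
      _ = _ := by push_cast; ring

/-- Here the row node `J` is strictly smaller, so `h_K` is constant on `J`. The contributions of the
mean of `b` over `J` to the two terms cancel, leaving the deviation of `b` on `J` paired with `a -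
a_L`, where `L` is the child of `K` containing `J`. -/
theorem norm_commMatrix_down_sq_le (hd : 2 ≤ d) (ha : D.LocallyIntegrable a)
    (hb : D.LocallyIntegrable b) (hA : 0 ≤ A)
    (hea : ∀ J, D.energy a J ≤ ENNReal.ofReal (A ^ 2 * nodeSize d J))
    (heb : ∀ J, D.energy b J < ⊤) {x y : (ℤ × ℤ) × Finset.Icc 1 (d - 1)} {n : ℕ}
    (h : anc d (n + 1) x.1 = y.1) :
    ‖D.commMatrix a b x y‖ ^ 2 ≤
      2 * d * A ^ 2 * ((n : ℝ) + 1) ^ 2 * ((D.energy b x.1).toReal / nodeSize d y.1) := by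
  obtain ⟨J, j⟩ := x
  obtain ⟨K, i⟩ := y
  change anc d (n + 1) J = K at h
  have hea' : ∀ J, D.energy a J < ⊤ := fun J => (hea J).trans_lt ENNReal.ofReal_lt_top
  have hd1 : (1 : ℝ) ≤ d := by exact_mod_cast (one_le_two.trans hd)
  have hσJ := nodeSize_pos (d := d) J
  have hσK := nodeSize_pos (d := d) K
  have he0 : 0 ≤ (D.energy b J).toReal := ENNReal.toReal_nonneg
  set L := anc d n J with hL
  have hLK : anc d 1 L = K := by rw [hL, anc_anc, h]
  obtain ⟨l, hl⟩ := (anc_one_eq_iff d K L).1 hLK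
  have hJL : J ∈ below d L := ⟨n, rfl⟩
  have hsub := D.node_subset_of_mem_below hJL
  have hmem : ∀ t ∈ D.node J, t ∈ D.node (kid d K l) := fun t ht => hl ▸ hsub ht
  have hdevb := D.memLp_dev hd (hb.integrableOn_node J) (heb J)
  have hdeva := D.memLp_dev hd (ha.integrableOn_node L) (hea' L)
  have hind : MemLp ((D.node J).indicator (D.dev a L)) 2 μ :=
    hdeva.indicator (D.measurableSet_node J)
  have hM : D.commMatrix a b (J, j) (K, i) = -(haarVal d K i l *
      D.haarCoeff (fun t => D.dev b J t * (D.node J).indicator (D.dev a L) t) J.1 J.2 j) := by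
    rw [commMatrix]
    dsimp only
    have e1 : D.avg (fun t => b t * D.haar K.1 K.2 i t) J = haarVal d K i l * D.avg b J := by
      have hσ : (nodeSize d J : ℂ) ≠ 0 := by exact_mod_cast hσJ.ne'
      refine mul_left_cancel₀ hσ ?_
      rw [← setIntegral_node, setIntegral_congr_fun (g := fun t => haarVal d K i l * b t)
        (D.measurableSet_node J) fun t ht => by
          simp only [D.haar_of_mem_kid (hmem t ht), mul_comm], integral_const_mul, setIntegral_node]
      ring
    have e2 : D.haarCoeff (fun t => b t * D.paraHaar a K i t) J.1 J.2 j = haarVal d K i l *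
        (D.haarCoeff (fun t => D.dev b J t * (D.node J).indicator (D.dev a L) t) J.1 J.2 j +
          D.avg b J * D.haarCoeff a J.1 J.2 j) := by
      rw [← D.haarCoeff_dev_of_below (ha.integrableOn_node L) hJL, ← haarCoeff_const_mul,
        ← D.haarCoeff_add
          (f := fun t => D.dev b J t * (D.node J).indicator (D.dev a L) t)
          (hdevb.integrable_mul hind).integrableOn
          ((D.integrableOn_node_of_memLp (hdeva.restrict _)).const_mul _), ← haarCoeff_const_mul]
      refine D.haarCoeff_congr (fun t ht => ?_) _
      rw [D.paraHaar_of_mem (hmem t ht), D.dev_of_mem ht, Set.indicator_of_mem ht, hl]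
      ring
    rw [e1, e2]
    ring
  -- Split `a - a_L` into the deviation on `J`, of energy at most `A² |J|`, and the difference of
  -- means, at most `n √d A`.
  have hdev2 : ∫ t, ‖(D.node J).indicator (D.dev a L) t‖ ^ 2 ∂μ ≤
      2 * d * A ^ 2 * ((n : ℝ) + 1) ^ 2 * nodeSize d J := by
    have e1 := D.norm_avg_sub_avg_anc_le ha hA hea n J
    have hda := D.memLp_dev hd (ha.integrableOn_node J) (hea' J)
    have hone := D.memLp_indicator_const 1 J
    have e2 : ∀ t, ‖(D.node J).indicator (D.dev a L) t‖ ^ 2 ≤ 2 * ‖D.dev a J t‖ ^ 2 +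
        2 * (n * (√d * A)) ^ 2 * ‖(D.node J).indicator (fun _ => (1 : ℂ)) t‖ ^ 2 := by
      intro t
      by_cases ht : t ∈ D.node J
      · rw [Set.indicator_of_mem ht, Set.indicator_of_mem ht, D.dev_of_mem ht,
          D.dev_of_mem (hsub ht)]
        have e3 : ‖a t - D.avg a L‖ ≤ ‖a t - D.avg a J‖ + n * (√d * A) := by
          calc _ = ‖(a t - D.avg a J) + (D.avg a J - D.avg a L)‖ := by rw [sub_add_sub_cancel]
            _ ≤ _ := (norm_add_le _ _).trans (by gcongr)
        refine (pow_le_pow_left₀ (norm_nonneg _) e3 2).trans (add_sq_le.trans (le_of_eq ?_))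
        simp only [norm_one, one_pow]
        ring
      · rw [Set.indicator_of_notMem ht, norm_zero, zero_pow two_ne_zero]
        positivity
    refine (integral_mono (hind.integrable_norm_pow two_ne_zero)
      (((hda.integrable_norm_pow two_ne_zero).const_mul _).add
        ((hone.integrable_norm_pow two_ne_zero).const_mul _)) e2).trans ?_
    simp only [Pi.add_apply]
    rw [integral_add ((hda.integrable_norm_pow two_ne_zero).const_mul _)
        ((hone.integrable_norm_pow two_ne_zero).const_mul _), integral_const_mul,
      integral_const_mul, integral_norm_indicator_one_sq,
      D.integral_norm_dev_sq hd (ha.integrableOn_node J) (hea' J)]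
    have e4 : (D.energy a J).toReal ≤ A ^ 2 * nodeSize d J :=
      ENNReal.toReal_le_of_le_ofReal (by positivity) (hea J)
    have e5 : (n * (√d * A)) ^ 2 = n ^ 2 * (d * A ^ 2) := by
      rw [mul_pow, mul_pow, Real.sq_sqrt (by positivity)]
    rw [e5]
    have e6 : A ^ 2 * nodeSize d J ≤ d * (A ^ 2 * nodeSize d J) :=
      le_mul_of_one_le_left (by positivity) hd1
    have e7 : 0 ≤ d * (A ^ 2 * nodeSize d J) * n := by positivity
    nlinarith
  rw [hM, norm_neg, norm_mul, mul_pow, norm_haarVal_sq]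
  have e8 := D.norm_haarCoeff_mul_sq_le hdevb hind J j
  rw [D.integral_norm_dev_sq hd (hb.integrableOn_node J) (heb J)] at e8
  calc _ ≤ (nodeSize d K)⁻¹ * ((nodeSize d J)⁻¹ * (D.energy b J).toReal *
        (2 * d * A ^ 2 * ((n : ℝ) + 1) ^ 2 * nodeSize d J)) := by
        gcongr
        exact e8.trans (by gcongr)
    _ = _ := by field_simp

end Bounds

end DAdicSystem

/-! ### Commutators in terms of matrices -/

section Commutator

variable {Ω : Type*} [MeasurableSpace Ω] {μ : Measure Ω} {ι : Type*}

theorem memLp_conj_mul {b : Ω → ℂ} {f : Lp ℂ 2 μ} (h : MemLp (fun t => b t * f t) 2 μ) :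
    MemLp (fun t => (starRingEnd ℂ) (b t) * f t) 2 μ := by
  -- Measurability of `b` is not assumed. The product with the conjugate is recovered from
  -- measurable functions; where `f` vanishes, division by zero returns `0`, as required.
  have h1 : (fun t => (starRingEnd ℂ) (b t) * f t) =
      fun t => (starRingEnd ℂ) (b t * f t) * f t / (starRingEnd ℂ) (f t) := by
    ext t
    by_cases ht : f t = 0
    · simp [ht]
    · have : (starRingEnd ℂ) (f t) ≠ 0 := by simpa using ht
      rw [map_mul]
      field_simp
  have hc := Complex.continuous_conj.measurable
  refine h.of_le ?_ (Eventually.of_forall fun t => by simp)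
  rw [h1]
  have hf := (Lp.memLp f).1.aemeasurable
  exact (((hc.comp_aemeasurable h.1.aemeasurable).mul hf).div
    (hc.comp_aemeasurable hf)).aestronglyMeasurable

theorem memLp_mul_of_mem_span {b : Ω → ℂ} (h : ι → Lp ℂ 2 μ) (Q : Lp ℂ 2 μ →L[ℂ] Lp ℂ 2 μ)
    (hQ : ∀ x, MemLp (fun t => b t * Q (h x) t) 2 μ) {f : Lp ℂ 2 μ}
    (hf : f ∈ Submodule.span ℂ (Set.range h)) : MemLp (fun t => b t * Q f t) 2 μ := by
  induction hf using Submodule.span_induction with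
  | mem f hf =>
    obtain ⟨x, rfl⟩ := hf
    exact hQ x
  | zero =>
    refine (memLp_congr_ae ?_).1 (MemLp.zero' (p := 2) (μ := μ) (ε := ℂ))
    rw [map_zero]
    filter_upwards [Lp.coeFn_zero ℂ 2 μ] with t ht
    rw [ht]
    simp
  | add f g _ _ hf hg =>
    refine (memLp_congr_ae ?_).1 (hf.add hg)
    rw [map_add]
    filter_upwards [Lp.coeFn_add (Q f) (Q g)] with t ht
    rw [ht, Pi.add_apply, Pi.add_apply, mul_add]
  | smul c f _ hf =>
    refine (memLp_congr_ae ?_).1 (hf.const_mul c)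
    rw [map_smul]
    filter_upwards [Lp.coeFn_smul c (Q f)] with t ht
    rw [ht, Pi.smul_apply, smul_eq_mul]
    ring

theorem inner_conj_mul_toLp {b : Ω → ℂ} {f g : Lp ℂ 2 μ}
    (hf : MemLp (fun t => (starRingEnd ℂ) (b t) * f t) 2 μ) (hg : MemLp (fun t => b t * g t) 2 μ) :
    inner ℂ (hf.toLp _) g = inner ℂ f (hg.toLp _) := by
  rw [L2.inner_def, L2.inner_def]
  refine integral_congr_ae ?_
  filter_upwards [hf.coeFn_toLp, hg.coeFn_toLp] with t h1 h2
  rw [h1, h2, RCLike.inner_apply, RCLike.inner_apply, map_mul, Complex.conj_conj]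
  ring

/-- An operator is the commutator with a multiplication operator, if it has the right matrix in a
suitable orthonormal basis. -/
theorem isCommutator_of_matrix (h : HilbertBasis ι ℂ (Lp ℂ 2 μ)) {b : Ω → ℂ}
    {P T : Lp ℂ 2 μ →L[ℂ] Lp ℂ 2 μ}
    (hb : ∀ x, MemLp (fun t => b t * h x t) 2 μ)
    (hP : ∀ x, MemLp (fun t => b t * P (h x) t) 2 μ)
    (hP' : ∀ x, MemLp (fun t => b t * ContinuousLinearMap.adjoint P (h x) t) 2 μ)
    (hT : ∀ x y, inner ℂ (h x) (T (h y)) =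
      inner ℂ (h x) (P ((hb y).toLp _)) - inner ℂ (h x) ((hP y).toLp _)) :
    IsCommutator P b T := by
  refine ⟨?_, fun f h₁ h₂ => h.ext_inner fun x => ?_⟩
  · have hd := Submodule.dense_iff_topologicalClosure_eq_top.2 h.dense_span
    refine hd.mono fun f hf => ⟨?_, memLp_mul_of_mem_span h P hP hf⟩
    exact memLp_mul_of_mem_span h (ContinuousLinearMap.id ℂ _) hb hf
  · have hb' := memLp_conj_mul (hb x)
    have hP'' := memLp_conj_mul (hP' x)
    -- The basis vectors also lie in the domain of the formal adjoint of the commutator, where `T*`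
    -- is known from the matrix. Pairing with them identifies `T f` for every `f` in the natural
    -- domain, not merely in the span of the basis.
    have h1 : ContinuousLinearMap.adjoint T (h x) =
        hP''.toLp _ - ContinuousLinearMap.adjoint P (hb'.toLp _) := by
      refine h.ext_inner fun y => ?_
      rw [← inner_conj_symm, ← inner_conj_symm (h y) (_ - _)]
      congr 1
      rw [ContinuousLinearMap.adjoint_inner_left, hT, inner_sub_left,
        ContinuousLinearMap.adjoint_inner_left, inner_conj_mul_toLp hP'' (hb y),
        inner_conj_mul_toLp hb' (hP y), ContinuousLinearMap.adjoint_inner_left]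
    rw [← ContinuousLinearMap.adjoint_inner_left, h1, inner_sub_left,
      ContinuousLinearMap.adjoint_inner_left, inner_conj_mul_toLp hP'' h₁,
      inner_conj_mul_toLp hb' h₂, ContinuousLinearMap.adjoint_inner_left, inner_sub_right]

/-- The commutator of the adjoint operator. -/
theorem isCommutator_adjoint_of_matrix (h : HilbertBasis ι ℂ (Lp ℂ 2 μ)) {b : Ω → ℂ}
    {P T : Lp ℂ 2 μ →L[ℂ] Lp ℂ 2 μ}
    (hb : ∀ x, MemLp (fun t => (starRingEnd ℂ) (b t) * h x t) 2 μ)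
    (hP : ∀ x, MemLp (fun t => (starRingEnd ℂ) (b t) * P (h x) t) 2 μ)
    (hP' : ∀ x, MemLp (fun t => (starRingEnd ℂ) (b t) * ContinuousLinearMap.adjoint P (h x) t) 2 μ)
    (hT : ∀ x y, inner ℂ (h x) (T (h y)) =
      inner ℂ (h x) (P ((hb y).toLp _)) - inner ℂ (h x) ((hP y).toLp _)) :
    IsCommutator (ContinuousLinearMap.adjoint P) b (-ContinuousLinearMap.adjoint T) := by
  have hb1 : ∀ x, MemLp (fun t => b t * h x t) 2 μ := fun x => by
    simpa only [Complex.conj_conj] using memLp_conj_mul (hb x)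
  have hP1 : ∀ x, MemLp (fun t => b t * P (h x) t) 2 μ := fun x => by
    simpa only [Complex.conj_conj] using memLp_conj_mul (hP x)
  have hP2 : ∀ x, MemLp (fun t => b t * ContinuousLinearMap.adjoint P (h x) t) 2 μ := fun x => by
    simpa only [Complex.conj_conj] using memLp_conj_mul (hP' x)
  -- Formally `[P*, M_b] = -[P, M_{b̄}]*`, so the matrix hypothesis for the conjugate of `b` becomes
  -- the one required here.
  refine isCommutator_of_matrix h hb1 hP2
    (fun x => by simpa only [ContinuousLinearMap.adjoint_adjoint] using hP1 x) fun x y => ?_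
  rw [neg_apply, inner_neg_right, ContinuousLinearMap.adjoint_inner_right,
    ← inner_conj_symm, hT, ContinuousLinearMap.adjoint_inner_right, map_sub, inner_conj_symm,
    inner_conj_symm, inner_conj_mul_toLp (hP x) (hb1 y), ← inner_conj_mul_toLp (hb x) (hP2 y),
    ContinuousLinearMap.adjoint_inner_right, neg_sub]

end Commutator

/-! ### Lorentz estimates for operators with almost diagonal matrices -/

section AlmostDiagonalLorentz

variable {S : Type*} [Fintype S]

/-- The sum of the squares of a family over the indices at a node. -/
def nodeSq (c : (ℤ × ℤ) × S → ℝ≥0∞) (J : ℤ × ℤ) : ℝ≥0∞ := ∑ j, c (J, j) ^ 2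

/-- The constant in `HilbertBasis.exists_almostDiagonal_of_treeEnergy`. -/
def treeWeakConst (d c : ℕ) (r : ℝ) : ℝ≥0∞ :=
  almostDiagonalConst d c r * (treeEnergyConst d (r / 2) * (c : ℝ≥0∞) ^ (r / 2)) ^ (1 / r)

theorem treeWeakConst_lt_top {d : ℕ} (hd : 2 ≤ d) (c : ℕ) {r : ℝ} (hr : 0 < r) :
    treeWeakConst d c r < ⊤ := by
  refine ENNReal.mul_lt_top (almostDiagonalConst_lt_top hd c hr)
    (ENNReal.rpow_lt_top_of_nonneg (by positivity) (ENNReal.mul_lt_top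
      (treeEnergyConst_lt_top hd (by positivity)) ?_).ne)
  exact ENNReal.rpow_lt_top_of_nonneg (by positivity) (ENNReal.natCast_ne_top c)

theorem ENNReal.rpow_half_sq (x : ℝ≥0∞) : (x ^ (1 / 2 : ℝ)) ^ 2 = x := by
  rw [← ENNReal.rpow_natCast, ← ENNReal.rpow_mul]
  simp

theorem tsum_treeEnergy_nodeSq_le (d : ℕ) [NeZero d] (c : (ℤ × ℤ) × S → ℝ≥0∞) {r : ℝ} (hr : 0 < r) :
    ∑' J, treeEnergy d (nodeSq c) J ^ (r / 2) ≤
      treeEnergyConst d (r / 2) * (Fintype.card S : ℝ≥0∞) ^ (r / 2) * ∑' x, c x ^ r := by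
  refine (tsum_treeEnergy_rpow_le d (nodeSq c) (show 0 < r / 2 by positivity)).trans ?_
  rw [mul_assoc]
  refine mul_le_mul_right ?_ _
  rw [ENNReal.tsum_prod' (f := fun x => c x ^ r), ← ENNReal.tsum_mul_left]
  refine ENNReal.tsum_le_tsum fun J => ?_
  rw [tsum_fintype]
  refine (ENNReal.finset_sum_rpow_le_card_mul _ _ (show 0 < r / 2 by positivity)).trans (le_of_eq ?_)
  rw [Finset.card_univ]
  congr 1
  refine Finset.sum_congr rfl fun j _ => ?_
  rw [← ENNReal.rpow_natCast, ← ENNReal.rpow_mul]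
  congr 1
  push_cast
  ring

variable {H : Type*} [NormedAddCommGroup H] [InnerProductSpace ℂ H] [CompleteSpace H]

/-- Weak type estimate for operators with almost diagonal matrices, in terms of tree energies. -/
theorem HilbertBasis.exists_almostDiagonal_of_treeEnergy {d : ℕ} (hd : 2 ≤ d) [NeZero d]
    (h : HilbertBasis ((ℤ × ℤ) × S) ℂ H)
    {M : (ℤ × ℤ) × S → (ℤ × ℤ) × S → ℂ} {c : (ℤ × ℤ) × S → ℝ≥0∞} {L : ℝ≥0∞} (hL : L < ⊤)
    (hdown : ∀ N J j i, ‖M (J, j) (anc d N J, i)‖ₑ ^ 2 ≤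
      ((N : ℝ≥0∞) + 1) ^ 2 * (((d : ℝ≥0∞) ^ N)⁻¹ * (L ^ 2 * treeEnergy d (nodeSq c) J)))
    (hup : ∀ N J j i, ‖M (anc d N J, i) (J, j)‖ₑ ^ 2 ≤
      ((N : ℝ≥0∞) + 1) ^ 2 * (((d : ℝ≥0∞) ^ N)⁻¹ * (L ^ 2 * treeEnergy d (nodeSq c) J)))
    (hzero : ∀ x y, (∀ N, anc d N x.1 ≠ y.1) → (∀ N, anc d N y.1 ≠ x.1) → M x y = 0)
    {r : ℝ} (hr : 0 < r) (hc : ∑' x, c x ^ r < ⊤) :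
    ∃ T : H →L[ℂ] H, (∀ x y, inner ℂ (h x) (T (h y)) = M x y) ∧
      ∀ m, approxNumber T m ≤ ((m : ℝ≥0∞) + 1) ^ (-(1 / r)) *
        (treeWeakConst d (Fintype.card S) r * L * (∑' x, c x ^ r) ^ (1 / r)) := by
  set s : ℤ × ℤ → ℝ≥0∞ := fun J => L * treeEnergy d (nodeSq c) J ^ (1 / 2 : ℝ) with hs
  have hs2 : ∀ J, s J ^ 2 = L ^ 2 * treeEnergy d (nodeSq c) J := fun J => by
    rw [hs]
    beta_reduce
    rw [mul_pow, ENNReal.rpow_half_sq]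
  have hsr : ∑' J, s J ^ r ≤ L ^ r *
      (treeEnergyConst d (r / 2) * (Fintype.card S : ℝ≥0∞) ^ (r / 2) * ∑' x, c x ^ r) := by
    refine le_trans (le_of_eq ?_) (mul_le_mul_right (tsum_treeEnergy_nodeSq_le d c hr) _)
    rw [← ENNReal.tsum_mul_left]
    refine tsum_congr fun J => ?_
    rw [hs]
    beta_reduce
    rw [ENNReal.mul_rpow_of_nonneg _ _ hr.le, ← ENNReal.rpow_mul _ (1 / 2) r]
    congr 2
    ring
  have hcard : (Fintype.card S : ℝ≥0∞) ^ (r / 2) < ⊤ :=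
    ENNReal.rpow_lt_top_of_nonneg (by positivity) (ENNReal.natCast_ne_top _)
  have hfin : ∑' J, s J ^ r < ⊤ := hsr.trans_lt (ENNReal.mul_lt_top
    (ENNReal.rpow_lt_top_of_nonneg hr.le hL.ne) (ENNReal.mul_lt_top (ENNReal.mul_lt_top
      (treeEnergyConst_lt_top hd (by positivity)) hcard) hc))
  obtain ⟨T, hT, hTa⟩ := h.exists_almostDiagonal d hd (M := M) (s := s)
    (fun N J j i => by rw [hs2]; exact hdown N J j i)
    (fun N J j i => by rw [hs2]; exact hup N J j i) hzero hr hfin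
  refine ⟨T, hT, fun m => (hTa m).trans (mul_le_mul_right ?_ _)⟩
  rw [treeWeakConst, mul_assoc, mul_assoc]
  refine mul_le_mul_right ?_ _
  refine (ENNReal.rpow_le_rpow hsr (show 0 ≤ 1 / r by positivity)).trans (le_of_eq ?_)
  rw [ENNReal.mul_rpow_of_nonneg _ _ (by positivity), ENNReal.mul_rpow_of_nonneg _ (∑' x, c x ^ r)
    (by positivity), ← ENNReal.rpow_mul, mul_one_div_cancel hr.ne', ENNReal.rpow_one]
  ring

theorem two_pow_sub_one_add_one (k : ℕ) : ((2 ^ k - 1 : ℕ) : ℝ≥0∞) + 1 = 2 ^ (k : ℝ) := by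
  rw [ENNReal.rpow_natCast]
  have := Nat.sub_add_cancel (Nat.one_le_two_pow (n := k))
  exact_mod_cast congrArg (Nat.cast : ℕ → ℝ≥0∞) this

/-- The inclusion of `ℓ_{p,q}` in `ℓ_{2p}`, through weak `ℓ_p`: the layer of height about `2^{-l/p}`
contributes a multiple of `2^{-l}`. -/
theorem tsum_rpow_two_mul_lt_top {ι : Type*} {c : ι → ℝ≥0∞} {p : ℝ} (hp : 0 < p) {q : ℝ≥0∞} (hq : 0 < q)
    (h : lorentzNorm p q c < ⊤) : ∑' t, c t ^ (2 * p) < ⊤ := by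
  obtain ⟨K, hK, hle⟩ := two_rpow_mul_lt_top_of_lorentzSeqNorm_lt_top hq
    (decreasingRearrangement_antitone c) h
  have h1 := tsum_split_tail_le c (show 0 < 2 * p by positivity)
    (exists_decreasingRearrangement_lt c hp hq h) 0
  simp only [pow_zero, Nat.sub_self, zero_add, not_lt.2 (le_decreasingRearrangement_zero c _),
    if_false] at h1
  refine h1.trans_lt (ENNReal.mul_lt_top ENNReal.ofNat_lt_top ?_)
  have h2 : ∀ l : ℕ, (2 : ℝ≥0∞) ^ (l : ℝ) * decreasingRearrangement c (2 ^ l - 1) ^ (2 * p) ≤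
      K ^ (2 * p) * 2 ^ (-(1 * l : ℝ)) := by
    intro l
    refine le_trans (le_of_eq ?_) (mul_le_mul_left (ENNReal.rpow_le_rpow (hle l)
      (show 0 ≤ 2 * p by positivity)) _)
    rw [ENNReal.mul_rpow_of_nonneg _ _ (by positivity), ← ENNReal.rpow_mul, mul_right_comm,
      ← ENNReal.rpow_add _ _ two_ne_zero ENNReal.ofNat_ne_top]
    congr 2
    field_simp
    ring
  refine (ENNReal.tsum_le_tsum h2).trans_lt ?_
  rw [ENNReal.tsum_mul_left]
  exact ENNReal.mul_lt_top (ENNReal.rpow_lt_top_of_nonneg (by positivity) hK.ne)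
    (ENNReal.tsum_two_rpow_neg_mul one_pos)

/-- Operators with almost diagonal matrices belong to Schatten-Lorentz classes, by real
interpolation of the weak type estimates. -/
theorem HilbertBasis.exists_almostDiagonal_lorentz {d : ℕ} (hd : 2 ≤ d) [NeZero d] (S : Type*)
    [Fintype S] {p : ℝ} (hp : 0 < p) {q : ℝ≥0∞} (hq : 0 < q) :
    ∃ C : ℝ≥0, ∀ (H : Type*) [NormedAddCommGroup H] [InnerProductSpace ℂ H] [CompleteSpace H]
      (h : HilbertBasis ((ℤ × ℤ) × S) ℂ H) (M : (ℤ × ℤ) × S → (ℤ × ℤ) × S → ℂ)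
      (c : (ℤ × ℤ) × S → ℝ≥0∞) (L : ℝ≥0∞), L < ⊤ →
      (∀ N J j i, ‖M (J, j) (anc d N J, i)‖ₑ ^ 2 ≤
        ((N : ℝ≥0∞) + 1) ^ 2 * (((d : ℝ≥0∞) ^ N)⁻¹ * (L ^ 2 * treeEnergy d (nodeSq c) J))) →
      (∀ N J j i, ‖M (anc d N J, i) (J, j)‖ₑ ^ 2 ≤
        ((N : ℝ≥0∞) + 1) ^ 2 * (((d : ℝ≥0∞) ^ N)⁻¹ * (L ^ 2 * treeEnergy d (nodeSq c) J))) →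
      (∀ x y, (∀ N, anc d N x.1 ≠ y.1) → (∀ N, anc d N y.1 ≠ x.1) → M x y = 0) →
      lorentzNorm p q c < ⊤ →
      ∃ T : H →L[ℂ] H, (∀ x y, inner ℂ (h x) (T (h y)) = M x y) ∧
        lorentzSeqNorm p q (approxNumber T) ≤ C * L * lorentzNorm p q c := by
  classical
  obtain ⟨C₀, hC₀⟩ := lorentzSeqNorm_le_of_dyadic hp hq
  set W₁ := treeWeakConst d (Fintype.card S) (p / 2) with hW₁
  set W₂ := treeWeakConst d (Fintype.card S) (2 * p) with hW₂
  set W := W₁ * 2 ^ (2 / p) + W₂ * 2 ^ (1 / (2 * p)) with hW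
  have hWt : W < ⊤ := ENNReal.add_lt_top.2
    ⟨ENNReal.mul_lt_top (treeWeakConst_lt_top hd _ (by positivity))
      (ENNReal.rpow_lt_top_of_nonneg (by positivity) ENNReal.ofNat_ne_top),
    ENNReal.mul_lt_top (treeWeakConst_lt_top hd _ (by positivity))
      (ENNReal.rpow_lt_top_of_nonneg (by positivity) ENNReal.ofNat_ne_top)⟩
  refine ⟨C₀ * 2 * W.toNNReal, fun H _ _ _ h M c L hL hdown hup hzero hc => ?_⟩
  set X := decreasingRearrangement c with hX
  have hXa : Antitone X := decreasingRearrangement_antitone c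
  obtain ⟨B, hBt, hB⟩ := two_rpow_mul_lt_top_of_lorentzSeqNorm_lt_top hq hXa hc
  have hXt : ∀ k, X (2 ^ k - 1) < ⊤ := by
    intro k
    by_contra hk
    have h1 := hB k
    rw [not_lt_top_iff.1 hk, ENNReal.mul_top (ENNReal.rpow_pos two_pos ENNReal.ofNat_ne_top).ne'] at h1
    exact absurd hBt (not_lt.2 h1)
  -- At height `c*(2 ^ k - 1)`, with indices starting at `0`, the large coefficients are measured in
  -- `ℓ_{p/2}` and the small ones in `ℓ_{2p}`. Each half of the operator receives rank `2 ^ k - 1`,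
  -- hence the total `2 ^ (k + 1) - 2`.
  have key : ∀ k : ℕ, ∃ T : H →L[ℂ] H, (∀ x y, inner ℂ (h x) (T (h y)) = M x y) ∧
      approxNumber T (2 ^ (k + 1) - 2) ≤ (2 * W * L) *
        ((2 ^ (-(k : ℝ)) * ∑ i ∈ Finset.range k, 2 ^ (i : ℝ) * X (2 ^ i - 1) ^ (p / 2)) ^ (2 / p) +
        (2 ^ (-(k : ℝ)) * ∑' l : ℕ, 2 ^ ((k + l : ℕ) : ℝ) * X (2 ^ (k + l) - 1) ^ (2 * p)) ^
          (1 / (2 * p))) := by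
    intro k
    set θ := X (2 ^ k - 1) with hθ
    set cb : (ℤ × ℤ) × S → ℝ≥0∞ := fun t => if θ < c t then c t else 0 with hcb
    set cs : (ℤ × ℤ) × S → ℝ≥0∞ := fun t => if θ < c t then 0 else c t with hcs
    have hsplit : nodeSq c = nodeSq cb + nodeSq cs := by
      ext J
      rw [Pi.add_apply, nodeSq, nodeSq, nodeSq, ← Finset.sum_add_distrib]
      refine Finset.sum_congr rfl fun j _ => ?_
      rw [hcb, hcs]
      beta_reduce
      split_ifs <;> simp
    have hE : ∀ J, treeEnergy d (nodeSq c) J =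
        treeEnergy d (nodeSq cb) J + treeEnergy d (nodeSq cs) J := fun J => by
      rw [hsplit, treeEnergy_add]
    -- The matrix is only bounded by `c` and need not depend on it linearly, so it cannot be split
    -- along with `c`. An entry goes to the part whose energy dominates at its lower node `low x y`,
    -- at the price of replacing `L` by `2 * L`.
    set G : Set (ℤ × ℤ) := {J | treeEnergy d (nodeSq cs) J ≤ treeEnergy d (nodeSq cb) J} with hG
    set low : (ℤ × ℤ) × S → (ℤ × ℤ) × S → ℤ × ℤ :=
      fun x y => if y.1.1 ≤ x.1.1 then x.1 else y.1 with hlow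
    have hlow1 : ∀ N J (j i : S), low (J, j) (anc d N J, i) = J := by
      intro N J j i
      rw [hlow]
      beta_reduce
      refine if_pos ?_
      change J.1 - N ≤ J.1
      omega
    have hlow2 : ∀ N J (j i : S), low (anc d N J, i) (J, j) = J := by
      intro N J j i
      rw [hlow]
      beta_reduce
      split_ifs with h1
      · change J.1 ≤ J.1 - N at h1
        obtain rfl : N = 0 := by omega
        exact anc_zero d J
      · rfl
    have hsq : ∀ J, (J ∈ G → L ^ 2 * treeEnergy d (nodeSq c) J ≤
          (2 * L) ^ 2 * treeEnergy d (nodeSq cb) J) ∧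
        (J ∉ G → L ^ 2 * treeEnergy d (nodeSq c) J ≤ (2 * L) ^ 2 * treeEnergy d (nodeSq cs) J) := by
      intro J
      have h4 : ∀ u v w : ℝ≥0∞, w = u + v → v ≤ u → L ^ 2 * w ≤ (2 * L) ^ 2 * u := by
        rintro u v _ rfl hvu
        calc L ^ 2 * (u + v) ≤ L ^ 2 * (u + u) := by gcongr
          _ ≤ L ^ 2 * ((u + u) + (u + u)) := by
              gcongr <;> exact le_self_add
          _ = _ := by ring
      exact ⟨fun hJ => h4 _ _ _ (hE J) hJ,
        fun hJ => h4 _ _ _ ((hE J).trans (add_comm _ _)) (not_le.1 hJ).le⟩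
    have hM : ∀ (z : ℂ) (N : ℕ) (J : ℤ × ℤ), ‖z‖ₑ ^ 2 ≤
        ((N : ℝ≥0∞) + 1) ^ 2 * (((d : ℝ≥0∞) ^ N)⁻¹ * (L ^ 2 * treeEnergy d (nodeSq c) J)) →
        ‖if J ∈ G then z else 0‖ₑ ^ 2 ≤ ((N : ℝ≥0∞) + 1) ^ 2 *
          (((d : ℝ≥0∞) ^ N)⁻¹ * ((2 * L) ^ 2 * treeEnergy d (nodeSq cb) J)) ∧
        ‖if J ∈ G then 0 else z‖ₑ ^ 2 ≤ ((N : ℝ≥0∞) + 1) ^ 2 *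
          (((d : ℝ≥0∞) ^ N)⁻¹ * ((2 * L) ^ 2 * treeEnergy d (nodeSq cs) J)) := by
      intro z N J hz
      by_cases hJ : J ∈ G
      · rw [if_pos hJ, if_pos hJ]
        refine ⟨hz.trans ?_, by simp⟩
        gcongr _ * (_ * ?_)
        exact (hsq J).1 hJ
      · rw [if_neg hJ, if_neg hJ]
        refine ⟨by simp, hz.trans ?_⟩
        gcongr _ * (_ * ?_)
        exact (hsq J).2 hJ
    have hL2 : 2 * L < ⊤ := ENNReal.mul_lt_top ENNReal.ofNat_lt_top hL
    have hsumb := tsum_split_head_le c (show 0 < p / 2 by positivity) k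
    have hsums := tsum_split_tail_le c (show 0 < 2 * p by positivity)
      (exists_decreasingRearrangement_lt c hp hq hc) k
    have hfinb : ∑' t, cb t ^ (p / 2) < ⊤ := by
      refine hsumb.trans_lt (ENNReal.mul_lt_top ENNReal.ofNat_lt_top (ENNReal.sum_lt_top.2
        fun i _ => ENNReal.mul_lt_top ?_ ?_))
      · exact ENNReal.rpow_lt_top_of_nonneg (by positivity) ENNReal.ofNat_ne_top
      · exact ENNReal.rpow_lt_top_of_nonneg (by positivity) (hXt i).ne
    have hfins : ∑' t, cs t ^ (2 * p) < ⊤ := by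
      refine lt_of_le_of_lt (ENNReal.tsum_le_tsum fun t => ?_) (tsum_rpow_two_mul_lt_top hp hq hc)
      rw [hcs]
      beta_reduce
      split_ifs
      · rw [ENNReal.zero_rpow_of_pos (by positivity)]
        exact zero_le
      · exact le_rfl
    obtain ⟨Tb, hTb, hTb'⟩ := h.exists_almostDiagonal_of_treeEnergy hd hL2
      (M := fun x y => if low x y ∈ G then M x y else 0) (c := cb)
      (fun N J j i => by rw [hlow1]; exact (hM _ N J (hdown N J j i)).1)
      (fun N J j i => by rw [hlow2]; exact (hM _ N J (hup N J j i)).1)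
      (fun x y h1 h2 => by simp [hzero x y h1 h2]) (show 0 < p / 2 by positivity) hfinb
    obtain ⟨Ts, hTs, hTs'⟩ := h.exists_almostDiagonal_of_treeEnergy hd hL2
      (M := fun x y => if low x y ∈ G then 0 else M x y) (c := cs)
      (fun N J j i => by rw [hlow1]; exact (hM _ N J (hdown N J j i)).2)
      (fun N J j i => by rw [hlow2]; exact (hM _ N J (hup N J j i)).2)
      (fun x y h1 h2 => by simp [hzero x y h1 h2]) (show 0 < 2 * p by positivity) hfins
    refine ⟨Tb + Ts, fun x y => ?_, ?_⟩
    · rw [add_apply, inner_add_right, hTb, hTs]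
      split_ifs <;> simp
    · have e1 : 2 ^ (k + 1) - 2 = (2 ^ k - 1) + (2 ^ k - 1) := by
        have := Nat.one_le_two_pow (n := k)
        rw [pow_succ]
        omega
      rw [e1]
      refine (approxNumber_add_le Tb Ts _ _).trans ?_
      have f1 := hTb' (2 ^ k - 1)
      have f2 := hTs' (2 ^ k - 1)
      rw [two_pow_sub_one_add_one, ← ENNReal.rpow_mul] at f1 f2
      have comb : ∀ {r : ℝ} (_ : 0 < r) (V U Z : ℝ≥0∞), U ≤ 2 * Z →
          2 ^ ((k : ℝ) * -(1 / r)) * (V * (2 * L) * U ^ (1 / r)) ≤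
            2 * (V * 2 ^ (1 / r)) * L * (2 ^ (-(k : ℝ)) * Z) ^ (1 / r) := by
        intro r hr V U Z hU
        have hr' : 0 ≤ 1 / r := by positivity
        calc _ ≤ 2 ^ ((k : ℝ) * -(1 / r)) * (V * (2 * L) * (2 * Z) ^ (1 / r)) := by gcongr
          _ = _ := by
            rw [ENNReal.mul_rpow_of_nonneg _ _ hr', ENNReal.mul_rpow_of_nonneg _ _ hr',
              ← ENNReal.rpow_mul, show (k : ℝ) * -(1 / r) = -(k : ℝ) * (1 / r) by ring]
            ring
      have g1 := f1.trans (comb (show 0 < p / 2 by positivity) _ _ _ hsumb)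
      have g2 := f2.trans (comb (show 0 < 2 * p by positivity) _ _ _ hsums)
      rw [show 1 / (p / 2) = 2 / p by field_simp, ← hW₁] at g1
      rw [← hW₂] at g2
      rw [mul_add]
      refine add_le_add (g1.trans ?_) (g2.trans ?_)
      · gcongr
        exact le_self_add
      · gcongr
        exact le_add_self
  obtain ⟨T, hT, -⟩ := key 0
  refine ⟨T, hT, ?_⟩
  -- The splitting depends on `k`, but the resulting operators share one matrix in a basis and
  -- therefore coincide.
  have hfinal := hC₀ X (approxNumber T) (2 * W * L) hXa (approxNumber_antitone T) fun k => by
    obtain ⟨T', hT', hle⟩ := key k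
    rwa [h.operator_ext fun i j => (hT i j).trans (hT' i j).symm]
  refine hfinal.trans (le_of_eq ?_)
  rw [lorentzNorm_eq]
  push_cast
  rw [ENNReal.coe_toNNReal hWt.ne]
  ring

end AlmostDiagonalLorentz

theorem lorentzNorm_comp_equiv {ι κ : Type*} (p : ℝ) (q : ℝ≥0∞) (c : ι → ℝ≥0∞) (e : κ ≃ ι) :
    lorentzNorm p q (c ∘ e) = lorentzNorm p q c := by
  have h : decreasingRearrangement (c ∘ e) = decreasingRearrangement c :=
    funext fun m => decreasingRearrangement_comp_equiv c e m
  rw [lorentzNorm_eq, lorentzNorm_eq, h]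

namespace DAdicSystem

variable {d : ℕ} {Ω : Type*} [MeasurableSpace Ω] {μ : Measure Ω} (D : DAdicSystem d μ)

/-! ### Energies and normalized Haar coefficients -/

/-- The family of normalized Haar coefficients, indexed by nodes and frequencies. -/
def haarFam (b : Ω → ℂ) : (ℤ × ℤ) × Finset.Icc 1 (d - 1) → ℝ≥0∞ :=
  D.haarSeq b ∘ Equiv.prodAssoc ℤ ℤ (Finset.Icc 1 (d - 1))

theorem lorentzNorm_haarFam (p : ℝ) (q : ℝ≥0∞) (b : Ω → ℂ) :
    lorentzNorm p q (D.haarFam b) = lorentzNorm p q (D.haarSeq b) :=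
  lorentzNorm_comp_equiv p q _ _

variable [NeZero d]

theorem measure_node_child (N : ℕ) (I : ℤ × ℤ) (l : Fin (d ^ N)) :
    μ (D.node (child d N I l)) = ((d : ℝ≥0∞) ^ N)⁻¹ * μ (D.node I) := by
  have hd0 : (d : ℝ≥0∞) ≠ 0 := by exact_mod_cast NeZero.ne d
  rw [measure_node, measure_node, child, neg_add, add_comm,
    ENNReal.zpow_add hd0 (ENNReal.natCast_ne_top d), ENNReal.zpow_neg, zpow_natCast]

theorem tsum_below_mul_measure (v : ℤ × ℤ → ℝ≥0∞) (I : ℤ × ℤ) :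
    ∑' J, (below d I).indicator (fun J => v J * μ (D.node J)) J =
      treeEnergy d v I * μ (D.node I) := by
  rw [tsum_below, treeEnergy, ← ENNReal.tsum_mul_right]
  refine tsum_congr fun N => ?_
  simp_rw [measure_node_child]
  rw [treeMean, ← Finset.sum_mul]
  ring

theorem nodeSq_haarFam_mul (b : Ω → ℂ) (J : ℤ × ℤ) :
    nodeSq (D.haarFam b) J * μ (D.node J) = ENNReal.ofReal (D.nodeEnergy b J) := by
  have h0 := D.measure_node_ne_zero J
  have ht := D.measure_node_ne_top J
  rw [nodeSq, Finset.sum_mul, nodeEnergy, ENNReal.ofReal_sum_of_nonneg fun _ _ => by positivity]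
  refine Finset.sum_congr rfl fun i _ => ?_
  change (μ (D.node J) ^ (-(1 / 2) : ℝ) * ‖D.haarCoeff b J.1 J.2 i‖ₑ) ^ 2 * _ = _
  rw [mul_pow, mul_right_comm, enorm_sq_eq_ofReal, ← ENNReal.rpow_natCast, ← ENNReal.rpow_mul]
  have h1 : μ (D.node J) ^ (-(1 / 2) * ((2 : ℕ) : ℝ)) * μ (D.node J) = 1 := by
    rw [show (-(1 / 2) * ((2 : ℕ) : ℝ)) = -1 by norm_num, ENNReal.rpow_neg_one,
      ENNReal.inv_mul_cancel h0 ht]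
  rw [h1, one_mul]

/-- Since `N` generations down the measure shrinks by `d ^ N`, sums of energies over descendants
become means of normalized coefficients. This links `b` to the abstract tree estimates. -/
theorem treeEnergy_haarFam_mul (b : Ω → ℂ) (I : ℤ × ℤ) :
    treeEnergy d (nodeSq (D.haarFam b)) I * μ (D.node I) = D.energy b I := by
  rw [← tsum_below_mul_measure, energy]
  simp_rw [nodeSq_haarFam_mul]

/-- The qualitative facts that put the wavelets into the domain of the commutator. The coefficients
lie in `ℓ_{2p}`, so their tree energy `v` lies in `ℓ_p` and is bounded; the tree energy of `v` lies
in `ℓ_p` again, which gives the second claim. -/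
theorem exists_energy_le (hd : 2 ≤ d) {p : ℝ} (hp : 0 < p) {q : ℝ≥0∞} (hq : 0 < q) {b : Ω → ℂ}
    (h : lorentzNorm p q (D.haarSeq b) < ⊤) :
    (∃ β : ℝ, 0 < β ∧ ∀ J, D.energy b J ≤ ENNReal.ofReal (β * nodeSize d J)) ∧
      ∀ I, ∑' J, (below d I).indicator (D.energy b) J < ⊤ := by
  rw [← lorentzNorm_haarFam] at h
  have h1 := tsum_rpow_two_mul_lt_top hp hq h
  set v := treeEnergy d (nodeSq (D.haarFam b)) with hv
  have h2 : ∑' J, v J ^ p < ⊤ := by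
    have h3 := tsum_treeEnergy_nodeSq_le d (D.haarFam b) (show 0 < 2 * p by positivity)
    rw [mul_div_cancel_left₀ p two_ne_zero] at h3
    exact h3.trans_lt (ENNReal.mul_lt_top (ENNReal.mul_lt_top (treeEnergyConst_lt_top hd hp)
      (ENNReal.rpow_lt_top_of_nonneg hp.le (ENNReal.natCast_ne_top _))) h1)
  have h4 : ∀ {u : ℤ × ℤ → ℝ≥0∞}, ∑' J, u J ^ p < ⊤ → ∀ J, u J < ⊤ := fun hu J => by
    have := (ENNReal.le_tsum J).trans_lt hu
    exact (ENNReal.rpow_lt_top_iff_of_pos hp).1 this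
  refine ⟨?_, fun I => ?_⟩
  · set s := (∑' J, v J ^ p) ^ p⁻¹ with hs
    have hst : s < ⊤ := ENNReal.rpow_lt_top_of_nonneg (by positivity) h2.ne
    refine ⟨s.toReal + 1, by positivity, fun J => ?_⟩
    have h5 : v J ≤ s := (ENNReal.le_rpow_inv_iff hp).2 (ENNReal.le_tsum J)
    rw [← treeEnergy_haarFam_mul, ENNReal.ofReal_mul (by positivity),
      ← D.measure_node_eq_ofReal]
    gcongr
    refine h5.trans ?_
    rw [ENNReal.ofReal_add ENNReal.toReal_nonneg zero_le_one, ENNReal.ofReal_toReal hst.ne]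
    exact le_self_add
  · have h6 : (fun J => v J * μ (D.node J)) = D.energy b := funext (D.treeEnergy_haarFam_mul b)
    rw [← h6, tsum_below_mul_measure]
    refine ENNReal.mul_lt_top (h4 ?_ I) (D.measure_node_ne_top I).lt_top
    exact (tsum_treeEnergy_rpow_le d v hp).trans_lt
      (ENNReal.mul_lt_top (treeEnergyConst_lt_top hd hp) h2)

/-! ### The commutators on the Haar basis -/

/-- The wavelets are complex in general, so conjugating `b` alters the individual coefficients. The
energy at a node depends only on the moduli of differences of means, which are unchanged. -/
theorem energy_conj {b : Ω → ℂ} (hb : D.LocallyIntegrable b) (I : ℤ × ℤ) :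
    D.energy (fun t => (starRingEnd ℂ) (b t)) I = D.energy b I := by
  have h : D.nodeEnergy (fun t => (starRingEnd ℂ) (b t)) = D.nodeEnergy b := by
    ext J
    have hb1 : IntegrableOn (fun t => (starRingEnd ℂ) (b t)) (D.node J) μ :=
      (Complex.conjLIE.integrable_comp_iff (μ := μ.restrict (D.node J)) (φ := b)).2
        (hb.integrableOn_node J)
    have h1 : ∀ K, D.avg (fun t => (starRingEnd ℂ) (b t)) K = (starRingEnd ℂ) (D.avg b K) := by
      intro K
      rw [avg, avg, setAverage_eq, setAverage_eq, integral_conj, Complex.real_smul,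
        Complex.real_smul, map_mul, Complex.conj_ofReal]
    rw [nodeEnergy, nodeEnergy, D.sum_norm_haarCoeff_sq hb1,
      D.sum_norm_haarCoeff_sq (hb.integrableOn_node J)]
    simp_rw [h1, ← map_sub, RCLike.norm_conj]
  rw [energy, energy, h]

theorem memLp_mul_haarLp (hd : 2 ≤ d) {b : Ω → ℂ} (hb : D.LocallyIntegrable b)
    (heb : ∀ J, D.energy b J < ⊤) (x : (ℤ × ℤ) × Finset.Icc 1 (d - 1)) :
    MemLp (fun t => b t * D.haarLp x t) 2 μ := by
  refine (memLp_congr_ae ?_).1 (D.memLp_haar_mul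
    (D.memLp_indicator_node hd (hb.integrableOn_node x.1) (heb x.1)) x.1 x.2)
  filter_upwards [D.coeFn_haarLp x] with t ht
  rw [ht]
  by_cases h : t ∈ D.node x.1
  · rw [Set.indicator_of_mem h, mul_comm]
  · rw [D.haar_of_notMem h, zero_mul, mul_zero]

theorem adjoint_paraproduct_haarLp {a : Ω → ℂ} {P : Lp ℂ 2 μ →L[ℂ] Lp ℂ 2 μ}
    (hP : D.HasParaproductMatrix a P) (x : (ℤ × ℤ) × Finset.Icc 1 (d - 1)) :
    ContinuousLinearMap.adjoint P (D.haarLp x) = (D.memLp_indicator_const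
      ((starRingEnd ℂ) (D.haarCoeff a x.1.1 x.1.2 x.2) / nodeSize d x.1) x.1).toLp _ := by
  refine ext_inner_right ℂ fun f => ?_
  rw [ContinuousLinearMap.adjoint_inner_left, hP, L2.inner_def]
  set c := (starRingEnd ℂ) (D.haarCoeff a x.1.1 x.1.2 x.2) / nodeSize d x.1 with hc
  have h : (fun t => inner ℂ ((D.memLp_indicator_const c x.1).toLp _ t) (f t)) =ᵐ[μ]
      (D.node x.1).indicator fun t => (starRingEnd ℂ) c * f t := by
    filter_upwards [(D.memLp_indicator_const c x.1).coeFn_toLp] with t ht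
    rw [ht, RCLike.inner_apply, mul_comm]
    by_cases h : t ∈ D.node x.1
    · rw [Set.indicator_of_mem h, Set.indicator_of_mem h]
    · rw [Set.indicator_of_notMem h, Set.indicator_of_notMem h, map_zero, zero_mul]
  have h0 : (nodeSize d x.1 : ℂ) ≠ 0 := by exact_mod_cast (nodeSize_pos x.1).ne'
  rw [integral_congr_ae h, integral_indicator (D.measurableSet_node _), integral_const_mul,
    setIntegral_node, hc, map_div₀, Complex.conj_conj, Complex.conj_ofReal]
  field_simp

theorem memLp_mul_adjoint_haarLp (hd : 2 ≤ d) {a b : Ω → ℂ} (hb : D.LocallyIntegrable b)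
    (heb : ∀ J, D.energy b J < ⊤) {P : Lp ℂ 2 μ →L[ℂ] Lp ℂ 2 μ}
    (hP : D.HasParaproductMatrix a P) (x : (ℤ × ℤ) × Finset.Icc 1 (d - 1)) :
    MemLp (fun t => b t * ContinuousLinearMap.adjoint P (D.haarLp x) t) 2 μ := by
  set c := (starRingEnd ℂ) (D.haarCoeff a x.1.1 x.1.2 x.2) / nodeSize d x.1 with hc
  refine (memLp_congr_ae ?_).1
    ((D.memLp_indicator_node hd (hb.integrableOn_node x.1) (heb x.1)).const_mul c)
  rw [D.adjoint_paraproduct_haarLp hP]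
  filter_upwards [(D.memLp_indicator_const c x.1).coeFn_toLp] with t ht
  rw [ht]
  by_cases h : t ∈ D.node x.1
  · rw [Set.indicator_of_mem h, Set.indicator_of_mem h, mul_comm]
  · rw [Set.indicator_of_notMem h, Set.indicator_of_notMem h, mul_zero, mul_zero]

/-- On a child `L`, `b` times the deviation of `a` is the product of the two deviations plus a
constant multiple of the deviation of `a`. -/
theorem memLp_mul_paraHaar (hd : 2 ≤ d) {a b : Ω → ℂ} {α β : ℝ}
    (ha : D.LocallyIntegrable a) (hb : D.LocallyIntegrable b) (hα : 0 < α) (hβ : 0 < β)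
    (hea : ∀ J, D.energy a J ≤ ENNReal.ofReal (α * nodeSize d J))
    (heb : ∀ J, D.energy b J ≤ ENNReal.ofReal (β * nodeSize d J))
    (hbb : ∀ I, ∑' J, (below d I).indicator (D.energy b) J < ⊤) (K : ℤ × ℤ) (i : ℕ) :
    MemLp (fun t => b t * D.paraHaar a K i t) 2 μ := by
  have h1 : ∀ l, MemLp (fun t => b t * D.dev a (kid d K l) t) 2 μ := by
    intro l
    set L := kid d K l with hL
    refine (memLp_congr_ae (Eventually.of_forall fun t => ?_)).1
      ((D.memLp_dev_mul_dev hd ha hb hα hβ hea heb hbb L).add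
        ((D.memLp_dev hd (ha.integrableOn_node L)
          ((hea L).trans_lt ENNReal.ofReal_lt_top)).const_mul (D.avg b L)))
    rw [Pi.add_apply]
    by_cases h : t ∈ D.node L
    · rw [D.dev_of_mem (g := b) h]
      ring
    · rw [D.dev_of_notMem (g := a) h]
      ring
  refine (memLp_congr_ae (Eventually.of_forall fun t => ?_)).1
    (memLp_finsetSum Finset.univ fun l _ => (h1 l).const_mul (haarVal d K i l))
  simp only [paraHaar, Finset.mul_sum]
  exact Finset.sum_congr rfl fun l _ => by ring

theorem inner_commutator_eq_commMatrix (hd : 2 ≤ d) {a b : Ω → ℂ}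
    (ha : D.LocallyIntegrable a) (hea : ∀ J, D.energy a J < ⊤)
    {P : Lp ℂ 2 μ →L[ℂ] Lp ℂ 2 μ} (hP : D.HasParaproductMatrix a P)
    (x y : (ℤ × ℤ) × Finset.Icc 1 (d - 1))
    (h₁ : MemLp (fun t => b t * D.haarLp y t) 2 μ)
    (h₂ : MemLp (fun t => b t * P (D.haarLp y) t) 2 μ) :
    inner ℂ (D.haarLp x) (P (h₁.toLp _)) - inner ℂ (D.haarLp x) (h₂.toLp _) =
      D.commMatrix a b x y := by
  have e1 : D.avg (h₁.toLp _) x.1 = D.avg (fun t => b t * D.haar y.1.1 y.1.2 y.2 t) x.1 := by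
    refine D.avg_congr_ae ?_ _
    filter_upwards [h₁.coeFn_toLp, D.coeFn_haarLp y] with t h3 h4
    rw [h3, h4]
  have e2 : D.haarCoeff (fun t => b t * P (D.haarLp y) t) x.1.1 x.1.2 x.2 =
      D.haarCoeff (fun t => b t * D.paraHaar a y.1 y.2 t) x.1.1 x.1.2 x.2 := by
    refine D.haarCoeff_congr_ae ?_ _ _
    rw [D.paraproduct_haarLp hd ha hea hP]
    filter_upwards [(D.memLp_paraHaar hd ha hea y.1 y.2).coeFn_toLp] with t h3
    rw [h3]
  rw [hP, inner_haarLp_toLp, commMatrix, e1, e2]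

end DAdicSystem

/-! ### Assembly of the commutator estimates -/

namespace DAdicSystem

section

variable {d : ℕ} {Ω : Type*} [MeasurableSpace Ω] {μ : Measure Ω} (D : DAdicSystem d μ) [NeZero d]

theorem treeEnergy_haarFam {b : Ω → ℂ} {J : ℤ × ℤ} (h : D.energy b J < ⊤) :
    treeEnergy d (nodeSq (D.haarFam b)) J =
      ENNReal.ofReal ((D.energy b J).toReal / nodeSize d J) := by
  rw [ENNReal.ofReal_div_of_pos (nodeSize_pos J), ENNReal.ofReal_toReal h.ne,
    ← D.measure_node_eq_ofReal, ← treeEnergy_haarFam_mul,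
    ENNReal.mul_div_cancel_right (D.measure_node_ne_zero J) (D.measure_node_ne_top J)]

/-- Translation into the form of the abstract theorem: `|anc N J| = d ^ N |J|` supplies the decay,
and `L = 2 d A` accommodates both entry bounds. -/
theorem enorm_sq_le_of_norm_sq_le {b : Ω → ℂ} {J : ℤ × ℤ} (h : D.energy b J < ⊤) {N : ℕ} {A : ℝ}
    (hA : 0 ≤ A) {z : ℂ} (hz : ‖z‖ ^ 2 ≤ 4 * (d : ℝ) ^ 2 * A ^ 2 * ((N : ℝ) + 1) ^ 2 *
      ((D.energy b J).toReal / nodeSize d (anc d N J))) :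
    ‖z‖ₑ ^ 2 ≤ ((N : ℝ≥0∞) + 1) ^ 2 * (((d : ℝ≥0∞) ^ N)⁻¹ *
      (((2 * d : ℝ≥0∞) * ENNReal.ofReal A) ^ 2 * treeEnergy d (nodeSq (D.haarFam b)) J)) := by
  have hd0 : (0 : ℝ) < d := by exact_mod_cast NeZero.pos d
  have hσ := nodeSize_pos (d := d) J
  have e : ((N : ℝ≥0∞) + 1) ^ 2 * (((d : ℝ≥0∞) ^ N)⁻¹ *
      (((2 * d : ℝ≥0∞) * ENNReal.ofReal A) ^ 2 * treeEnergy d (nodeSq (D.haarFam b)) J)) =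
      ENNReal.ofReal (((N : ℝ) + 1) ^ 2 * (((d : ℝ) ^ N)⁻¹ *
        ((2 * d * A) ^ 2 * ((D.energy b J).toReal / nodeSize d J)))) := by
    rw [D.treeEnergy_haarFam h, ENNReal.ofReal_mul (by positivity),
      ENNReal.ofReal_mul (by positivity), ENNReal.ofReal_mul (by positivity),
      ENNReal.ofReal_pow (by positivity), ENNReal.ofReal_pow (by positivity),
      ENNReal.ofReal_inv_of_pos (by positivity), ENNReal.ofReal_pow hd0.le,
      ENNReal.ofReal_mul (by positivity), ENNReal.ofReal_mul (by positivity),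
      ENNReal.ofReal_add (by positivity) zero_le_one, ENNReal.ofReal_natCast,
      ENNReal.ofReal_natCast, ENNReal.ofReal_one, ENNReal.ofReal_ofNat]
  rw [e, enorm_sq_eq_ofReal]
  refine ENNReal.ofReal_le_ofReal (hz.trans_eq ?_)
  rw [nodeSize_anc]
  field_simp
  ring

theorem energy_le_ofReal_bmoNorm {a : Ω → ℂ} (ha : D.MemBMO a) (J : ℤ × ℤ) :
    D.energy a J ≤ ENNReal.ofReal ((D.bmoNorm a).toReal ^ 2 * nodeSize d J) := by
  rw [ENNReal.ofReal_mul (by positivity), ← D.measure_node_eq_ofReal,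
    ENNReal.ofReal_pow ENNReal.toReal_nonneg, ENNReal.ofReal_toReal ha.2.ne]
  exact D.energy_le_bmoNorm_sq_mul ha.1 J

theorem enorm_commMatrix_up_sq_le (hd : 2 ≤ d) {a b : Ω → ℂ} (ha : D.MemBMO a)
    (hb : D.LocallyIntegrable b) (heb : ∀ J, D.energy b J < ⊤) (N : ℕ) (J : ℤ × ℤ)
    (j i : Finset.Icc 1 (d - 1)) :
    ‖D.commMatrix a b (anc d N J, i) (J, j)‖ₑ ^ 2 ≤ ((N : ℝ≥0∞) + 1) ^ 2 * (((d : ℝ≥0∞) ^ N)⁻¹ *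
      (((2 * d : ℝ≥0∞) * D.bmoNorm a) ^ 2 * treeEnergy d (nodeSq (D.haarFam b)) J)) := by
  rw [← ENNReal.ofReal_toReal ha.2.ne]
  refine D.enorm_sq_le_of_norm_sq_le (heb J) ENNReal.toReal_nonneg ?_
  refine (D.norm_commMatrix_up_sq_le hd ha.1 hb (D.energy_le_ofReal_bmoNorm ha) heb
    ⟨N, rfl⟩).trans ?_
  have hd1 : (1 : ℝ) ≤ (d : ℝ) ^ 2 := by
    have : (1 : ℝ) ≤ d := by exact_mod_cast NeZero.one_le
    exact one_le_pow₀ this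
  have hN : (1 : ℝ) ≤ ((N : ℝ) + 1) ^ 2 := one_le_pow₀ (by simp)
  have hσ := nodeSize_pos (d := d) (anc d N J)
  refine mul_le_mul_of_nonneg_right ?_ (by positivity)
  calc 4 * (D.bmoNorm a).toReal ^ 2 = 4 * 1 * (D.bmoNorm a).toReal ^ 2 * 1 := by ring
    _ ≤ _ := by gcongr

theorem enorm_commMatrix_down_sq_le (hd : 2 ≤ d) {a b : Ω → ℂ} (ha : D.MemBMO a)
    (hb : D.LocallyIntegrable b) (heb : ∀ J, D.energy b J < ⊤) (N : ℕ) (J : ℤ × ℤ)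
    (j i : Finset.Icc 1 (d - 1)) :
    ‖D.commMatrix a b (J, j) (anc d N J, i)‖ₑ ^ 2 ≤ ((N : ℝ≥0∞) + 1) ^ 2 * (((d : ℝ≥0∞) ^ N)⁻¹ *
      (((2 * d : ℝ≥0∞) * D.bmoNorm a) ^ 2 * treeEnergy d (nodeSq (D.haarFam b)) J)) := by
  cases N with
  | zero =>
    -- On the diagonal the strict descent needed for the downward bound fails, and the upward bound
    -- is used.
    have := D.enorm_commMatrix_up_sq_le hd ha hb heb 0 J i j
    rwa [anc_zero] at this ⊢
  | succ n =>
    rw [← ENNReal.ofReal_toReal ha.2.ne]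
    refine D.enorm_sq_le_of_norm_sq_le (heb J) ENNReal.toReal_nonneg ?_
    refine (D.norm_commMatrix_down_sq_le hd ha.1 hb ENNReal.toReal_nonneg
      (D.energy_le_ofReal_bmoNorm ha) heb rfl).trans ?_
    have hd1 : (d : ℝ) ≤ (d : ℝ) ^ 2 := by
      have : (1 : ℝ) ≤ d := by exact_mod_cast NeZero.one_le
      exact le_self_pow₀ this two_ne_zero
    have hσ := nodeSize_pos (d := d) (anc d (n + 1) J)
    refine mul_le_mul_of_nonneg_right ?_ (by positivity)
    push_cast
    gcongr
    · norm_num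
    · simp

end

/-- The entry bounds see only energies, so the Lorentz norm of `b` also controls commutators with
any `b'` of equal energies. The two cases needed are `b` itself and its conjugate. -/
theorem exists_operator_commMatrix {d : ℕ} (hd : 2 ≤ d) [NeZero d] {p : ℝ} (hp : 0 < p)
    {q : ℝ≥0∞} (hq : 0 < q) :
    ∃ C : ℝ≥0, ∀ (Ω : Type*) [MeasurableSpace Ω] (μ : Measure Ω) (D : DAdicSystem d μ)
      (a b b' : Ω → ℂ), D.MemBMO a → D.LocallyIntegrable b' → D.energy b' = D.energy b →
      lorentzNorm p q (D.haarSeq b) < ⊤ →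
      ∃ T : Lp ℂ 2 μ →L[ℂ] Lp ℂ 2 μ,
        (∀ x y, inner ℂ (D.haarLp x) (T (D.haarLp y)) = D.commMatrix a b' x y) ∧
        lorentzSeqNorm p q (approxNumber T) ≤
          C * D.bmoNorm a * lorentzNorm p q (D.haarSeq b) := by
  obtain ⟨C, hC⟩ :=
    HilbertBasis.exists_almostDiagonal_lorentz hd (Finset.Icc 1 (d - 1)) hp hq
  refine ⟨C * (2 * d), fun Ω _ μ D a b b' ha hb' he hc => ?_⟩
  obtain ⟨h, hh⟩ := D.exists_haarBasis hd
  obtain ⟨⟨β, -, hβ⟩, -⟩ := D.exists_energy_le hd hp hq hc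
  have heb : ∀ J, D.energy b J < ⊤ := fun J => (hβ J).trans_lt ENNReal.ofReal_lt_top
  have hw : treeEnergy d (nodeSq (D.haarFam b')) = treeEnergy d (nodeSq (D.haarFam b)) := by
    ext J
    rw [D.treeEnergy_haarFam (heb J), D.treeEnergy_haarFam (he ▸ heb J), he]
  obtain ⟨T, hT, hTn⟩ := hC (Lp ℂ 2 μ) h (D.commMatrix a b') (D.haarFam b)
    ((2 * d : ℝ≥0∞) * D.bmoNorm a)
    (ENNReal.mul_lt_top (ENNReal.mul_lt_top ENNReal.ofNat_lt_top (ENNReal.natCast_lt_top d)) ha.2)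
    (fun N J j i => by
      rw [← hw]
      exact D.enorm_commMatrix_down_sq_le hd ha hb' (fun J => he ▸ heb J) N J j i)
    (fun N J j i => by
      rw [← hw]
      exact D.enorm_commMatrix_up_sq_le hd ha hb' (fun J => he ▸ heb J) N J j i)
    (fun x y hxy hyx => D.commMatrix_eq_zero a b' (by
      rcases D.below_or_below_or_disjoint x.1 y.1 with ⟨N, hN⟩ | ⟨N, hN⟩ | hd
      · exact absurd hN (hxy N)
      · exact absurd hN (hyx N)
      · exact hd))
    ((D.lorentzNorm_haarFam p q b).trans_lt hc)
  refine ⟨T, fun x y => by rw [← hh, ← hh, hT], hTn.trans_eq ?_⟩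
  rw [lorentzNorm_haarFam]
  push_cast
  ring

theorem exists_commutators {d : ℕ} (hd : 2 ≤ d) [NeZero d] {p : ℝ} (hp : 0 < p)
    {q : ℝ≥0∞} (hq : 0 < q) :
    ∃ C : ℝ≥0, ∀ (Ω : Type*) [MeasurableSpace Ω] (μ : Measure Ω) (D : DAdicSystem d μ)
      (a b : Ω → ℂ), D.MemBMO a → D.LocallyIntegrable b → lorentzNorm p q (D.haarSeq b) < ⊤ →
      ∃ P : Lp ℂ 2 μ →L[ℂ] Lp ℂ 2 μ, D.IsParaproduct a P ∧
        (∃ T : Lp ℂ 2 μ →L[ℂ] Lp ℂ 2 μ, IsCommutator P b T ∧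
          lorentzSeqNorm p q (approxNumber T) ≤
            C * D.bmoNorm a * lorentzNorm p q (D.haarSeq b)) ∧
        (∃ T : Lp ℂ 2 μ →L[ℂ] Lp ℂ 2 μ, IsCommutator (ContinuousLinearMap.adjoint P) b T ∧
          lorentzSeqNorm p q (approxNumber T) ≤
            C * D.bmoNorm a * lorentzNorm p q (D.haarSeq b)) := by
  obtain ⟨C, hC⟩ := exists_operator_commMatrix hd hp hq
  refine ⟨C, fun Ω _ μ D a b ha hb hc => ?_⟩
  obtain ⟨h, hh⟩ := D.exists_haarBasis hd
  obtain ⟨⟨β, hβ, heb⟩, hbb⟩ := D.exists_energy_le hd hp hq hc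
  -- The summand `1` only makes the Carleson constant positive when the `BMO` norm vanishes; it does
  -- not enter the final estimate.
  set α : ℝ := (D.bmoNorm a).toReal ^ 2 + 1 with hα
  have hα0 : 0 < α := by positivity
  have hea : ∀ J, D.energy a J ≤ ENNReal.ofReal (α * nodeSize d J) := fun J => by
    refine (D.energy_le_ofReal_bmoNorm ha J).trans (ENNReal.ofReal_le_ofReal ?_)
    have := nodeSize_pos (d := d) J
    gcongr
    rw [hα]
    linarith
  have hea' : ∀ J, D.energy a J < ⊤ := fun J => (hea J).trans_lt ENNReal.ofReal_lt_top
  obtain ⟨P, hP⟩ := D.exists_hasParaproductMatrix hd hα0 hea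
  -- The functions needed for the commutator with a function of the same energies as `b`.
  have hmem : ∀ b' : Ω → ℂ, D.LocallyIntegrable b' → D.energy b' = D.energy b →
      (∀ x, MemLp (fun t => b' t * h x t) 2 μ) ∧ (∀ x, MemLp (fun t => b' t * P (h x) t) 2 μ) ∧
      (∀ x, MemLp (fun t => b' t * ContinuousLinearMap.adjoint P (h x) t) 2 μ) := by
    intro b' hb' he
    have heb' : ∀ J, D.energy b' J < ⊤ := fun J => by
      rw [he]
      exact (heb J).trans_lt ENNReal.ofReal_lt_top
    refine ⟨fun x => hh x ▸ D.memLp_mul_haarLp hd hb' heb' x, fun x => ?_,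
      fun x => hh x ▸ D.memLp_mul_adjoint_haarLp hd hb' heb' hP x⟩
    refine (memLp_congr_ae ?_).1 (D.memLp_mul_paraHaar hd ha.1 hb' hα0 hβ hea
      (fun J => he ▸ heb J) (fun I => he ▸ hbb I) x.1 x.2)
    rw [hh, D.paraproduct_haarLp hd ha.1 hea' hP]
    filter_upwards [(D.memLp_paraHaar hd ha.1 hea' x.1 x.2).coeFn_toLp] with t ht
    rw [ht]
  have hT : ∀ (b' : Ω → ℂ) (T : Lp ℂ 2 μ →L[ℂ] Lp ℂ 2 μ),
      (∀ x y, inner ℂ (D.haarLp x) (T (D.haarLp y)) = D.commMatrix a b' x y) →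
      ∀ (h₁ : ∀ x, MemLp (fun t => b' t * h x t) 2 μ)
        (h₂ : ∀ x, MemLp (fun t => b' t * P (h x) t) 2 μ) x y,
      inner ℂ (h x) (T (h y)) =
        inner ℂ (h x) (P ((h₁ y).toLp _)) - inner ℂ (h x) ((h₂ y).toLp _) := by
    intro b' T hT h₁ h₂ x y
    have e := D.inner_commutator_eq_commMatrix (b := b') hd ha.1 hea' hP x y
      (hh y ▸ h₁ y) (hh y ▸ h₂ y)
    simp only [hh]
    rw [hT, ← e]
  refine ⟨P, D.isParaproduct_of_hasParaproductMatrix hd ha.1 hP, ?_, ?_⟩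
  · obtain ⟨T, hT1, hT2⟩ := hC Ω μ D a b b ha hb rfl hc
    obtain ⟨m1, m2, m3⟩ := hmem b hb rfl
    exact ⟨T, isCommutator_of_matrix h m1 m2 m3 (hT b T hT1 m1 m2), hT2⟩
  · have hb' : D.LocallyIntegrable fun t => (starRingEnd ℂ) (b t) := fun n k =>
      (Complex.conjLIE.integrable_comp_iff (μ := μ.restrict (D.I n k)) (φ := b)).2 (hb n k)
    have he : D.energy (fun t => (starRingEnd ℂ) (b t)) = D.energy b := funext (D.energy_conj hb)
    obtain ⟨T, hT1, hT2⟩ := hC Ω μ D a b _ ha hb' he hc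
    obtain ⟨m1, m2, m3⟩ := hmem _ hb' he
    refine ⟨-ContinuousLinearMap.adjoint T,
      isCommutator_adjoint_of_matrix h m1 m2 m3 (hT _ T hT1 m1 m2), ?_⟩
    have e : approxNumber (-ContinuousLinearMap.adjoint T) = approxNumber T := funext fun m => by
      rw [approxNumber_neg, approxNumber_adjoint]
    rwa [e]

theorem lorentzNorm_haarSeq_le_besovNorm {d : ℕ} {Ω : Type*} [MeasurableSpace Ω] {μ : Measure Ω}
    (D : DAdicSystem d μ) {p : ℝ} (hp : 0 < p) {b : Ω → ℂ} (h : D.besovNorm p b < ⊤) :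
    lorentzNorm p (ENNReal.ofReal p) (D.haarSeq b) ≤ D.besovNorm p b := by
  have h1 : ∀ t, D.haarSeq b t ^ p =
      ‖D.haarCoeff b t.1 t.2.1 t.2.2‖ₑ ^ p / μ (D.I t.1 t.2.1) ^ (p / 2) := by
    intro t
    rw [haarSeq, ENNReal.mul_rpow_of_nonneg _ _ hp.le, ← ENNReal.rpow_mul, mul_comm,
      show -(1 / 2) * p = -(p / 2) by ring, ENNReal.rpow_neg, ← div_eq_mul_inv]
  have h2 : D.besovNorm p b = (∑' t, D.haarSeq b t ^ p) ^ (1 / p) := by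
    simp_rw [h1]
    rfl
  rw [h2] at h ⊢
  exact lorentzNorm_self_le _ hp ((ENNReal.rpow_lt_top_iff_of_pos (by positivity)).1 h)

end DAdicSystem

/-- A finite Lorentz norm forces the approximation numbers to tend to zero, which gives both
compactness and a singular value decomposition. -/
theorem memSchattenLorentz_and_le {H : Type*} [NormedAddCommGroup H] [InnerProductSpace ℂ H]
    [CompleteSpace H] {p : ℝ} (hp : 0 < p) {q : ℝ≥0∞} (hq : 0 < q) {T : H →L[ℂ] H} {K : ℝ≥0∞}
    (hK : K < ⊤) (h : lorentzSeqNorm p q (approxNumber T) ≤ K) :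
    MemSchattenLorentz p q T ∧ schattenLorentzNorm p q T ≤ K := by
  have h1 : ∀ ε > 0, ∃ m, approxNumber T m < ε := fun ε hε =>
    let ⟨i, hi⟩ := exists_lt_of_lorentzSeqNorm_lt_top hp hq (approxNumber_antitone T)
      (h.trans_lt hK) ε hε
    ⟨_, hi⟩
  have h2 := (schattenLorentzNorm_le (p := p) (q := q) h1).trans h
  exact ⟨⟨isCompactOperator_of_approxNumber h1, h2.trans_lt hK⟩, h2⟩

end

theorem proposition3p3 (d : ℕ) (hd : 2 ≤ d) (p : ℝ) (hp : 0 < p) :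
    (∀ q : ℝ≥0∞, 0 < q → ∃ C : ℝ≥0,
      ∀ (Ω : Type*) [MeasurableSpace Ω] (μ : Measure Ω) (D : DAdicSystem d μ) (a b : Ω → ℂ),
        D.MemBMO a → D.LocallyIntegrable b → lorentzNorm p q (D.haarSeq b) < ⊤ →
        ∃ P : Lp ℂ 2 μ →L[ℂ] Lp ℂ 2 μ, D.IsParaproduct a P ∧
          (∃ T : Lp ℂ 2 μ →L[ℂ] Lp ℂ 2 μ, IsCommutator P b T ∧
            MemSchattenLorentz p q T ∧
            schattenLorentzNorm p q T ≤ C * D.bmoNorm a * lorentzNorm p q (D.haarSeq b)) ∧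
          (∃ T : Lp ℂ 2 μ →L[ℂ] Lp ℂ 2 μ, IsCommutator (ContinuousLinearMap.adjoint P) b T ∧
            MemSchattenLorentz p q T ∧
            schattenLorentzNorm p q T ≤ C * D.bmoNorm a * lorentzNorm p q (D.haarSeq b))) ∧
    (∃ C : ℝ≥0,
      ∀ (Ω : Type*) [MeasurableSpace Ω] (μ : Measure Ω) (D : DAdicSystem d μ) (a b : Ω → ℂ),
        D.MemBMO a → D.MemBesov p b →
        ∃ P : Lp ℂ 2 μ →L[ℂ] Lp ℂ 2 μ, D.IsParaproduct a P ∧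
          (∃ T : Lp ℂ 2 μ →L[ℂ] Lp ℂ 2 μ, IsCommutator P b T ∧
            MemSchattenLorentz p (ENNReal.ofReal p) T ∧
            schattenLorentzNorm p (ENNReal.ofReal p) T ≤ C * D.bmoNorm a * D.besovNorm p b) ∧
          (∃ T : Lp ℂ 2 μ →L[ℂ] Lp ℂ 2 μ, IsCommutator (ContinuousLinearMap.adjoint P) b T ∧
            MemSchattenLorentz p (ENNReal.ofReal p) T ∧
            schattenLorentzNorm p (ENNReal.ofReal p) T ≤ C * D.bmoNorm a * D.besovNorm p b)) := by
  have : NeZero d := ⟨by omega⟩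
  refine ⟨fun q hq => ?_, ?_⟩
  · obtain ⟨C, hC⟩ := DAdicSystem.exists_commutators hd hp hq
    refine ⟨C, fun Ω _ μ D a b ha hb hc => ?_⟩
    have hK : C * D.bmoNorm a * lorentzNorm p q (D.haarSeq b) < ⊤ :=
      ENNReal.mul_lt_top (ENNReal.mul_lt_top ENNReal.coe_lt_top ha.2) hc
    obtain ⟨P, hP, ⟨T, hT, hT'⟩, S, hS, hS'⟩ := hC Ω μ D a b ha hb hc
    exact ⟨P, hP, ⟨T, hT, memSchattenLorentz_and_le hp hq hK hT'⟩,
      S, hS, memSchattenLorentz_and_le hp hq hK hS'⟩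
  · have hq : 0 < ENNReal.ofReal p := ENNReal.ofReal_pos.2 hp
    obtain ⟨C, hC⟩ := DAdicSystem.exists_commutators hd hp hq
    refine ⟨C, fun Ω _ μ D a b ha hb => ?_⟩
    have hK : C * D.bmoNorm a * D.besovNorm p b < ⊤ :=
      ENNReal.mul_lt_top (ENNReal.mul_lt_top ENNReal.coe_lt_top ha.2) hb.2
    have hle := D.lorentzNorm_haarSeq_le_besovNorm hp hb.2
    have hle' : C * D.bmoNorm a * lorentzNorm p (ENNReal.ofReal p) (D.haarSeq b) ≤
      C * D.bmoNorm a * D.besovNorm p b := mul_le_mul_right hle _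
    obtain ⟨P, hP, ⟨T, hT, hT'⟩, S, hS, hS'⟩ := hC Ω μ D a b ha hb.1 (hle.trans_lt hb.2)
    exact ⟨P, hP, ⟨T, hT, memSchattenLorentz_and_le hp hq hK (hT'.trans hle')⟩,
      S, hS, memSchattenLorentz_and_le hp hq hK (hS'.trans hle')⟩
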